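/- Let $q=e^{\eta}$ with $\eta\in\mathbb C$, write $q^{c}=e^{\eta c}$, and let $\alpha\in\mathbb C$; assume $q^4\neq1$ and $q^{2(\alpha+m)}\neq 1$ for all $m\in\mathbb Z$. For a chain segment $[k,l]$ of $n=l-k+1\ge 0$ sites let $\mathcal H_{[k,l]}=(\mathbb C^2)^{\otimes n}$, $S_{[k,l]}=\frac12\sum_{j=k}^l\sigma_j^z$, $\mathbb S X=[S_{[k,l]},X]$ and $\mathbb J X=JXJ$ with $J=\prod_{j=k}^l\sigma_j^x$. Let $R(\zeta)$ be the six-vertex $R$-matrix with weights $1$, $\beta(\zeta)=\frac{(1-\zeta^2)q}{1-q^2\zeta^2}$, $\gamma(\zeta)=\frac{(1-q^2)\zeta}{1-q^2\zeta^2}$, and let $\mathbf a,\mathbf a^*,q^{\pm D}$ be the $q$-oscillators acting on $W^+=\bigoplus_{k\ge0}\mathbb C|k\rangle$ by $q^D|k\rangle=q^k|k\rangle$, $\mathbf a|k\rangle=(1-q^{2k})|k-1\rangle$, $\mathbf a^*|k\rangle=|k+1\rangle$. Put (scalar normalisations drop out below) $$L_{a,j}(\zeta)=R_{a,j}(\zeta),\qquad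 L_{A,j}(\zeta)=\begin{pmatrix}1-\zeta^2q^{2D_A+2}&-\zeta\mathbf a_A\\-\zeta\mathbf a_A^*&1\end{pmatrix}_j\begin{pmatrix}q^{-D_A}&0\\0&q^{D_A}\end{pmatrix}_j ,$$ $\mathbb L_{\cdot,j}(\zeta)Y=L_{\cdot,j}(\zeta)\,Y\,L_{\cdot,j}(\zeta)^{-1}$, and $\mathbb T_{a}(\zeta,\alpha)Y=\mathbb L_{a,l}(\zeta)\cdots\mathbb L_{a,k}(\zeta)\,q^{\alpha\sigma^z_a}Y$, $\mathbb T_{A}(\zeta,\alpha)Y=\mathbb L_{A,l}(\zeta)\cdots\mathbb L_{A,k}(\zeta)\,q^{2\alpha D_A}Y$. For $X\in\operatorname{End}\mathcal H_{[k,l]}$ define $$\mathbf k(\zeta,\alpha)X=\operatorname{tr}_{A,a}\bigl\{\sigma_a^+\,\mathbb T_a(\zeta,\alpha)\,\mathbb T_A(\zeta,\alpha)\,\zeta^{\alpha-\mathbb S}\bigl(\mathrm{id}_{A,a}\otimes q^{-2S_{[k,l]}}X\bigr)\bigr\},$$ where $\operatorname{tr}_A$ is the trace over $W^+$, continued rationally,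 so that $\operatorname{tr}_A q^{2\alpha D+mD}=1/(1-q^{2\alpha+m})$. For $X$ of spin $s$ (i.e. $\mathbb SX=sX$) let $\mathbf k_{\rm skal}(\zeta,\alpha)X=\zeta^{-\alpha-s-1}\mathbf k(\zeta,\alpha)X$, a function of $\zeta^2$, let $\rho^{(\pm)}_j(\alpha)X$ be the coefficient of $(\zeta^2-q^{\pm2})^{-j}$ in its Laurent expansion at $\zeta^2=q^{\pm2}$, and define the annihilation modes $c_{p,[k,l]}(\alpha)$, $b_{p,[k,l]}(\alpha)$, $p\ge0$, by $$c_p(\alpha)X=\tfrac12\bigl(q^{2p-\alpha-s-1}\rho_p^{(-)}(\alpha)+q^{\alpha+s+1-2p}\rho_p^{(+)}(\alpha)\bigr)X\quad(p\ge1),\qquad c_0(\alpha)=\tfrac12\sum_{j=1}^n(-1)^{j-1}c_j(\alpha),$$ $$b_p(\alpha)=-q^{-1}\bigl(q^{\alpha-\mathbb S-1}-q^{-\alpha+\mathbb S+1}\bigr)\,\mathbb J\,c_p(-\alpha)\,\mathbb J ,$$ extended linearly to $\operatorname{End}\mathcal H_{[k,l]}$. Then, for $x=b,c$ and every $p\ge0$,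 the following hold. (i) For all segments $[k,l]$ with $n=l-k+1$ sites, all $m\ge0$ and all $X_{[k,l]}\in\operatorname{End}\mathcal H_{[k,l]}$, $$x_{p,[k,l+m]}(\alpha)\bigl(X_{[k,l]}\otimes\mathrm{id}_{[l+1,l+m]}\bigr)=\begin{cases}\bigl(x_{p,[k,l]}(\alpha)X_{[k,l]}\bigr)\otimes\mathrm{id}_{[l+1,l+m]}& p\le n,\\ 0& p>n.\end{cases}$$ (ii) There is exactly one linear operator $x_{p,[k,\infty)}(\alpha)$ on the space of local operators $X_{[k,l]}\otimes\mathrm{id}_{[l+1,\infty)}$, $l\ge k-1$, of the semi-infinite chain $[k,\infty)$ such that $x_{p,[k,\infty)}(\alpha)(X_{[k,l]}\otimes\mathrm{id}_{[l+1,\infty)})=(x_{p,[k,l]}(\alpha)X_{[k,l]})\otimes\mathrm{id}_{[l+1,\infty)}$ for all $l$ and all $X_{[k,l]}$. (iii) This operator satisfies, with $n=l-k+1$, $$x_{p,[k,\infty)}(\alpha)\bigl(X_{[k,l]}\otimes\mathrm{id}_{[l+1,\infty)}\bigr)=\begin{cases}\bigl(x_{p,[k,l]}(\alpha)X_{[k,l]}\bigr)\otimes\mathrm{id}_{[l+1,\infty)}&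 p\le n,\\ 0& p>n.\end{cases}$$ In particular, if $\ell(X)$ denotes the smallest $n$ such that the local operator $X$ on $[k,\infty)$ is of the form $X_{[k,k+n-1]}\otimes\mathrm{id}_{[k+n,\infty)}$, then $x_{p,[k,\infty)}(\alpha)X=0$ for all $p>\ell(X)$. -/

import Mathlib

noncomputable section

namespace XXZ

/-! Conventions: `q = exp η` and `q ^ c = exp (η * c)`, so that all complex powers of `q` refer to
one fixed logarithm `η`. Spin up is `0 : Fin 2`, spin down is `1 : Fin 2`. A chain segment
`[k, l]` enters only through its number of sites `n = l - k + 1`; site `k + i` is `i : Fin n`. -/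

/-- The complex power `q ^ c` for `q = exp η`. -/
def qpow (η c : ℂ) : ℂ := Complex.exp (η * c)

/-- Spin configurations of `n` sites; they label the standard basis of `(ℂ²)^{⊗ n}`. -/
abbrev Cfg (n : ℕ) : Type := Fin n → Fin 2

/-- `End H_{[k,l]}` for a segment of `n` sites, as matrices in the standard basis. -/
abbrev SegOp (n : ℕ) : Type := Matrix (Cfg n) (Cfg n) ℂ

/-- Eigenvalue of `S^z = (1/2) ∑ σ_j^z` on a basis vector. -/
def spinZ {n : ℕ} (σ : Cfg n) : ℂ := ∑ i, (if σ i = 0 then (1 / 2 : ℂ) else -(1 / 2))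

/-- The function `f(𝕊)` of the adjoint spin operator `𝕊 = [S^z, · ]`: matrix units are
eigenvectors of `𝕊`, with the difference of the two `S^z`-values as eigenvalue. In particular an
operator of spin `s` is multiplied by `f s`. -/
def spinFun {n : ℕ} (f : ℂ → ℂ) (X : SegOp n) : SegOp n :=
  fun σ τ => f (spinZ σ - spinZ τ) * X σ τ

/-- Spin reversal `X ↦ J X J`, `J = ∏ σ_j^x`. -/
def spinFlip {n : ℕ} (X : SegOp n) : SegOp n :=
  fun σ τ => X (fun i => 1 - σ i) (fun i => 1 - τ i)

/-! ### The oscillator algebra on `W⁺` and its trace -/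

/-- The module `W⁺ = ⨁_{k ≥ 0} ℂ |k⟩`. -/
abbrev Fock : Type := ℕ →₀ ℂ

/-- Operators on `W⁺`. -/
abbrev FockOp : Type := Module.End ℂ Fock

/-- `q^{c D} |k⟩ = q^{c k} |k⟩`. -/
def oscQ (η c : ℂ) : FockOp :=
  Finsupp.linearCombination ℂ fun k : ℕ => Finsupp.single k (qpow η (c * k))

/-- `𝐚 |k⟩ = (1 - q^{2k}) |k - 1⟩`. -/
def oscA (η : ℂ) : FockOp :=
  Finsupp.linearCombination ℂ fun k : ℕ => Finsupp.single (k - 1) (1 - qpow η (2 * k))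

/-- `𝐚* |k⟩ = |k + 1⟩`. -/
def oscAstar : FockOp :=
  Finsupp.linearCombination ℂ fun k : ℕ => Finsupp.single (k + 1) 1

/-- `v` is the value at `y = 1` of a rational function, regular at `y = 1`, whose power series at
`y = 0` is `∑ a_k y^k`. -/
def HasRegSum (a : ℕ → ℂ) (v : ℂ) : Prop :=
  ∃ P Q : Polynomial ℂ, Q.eval 1 ≠ 0 ∧
    (Q : PowerSeries ℂ) * PowerSeries.mk a = (P : PowerSeries ℂ) ∧ v = P.eval 1 / Q.eval 1

theorem HasRegSum.unique {a : ℕ → ℂ} {v w : ℂ} (hv : HasRegSum a v) (hw : HasRegSum a w) :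
    v = w := by
  obtain ⟨P, Q, hQ, h, rfl⟩ := hv
  obtain ⟨P', Q', hQ', h', rfl⟩ := hw
  have key : Q' * P = Q * P' := by
    apply Polynomial.coe_injective ℂ
    rw [Polynomial.coe_mul, Polynomial.coe_mul, ← h, ← h']
    ring
  have := congrArg (Polynomial.eval 1) key
  simp only [Polynomial.eval_mul] at this
  rw [div_eq_div_iff hQ hQ']
  linear_combination this

open Classical in
/-- The trace over the oscillator algebra: the trace `∑ ⟨k|x|k⟩` over `W⁺`, continued as a
rational function. On `q^{2αD + mD}` it takes the value `1 / (1 - q^{2α + m})`, and it vanishes on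
operators that raise or lower `k`. -/
def oscTrace (x : FockOp) : ℂ :=
  if h : ∃ v, HasRegSum (fun k => x (Finsupp.single k 1) k) v then h.choose else 0

/-! ### `L`-operators, all acting on `V_a ⊗ W⁺ ⊗ H` -/

/-- `End (V_a ⊗ W⁺ ⊗ H)` for a segment of `n` sites. -/
abbrev FullOp (n : ℕ) : Type := Matrix (Fin 2 × Cfg n) (Fin 2 × Cfg n) FockOp

/-- `β(ζ) = (1 - ζ²) q / (1 - q² ζ²)`. -/
def beta (η ζ : ℂ) : ℂ := (1 - ζ ^ 2) * qpow η 1 / (1 - qpow η 2 * ζ ^ 2)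

/-- `γ(ζ) = (1 - q²) ζ / (1 - q² ζ²)`. -/
def gamma (η ζ : ℂ) : ℂ := (1 - qpow η 2) * ζ / (1 - qpow η 2 * ζ ^ 2)

/-- The six-vertex `R`-matrix. -/
def Rmat (η ζ : ℂ) : Matrix (Fin 2 × Fin 2) (Fin 2 × Fin 2) ℂ := fun x y =>
  if x.1 = x.2 then (if y = x then 1 else 0)
  else if y = x then beta η ζ
  else if y = (x.2, x.1) then gamma η ζ
  else 0

/-- `L_{a,j}(ζ)`. Only conjugation by it is used, so its scalar normalisation is left out. -/
def Laux (η ζ : ℂ) {n : ℕ} (j : Fin n) : FullOp n := fun x y =>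
  if ∀ i, i ≠ j → x.2 i = y.2 i then
    algebraMap ℂ FockOp (Rmat η ζ (x.1, x.2 j) (y.1, y.2 j))
  else 0

/-- The matrix of `L_{A,j}(ζ)` in the space `V_j`, again without its scalar normalisation. -/
def oscMat (η ζ : ℂ) : Matrix (Fin 2) (Fin 2) FockOp :=
  !![1 - (ζ ^ 2 * qpow η 2) • oscQ η 2, -(ζ • oscA η); -(ζ • oscAstar), 1] *
    !![oscQ η (-1), 0; 0, oscQ η 1]

/-- `L_{A,j}(ζ)`. -/
def Losc (η ζ : ℂ) {n : ℕ} (j : Fin n) : FullOp n := fun x y =>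
  if x.1 = y.1 ∧ ∀ i, i ≠ j → x.2 i = y.2 i then oscMat η ζ (x.2 j) (y.2 j) else 0

/-- The adjoint action `𝕃_l ⋯ 𝕃_k Y`, where `𝕃_j Y = L_j Y L_j⁻¹`. -/
def adjointMonodromy {n : ℕ} (L : Fin n → FullOp n) (Y : FullOp n) : FullOp n :=
  (List.ofFn L).foldl (fun Z A => A * Z * Ring.inverse A) Y

/-- `id_{A,a} ⊗ X`. -/
def embedSeg {n : ℕ} (X : SegOp n) : FullOp n := fun x y =>
  if x.1 = y.1 then algebraMap ℂ FockOp (X x.2 y.2) else 0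

/-- `q^{2α D_A}`. -/
def twistOsc (η α : ℂ) (n : ℕ) : FullOp n := Matrix.diagonal fun _ => oscQ η (2 * α)

/-- `q^{α σ_a^z}`. -/
def twistAux (η α : ℂ) (n : ℕ) : FullOp n :=
  Matrix.diagonal fun x => algebraMap ℂ FockOp (if x.1 = 0 then qpow η α else qpow η (-α))

/-- `σ_a^+`. -/
def sigmaPlus (n : ℕ) : FullOp n := fun x y => if x.1 = 0 ∧ y.1 = 1 ∧ x.2 = y.2 then 1 else 0

/-- `tr_{A,a}`. -/
def traceAux {n : ℕ} (Y : FullOp n) : SegOp n := fun σ τ => ∑ a, oscTrace (Y (a, σ) (a, τ))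

/-- Left multiplication by `q^{-2 S^z}`. -/
def mulQSpin (η : ℂ) {n : ℕ} (X : SegOp n) : SegOp n :=
  fun σ τ => qpow η (-2 * spinZ σ) * X σ τ

/-- `𝐤(ζ, α) X = tr_{A,a} { σ_a^+ 𝕋_a(ζ, α) 𝕋_A(ζ, α) ζ^{α - 𝕊} (id ⊗ q^{-2 S^z} X) }`. -/
def kOp (η α : ℂ) (n : ℕ) (ζ : ℂ) (X : SegOp n) : SegOp n :=
  traceAux (sigmaPlus n *
    adjointMonodromy (Laux η ζ) (twistAux η α n *
      adjointMonodromy (Losc η ζ) (twistOsc η α n *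
        embedSeg (spinFun (fun s => ζ ^ (α - s)) (mulQSpin η X)))))

/-- `𝐤_skal(ζ, α) X = ζ^{-α-s-1} 𝐤(ζ, α) X` for `X` of spin `s`, extended linearly to all `X`, as
a function of `z = ζ²`. It is even in `ζ`, so the choice of the square root is immaterial. -/
def kSkal (η α : ℂ) (n : ℕ) (z : ℂ) (X : SegOp n) : SegOp n :=
  kOp η α n (z ^ (1 / 2 : ℂ)) (spinFun (fun s => (z ^ (1 / 2 : ℂ)) ^ (-α - s - 1)) X)

/-! ### Laurent coefficients and modes -/

/-- The coefficient of `(z - w)^k` in the Laurent expansion of `f` around `w`, as the integral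
over a small circle. For a function with an isolated singularity at `w` the integral does not
depend on the radius once that is small. -/
def laurentCoeff (f : ℂ → ℂ) (w : ℂ) (k : ℤ) : ℂ :=
  Filter.limUnder (nhdsWithin (0 : ℝ) (Set.Ioi 0)) fun r : ℝ =>
    (2 * Real.pi * Complex.I)⁻¹ * ∮ z in C(w, r), (z - w) ^ (-k - 1) * f z

/-- `ρ_j^{(ε)}(α) X`: the coefficient of `(ζ² - q^{2ε})^{-j}` in the Laurent expansion of
`𝐤_skal(ζ, α) X` around `ζ² = q^{2ε}`. -/
def rho (η α : ℂ) (n : ℕ) (ε : ℤ) (j : ℕ) (X : SegOp n) : SegOp n := fun σ τ =>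
  laurentCoeff (fun z => kSkal η α n z X σ τ) (qpow η (2 * ε)) (-(j : ℤ))

/-- `c_j(α)` for `j ≥ 1`:
`c_j(α) X = (1/2) (q^{2j-α-s-1} ρ_j^{(-)}(α) + q^{α+s+1-2j} ρ_j^{(+)}(α)) X` on spin `s`. -/
def cCoeff (η α : ℂ) (n j : ℕ) (X : SegOp n) : SegOp n :=
  (1 / 2 : ℂ) •
    (rho η α n (-1) j (spinFun (fun s => qpow η (2 * j - α - s - 1)) X) +
      rho η α n 1 j (spinFun (fun s => qpow η (α + s + 1 - 2 * j)) X))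

/-- The modes `c_p(α)`, `p ≥ 0`, on a segment of `n` sites, with
`c_0(α) = (1/2) ∑_{j=1}^n (-1)^{j-1} c_j(α)`. -/
def cMode (η α : ℂ) (n p : ℕ) (X : SegOp n) : SegOp n :=
  if p = 0 then (1 / 2 : ℂ) • ∑ j ∈ Finset.Icc 1 n, (-1 : ℂ) ^ (j - 1) • cCoeff η α n j X
  else cCoeff η α n p X

/-- The modes
`b_p(α) = - q^{-1} (q^{α - 𝕊 - 1} - q^{-α + 𝕊 + 1}) 𝕁 c_p(-α) 𝕁` on a segment of `n` sites. -/
def bMode (η α : ℂ) (n p : ℕ) (X : SegOp n) : SegOp n :=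
  spinFun (fun s => -qpow η (-1) * (qpow η (α - s - 1) - qpow η (-α + s + 1)))
    (spinFlip (cMode η (-α) n p (spinFlip X)))

/-- The two families of annihilation operators. -/
inductive Annihilator : Type
  | b
  | c

/-- The mode `x_{p,[k,l]}(α)`, `x = b, c`, on a segment of `n = l - k + 1` sites. -/
def mode (x : Annihilator) (η α : ℂ) (n p : ℕ) : SegOp n → SegOp n :=
  match x with
  | .b => bMode η α n p
  | .c => cMode η α n p

/-! ### Extension to the right -/

/-- `X ⊗ id_{[l+1,l+m]}`. -/
def tensorId {n : ℕ} (m : ℕ) (X : SegOp n) : SegOp (n + m) := fun σ τ =>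
  if ∀ i : Fin m, σ (Fin.natAdd n i) = τ (Fin.natAdd n i) then
    X (fun i => σ (Fin.castAdd m i)) (fun i => τ (Fin.castAdd m i))
  else 0

open Classical in
/-- `X ⊗ id_{[l+1,∞)}`, as a matrix indexed by the configurations of the semi-infinite chain
`[k,∞)`. -/
def tensorIdInf (n : ℕ) : SegOp n →ₗ[ℂ] Matrix (ℕ → Fin 2) (ℕ → Fin 2) ℂ where
  toFun X := Matrix.of fun σ τ =>
    if ∀ i, n ≤ i → σ i = τ i then X (fun i => σ i) (fun i => τ i) else 0
  map_add' X Y := by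
    ext σ τ
    simp only [Matrix.of_apply, Matrix.add_apply]
    split_ifs
    · rfl
    · exact (add_zero _).symm
  map_smul' r X := by
    ext σ τ
    simp only [Matrix.of_apply, Matrix.smul_apply]
    split_ifs
    · rfl
    · exact (smul_zero _).symm

/-- The space of local operators on `[k,∞)`: all `X_{[k,l]} ⊗ id_{[l+1,∞)}`. -/
def localOps : Submodule ℂ (Matrix (ℕ → Fin 2) (ℕ → Fin 2) ℂ) :=
  ⨆ n, LinearMap.range (tensorIdInf n)

/-- `X ↦ X ⊗ id_{[l+1,∞)}` as a map to the local operators. -/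
def toLocal (n : ℕ) : SegOp n →ₗ[ℂ] localOps :=
  (tensorIdInf n).codRestrict localOps fun X =>
    Submodule.mem_iSup_of_mem n (LinearMap.mem_range_self _ X)

/-- The length of a local operator on `[k,∞)`: the smallest `n` such that it acts as the identity
outside the first `n` sites. -/
def length (X : localOps) : ℕ := sInf {n | ∃ Y : SegOp n, toLocal n Y = X}

/-- `T` is an extension of the finite modes `x_{p,[k,l]}(α)`, for all `l`, to `[k,∞)`:
`T (X_{[k,l]} ⊗ id_{[l+1,∞)}) = (x_{p,[k,l]}(α) X_{[k,l]}) ⊗ id_{[l+1,∞)}`. -/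
def ExtendsModes (x : Annihilator) (η α : ℂ) (p : ℕ) (T : Module.End ℂ localOps) : Prop :=
  ∀ (n : ℕ) (X : SegOp n), T (toLocal n X) = toLocal n (mode x η α n p X)

end XXZ

end

/-!
Everything is reduced to one statement: adding a site on the right, on which the operator acts as
the identity, does not change the modes `c_p` (`cCoeff_tensorId_one`). All claims follow by
induction on the number of added sites, together with the fact that the poles of `𝐤_skal` at
`ζ² = q^{±2}` have order at most the number `n` of sites (`exists_hasPrincipalPart_kSkal`), so that
`c_p = 0` for `p > n`. The modes `b_p(α)` are obtained from `c_p(-α)` by operations that commute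
with `X ↦ X ⊗ id`.

*Rationality.* The product `L_{a,j} L_{A,j}` acts in the quantum space on one site only, so the
adjoint action of both monodromies is a recursion over the sites, `transport`, with values in
`End V_a ⊗ End W⁺`. A conjugation by `ζ^D` makes all site matrices polynomial in `z = ζ²`, and
`kSkal_eq` expresses `𝐤_skal` by a polynomial in `z` over a power of
`(1 - q² z)(q² - z)(1 - z) z`. The continued trace is linear on the space `traceable`, which
contains `q^{2αD}` and is stable under the recursion, and it is cyclic with respect to `𝐚`, `𝐚*`
and diagonal operators.

*One more site.* Let `X ⊗ id` be written in blocks with respect to the new site. By cyclicity the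
two diagonal blocks of `𝐤_skal (X ⊗ id)` are `𝐤_skal X`, and the block `⟨1| |0⟩` vanishes
(`oscTrace_auxSite_one_zero`). The block `⟨0| |1⟩` need not vanish. It involves diagonal entries of
the adjoint action conjugated by the matrix `U = (1, 𝐚; 0, 1)`. This conjugation makes the products
`L_{a,j} L_{A,j}` lower triangular, with diagonal entries that are again oscillator `L`-operators,
at `q² z` and `q⁻² z` (`uMat_conj_combine`). Hence the block is a difference of values of one
function `H`, at `q² z` and `q⁻² z` (`kSkal_tensorId_one`), and `H` has no singularities except at
`0` and `1`.

*Cancellation.* At `z = q⁻²` only the term with `H (q² z)` is singular, and at `z = q²` only the one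
with `H (q⁻² z)`. Both principal parts come from that of `H` at `1`, by a rescaling of the variable
(`rho_tensorId_one_zero_one`), and the weights in the definition of `c_p` are such that they cancel.
-/

noncomputable section

namespace XXZ

/-! ### Powers of `q` -/

theorem qpow_zero (η : ℂ) : qpow η 0 = 1 := by simp [qpow]

theorem qpow_add (η b c : ℂ) : qpow η (b + c) = qpow η b * qpow η c := by
  simp [qpow, mul_add, Complex.exp_add]

theorem qpow_neg (η c : ℂ) : qpow η (-c) = (qpow η c)⁻¹ := by
  simp [qpow, Complex.exp_neg]

theorem qpow_ne_zero (η c : ℂ) : qpow η c ≠ 0 := Complex.exp_ne_zero _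

theorem qpow_natCast_mul (η c : ℂ) (k : ℕ) : qpow η (c * k) = qpow η c ^ k := by
  rw [qpow, qpow, ← Complex.exp_nat_mul]; ring_nf

/-! ### Regularised sums -/

theorem HasRegSum.zero : HasRegSum 0 0 := by
  refine ⟨0, 1, by simp, ?_, by simp⟩
  ext k; simp

theorem HasRegSum.add {a b : ℕ → ℂ} {v w : ℂ} (ha : HasRegSum a v) (hb : HasRegSum b w) :
    HasRegSum (a + b) (v + w) := by
  obtain ⟨P, Q, hQ, h, rfl⟩ := ha
  obtain ⟨P', Q', hQ', h', rfl⟩ := hb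
  refine ⟨P * Q' + P' * Q, Q * Q', by simp [hQ, hQ'], ?_, ?_⟩
  · have : PowerSeries.mk (a + b) = PowerSeries.mk a + PowerSeries.mk b := by
      ext k; simp
    rw [this]
    push_cast
    rw [← h, ← h']
    ring
  · simp only [Polynomial.eval_add, Polynomial.eval_mul]
    field_simp

theorem HasRegSum.smul {a : ℕ → ℂ} {v : ℂ} (r : ℂ) (ha : HasRegSum a v) :
    HasRegSum (r • a) (r * v) := by
  obtain ⟨P, Q, hQ, h, rfl⟩ := ha
  refine ⟨Polynomial.C r * P, Q, hQ, ?_, ?_⟩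
  · have : PowerSeries.mk (r • a) = PowerSeries.C r * PowerSeries.mk a := by
      ext k; simp
    rw [this]
    push_cast
    rw [← h]
    ring
  · simp only [Polynomial.eval_mul, Polynomial.eval_C]
    ring

theorem hasRegSum_single (i : ℕ) : HasRegSum (Pi.single i 1) 1 := by
  refine ⟨Polynomial.X ^ i, 1, by simp, ?_, by simp⟩
  ext k
  simp [PowerSeries.coeff_X_pow, Pi.single_apply]

theorem hasRegSum_geometric {r : ℂ} (hr : r ≠ 1) : HasRegSum (fun k => r ^ k) (1 / (1 - r)) := by
  refine ⟨1, 1 - Polynomial.C r * Polynomial.X, ?_, ?_, by simp⟩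
  · simpa [sub_eq_zero] using hr.symm
  · push_cast
    ext k
    cases k with
    | zero => simp [sub_mul]
    | succ k =>
      rw [sub_mul, mul_assoc, one_mul, map_sub, PowerSeries.coeff_C_mul,
        PowerSeries.coeff_succ_X_mul]
      simp [pow_succ']

/-- The power series of the shifted sequence is multiplied by `y`, which does not change the value
at `y = 1`. -/
theorem hasRegSum_shift_iff {a b : ℕ → ℂ} (h0 : b 0 = 0) (h : ∀ k, b (k + 1) = a k) (v : ℂ) :
    HasRegSum b v ↔ HasRegSum a v := by
  have hb : PowerSeries.mk b = PowerSeries.X * PowerSeries.mk a := by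
    ext k
    cases k with
    | zero => simp [h0]
    | succ k => simp [PowerSeries.coeff_succ_X_mul, h]
  constructor
  · rintro ⟨P, Q, hQ, hP, rfl⟩
    refine ⟨P, Q * Polynomial.X, by simpa using hQ, ?_, by simp⟩
    rw [← hP, hb]
    push_cast
    ring
  · rintro ⟨P, Q, hQ, hP, rfl⟩
    refine ⟨P * Polynomial.X, Q, hQ, ?_, by simp⟩
    push_cast
    rw [← hP, hb]
    ring

/-- The sequences occurring as diagonals of the operators of interest: linear combinations of the
geometric sequences `q^{2(α+m)k}`, `m ∈ ℤ`, and of finitely supported sequences. -/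
def geomSeq (η α : ℂ) : Submodule ℂ (ℕ → ℂ) :=
  Submodule.span ℂ (Set.range (fun (m : ℤ) (k : ℕ) => qpow η (2 * (α + m)) ^ k) ∪
    Set.range fun i : ℕ => (Pi.single i 1 : ℕ → ℂ))

theorem geom_mem_geomSeq (η α : ℂ) (m : ℤ) :
    (fun k : ℕ => qpow η (2 * (α + m)) ^ k) ∈ geomSeq η α :=
  Submodule.subset_span (Or.inl ⟨m, rfl⟩)

theorem single_mem_geomSeq (η α : ℂ) (i : ℕ) : (Pi.single i 1 : ℕ → ℂ) ∈ geomSeq η α :=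
  Submodule.subset_span (Or.inr ⟨i, rfl⟩)

theorem map_mem_geomSeq {η α : ℂ} (T : (ℕ → ℂ) →ₗ[ℂ] (ℕ → ℂ))
    (hg : ∀ m : ℤ, T (fun k => qpow η (2 * (α + m)) ^ k) ∈ geomSeq η α)
    (hs : ∀ i : ℕ, T (Pi.single i 1) ∈ geomSeq η α) {f : ℕ → ℂ} (hf : f ∈ geomSeq η α) :
    T f ∈ geomSeq η α := by
  have : geomSeq η α ≤ (geomSeq η α).comap T := by
    rw [geomSeq, Submodule.span_le]
    rintro _ (⟨m, rfl⟩ | ⟨i, rfl⟩)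
    · exact hg m
    · exact hs i
  exact this hf

/-- The hypothesis on `α` says that no ratio `q^{2(α+m)}` equals `1`, so that none of the geometric
series has its pole at `y = 1`. -/
theorem exists_hasRegSum {η α : ℂ} (hα : ∀ m : ℤ, qpow η (2 * (α + m)) ≠ 1) {f : ℕ → ℂ}
    (hf : f ∈ geomSeq η α) : ∃ v, HasRegSum f v := by
  induction hf using Submodule.span_induction with
  | mem f hf =>
    rcases hf with ⟨m, rfl⟩ | ⟨i, rfl⟩
    · exact ⟨_, hasRegSum_geometric (hα m)⟩
    · exact ⟨_, hasRegSum_single i⟩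
  | zero => exact ⟨_, HasRegSum.zero⟩
  | add f g _ _ hf hg =>
    obtain ⟨v, hv⟩ := hf
    obtain ⟨w, hw⟩ := hg
    exact ⟨_, hv.add hw⟩
  | smul r f _ hf =>
    obtain ⟨v, hv⟩ := hf
    exact ⟨_, hv.smul r⟩

theorem qpow_mul_mem_geomSeq {η α : ℂ} (m : ℤ) {f : ℕ → ℂ} (hf : f ∈ geomSeq η α) :
    (fun k : ℕ => qpow η (2 * m * k) * f k) ∈ geomSeq η α := by
  refine map_mem_geomSeq (η := η) (α := α)
    (LinearMap.pi fun k : ℕ => qpow η (2 * m * k) • LinearMap.proj k) (fun m' => ?_)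
    (fun i => ?_) hf
  · convert geom_mem_geomSeq η α (m + m') using 1
    funext k
    simp only [LinearMap.pi_apply, LinearMap.smul_apply, LinearMap.proj_apply, smul_eq_mul,
      ← qpow_natCast_mul, ← qpow_add]
    push_cast
    ring_nf
  · convert (geomSeq η α).smul_mem (qpow η (2 * m * i)) (single_mem_geomSeq η α i) using 1
    funext k
    by_cases h : k = i
    · subst h; simp
    · simp [h]

/-- A geometric sequence shifted to the right is a multiple of it, up to a correction at `0`. This
is why finitely supported sequences are admitted in `geomSeq`. -/
theorem unshift_mem_geomSeq {η α : ℂ} {f : ℕ → ℂ} (hf : f ∈ geomSeq η α) :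
    (fun k => if k = 0 then 0 else f (k - 1)) ∈ geomSeq η α := by
  let T : (ℕ → ℂ) →ₗ[ℂ] (ℕ → ℂ) :=
    LinearMap.pi fun k : ℕ => if k = 0 then 0 else LinearMap.proj (k - 1)
  have hT : ∀ g : ℕ → ℂ, T g = fun k => if k = 0 then 0 else g (k - 1) := by
    intro g
    funext k
    simp only [T, LinearMap.pi_apply]
    split_ifs <;> simp
  rw [← hT]
  refine map_mem_geomSeq T (fun m => ?_) (fun i => ?_) hf
  · rw [hT]
    convert (geomSeq η α).smul_mem (qpow η (2 * (α + m)))⁻¹ ((geomSeq η α).sub_mem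
      (geom_mem_geomSeq η α m) (single_mem_geomSeq η α 0)) using 1
    funext k
    cases k with
    | zero => simp
    | succ k => simp [pow_succ', qpow_ne_zero]
  · rw [hT]
    convert single_mem_geomSeq η α (i + 1) using 1
    funext k
    cases k with
    | zero => simp
    | succ k => simp [Pi.single_apply]

/-! ### Matrix elements of oscillator operators -/

/-- The diagonal operator `|k⟩ ↦ f k |k⟩` on `W⁺`. -/
def fockDiag (f : ℕ → ℂ) : FockOp :=
  Finsupp.linearCombination ℂ fun k : ℕ => Finsupp.single k (f k)

theorem oscQ_eq_fockDiag (η c : ℂ) : oscQ η c = fockDiag fun k => qpow η (c * k) := rfl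

theorem fockOp_ext {x y : FockOp}
    (h : ∀ k, x (Finsupp.single k 1) = y (Finsupp.single k 1)) : x = y := by
  ext k : 2
  simpa using h k

theorem fockDiag_single (f : ℕ → ℂ) (k : ℕ) :
    fockDiag f (Finsupp.single k 1) = f k • Finsupp.single k 1 := by
  simp [fockDiag]

theorem oscA_single (η : ℂ) (k : ℕ) :
    oscA η (Finsupp.single k 1) = (1 - qpow η (2 * k)) • Finsupp.single (k - 1) 1 := by
  simp [oscA]

theorem oscAstar_single (k : ℕ) :
    oscAstar (Finsupp.single k 1) = Finsupp.single (k + 1) 1 := by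
  simp [oscAstar]

theorem fockDiag_apply (f : ℕ → ℂ) (v : Fock) (j : ℕ) : fockDiag f v j = f j * v j := by
  induction v using Finsupp.induction_linear with
  | zero => simp
  | add u w hu hw => simp [hu, hw, mul_add]
  | single k c =>
    by_cases h : k = j
    · subst h; simp [fockDiag, mul_comm]
    · simp [fockDiag, h]

theorem oscA_apply (η : ℂ) (v : Fock) (j : ℕ) :
    oscA η v j = (1 - qpow η (2 * (j + 1 : ℕ))) * v (j + 1) := by
  induction v using Finsupp.induction_linear with
  | zero => simp
  | add u w hu hw => simp only [map_add, Finsupp.add_apply, hu, hw, mul_add]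
  | single k c =>
    cases k with
    | zero => simp [oscA, qpow_zero]
    | succ k =>
      by_cases h : k = j
      · subst h; simp [oscA, mul_comm]
      · simp [oscA, h]

theorem oscAstar_apply (v : Fock) (j : ℕ) :
    oscAstar v j = if j = 0 then 0 else v (j - 1) := by
  induction v using Finsupp.induction_linear with
  | zero => simp
  | add u w hu hw =>
    simp only [map_add, Finsupp.add_apply, hu, hw]
    split_ifs <;> simp
  | single k c =>
    cases j with
    | zero => simp [oscAstar]
    | succ j => simp [oscAstar, Finsupp.single_apply]

/-! ### The trace -/

theorem oscTrace_eq {x : FockOp} {v : ℂ}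
    (h : HasRegSum (fun k => x (Finsupp.single k 1) k) v) : oscTrace x = v := by
  have hex : ∃ v, HasRegSum (fun k => x (Finsupp.single k 1) k) v := ⟨v, h⟩
  rw [oscTrace, dif_pos hex]
  exact hex.choose_spec.unique h

theorem oscTrace_congr {x y : FockOp}
    (h : ∀ v, HasRegSum (fun k => x (Finsupp.single k 1) k) v ↔
      HasRegSum (fun k => y (Finsupp.single k 1) k) v) : oscTrace x = oscTrace y := by
  by_cases hx : ∃ v, HasRegSum (fun k => x (Finsupp.single k 1) k) v
  · obtain ⟨v, hv⟩ := hx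
    rw [oscTrace_eq hv, oscTrace_eq ((h v).1 hv)]
  · have hy : ¬ ∃ v, HasRegSum (fun k => y (Finsupp.single k 1) k) v := by
      simpa only [h] using hx
    rw [oscTrace, oscTrace, dif_neg hx, dif_neg hy]

theorem oscTrace_fockDiag_mul_comm (f : ℕ → ℂ) (x : FockOp) :
    oscTrace (fockDiag f * x) = oscTrace (x * fockDiag f) := by
  refine oscTrace_congr fun v => ?_
  simp [Module.End.mul_apply, fockDiag_apply, fockDiag_single, -Finsupp.smul_single]

/-- The diagonals of `𝐚 x` and `x 𝐚` differ by a shift of the index; the missing term vanishes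
because `𝐚 |0⟩ = 0`. -/
theorem oscTrace_oscA_mul_comm (η : ℂ) (x : FockOp) :
    oscTrace (oscA η * x) = oscTrace (x * oscA η) := by
  refine oscTrace_congr fun v => (hasRegSum_shift_iff ?_ ?_ v).symm
  · simp [Module.End.mul_apply, oscA_single, qpow_zero]
  · intro k
    simp [Module.End.mul_apply, oscA_single, oscA_apply, -Finsupp.smul_single]

theorem oscTrace_oscAstar_mul_comm (x : FockOp) :
    oscTrace (oscAstar * x) = oscTrace (x * oscAstar) := by
  refine oscTrace_congr fun v => hasRegSum_shift_iff ?_ ?_ v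
  · simp [Module.End.mul_apply, oscAstar_apply]
  · intro k
    simp [Module.End.mul_apply, oscAstar_single, oscAstar_apply]

/-- Operators on `W⁺` with which the trace is cyclic, whatever the other factor is. -/
def IsCyclic (y : FockOp) : Prop := ∀ x, oscTrace (y * x) = oscTrace (x * y)

theorem isCyclic_fockDiag (f : ℕ → ℂ) : IsCyclic (fockDiag f) := oscTrace_fockDiag_mul_comm f

theorem isCyclic_oscA (η : ℂ) : IsCyclic (oscA η) := oscTrace_oscA_mul_comm η

theorem isCyclic_oscAstar : IsCyclic oscAstar := oscTrace_oscAstar_mul_comm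

theorem IsCyclic.mul {x y : FockOp} (hx : IsCyclic x) (hy : IsCyclic y) : IsCyclic (x * y) := by
  intro u
  rw [mul_assoc, hx, mul_assoc, hy, mul_assoc]

theorem smul_eq_fockDiag_mul (r : ℂ) (x : FockOp) : r • x = fockDiag (fun _ => r) * x := by
  refine fockOp_ext fun k => ?_
  ext j
  simp [Module.End.mul_apply, fockDiag_apply]

theorem IsCyclic.smul {x : FockOp} (r : ℂ) (hx : IsCyclic x) : IsCyclic (r • x) := by
  rw [smul_eq_fockDiag_mul]
  exact (isCyclic_fockDiag _).mul hx

/-- Operators all of whose (shifted) diagonals are in `geomSeq`. This space contains `q^{2αD}`, it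
is stable under the operations that make up the conjugation by an `L`-operator, and the trace is
linear on it. -/
def traceable (η α : ℂ) : Submodule ℂ FockOp where
  carrier := {x | ∀ d e : ℕ, (fun k => x (Finsupp.single (k + e) 1) (k + d)) ∈ geomSeq η α}
  add_mem' hx hy d e := (geomSeq η α).add_mem (hx d e) (hy d e)
  zero_mem' _ _ := (geomSeq η α).zero_mem
  smul_mem' r _ hx d e := (geomSeq η α).smul_mem r (hx d e)

section Traceable

variable {η α : ℂ} {x : FockOp}

theorem exists_hasRegSum_of_traceable (hα : ∀ m : ℤ, qpow η (2 * (α + m)) ≠ 1)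
    (hx : x ∈ traceable η α) : ∃ v, HasRegSum (fun k => x (Finsupp.single k 1) k) v :=
  exists_hasRegSum hα (hx 0 0)

theorem oscTrace_zero : oscTrace 0 = 0 := oscTrace_eq HasRegSum.zero

theorem oscTrace_add (hα : ∀ m : ℤ, qpow η (2 * (α + m)) ≠ 1) {y : FockOp}
    (hx : x ∈ traceable η α) (hy : y ∈ traceable η α) :
    oscTrace (x + y) = oscTrace x + oscTrace y := by
  obtain ⟨v, hv⟩ := exists_hasRegSum_of_traceable hα hx
  obtain ⟨w, hw⟩ := exists_hasRegSum_of_traceable hα hy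
  rw [oscTrace_eq hv, oscTrace_eq hw]
  exact oscTrace_eq (hv.add hw)

theorem oscTrace_smul (hα : ∀ m : ℤ, qpow η (2 * (α + m)) ≠ 1) (r : ℂ)
    (hx : x ∈ traceable η α) : oscTrace (r • x) = r * oscTrace x := by
  obtain ⟨v, hv⟩ := exists_hasRegSum_of_traceable hα hx
  rw [oscTrace_eq hv]
  exact oscTrace_eq (hv.smul r)

theorem oscQ_mem_traceable : oscQ η (2 * α) ∈ traceable η α := by
  intro d e
  have h : (fun k : ℕ => oscQ η (2 * α) (Finsupp.single (k + e) 1) (k + d)) =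
      if d = e then qpow η (2 * α) ^ d • fun k : ℕ => qpow η (2 * (α + (0 : ℤ))) ^ k else 0 := by
    funext k
    rw [oscQ_eq_fockDiag, fockDiag_apply]
    split_ifs with h
    · subst h
      simp only [Finsupp.single_eq_same, qpow_natCast_mul, Pi.smul_apply, smul_eq_mul]
      push_cast
      rw [add_zero, pow_add]
      ring
    · have : ¬ e = d := fun h' => h h'.symm
      simp [this]
  rw [h]
  split_ifs
  · exact (geomSeq η α).smul_mem _ (geom_mem_geomSeq η α 0)
  · exact (geomSeq η α).zero_mem

theorem oscA_mul_mem_traceable (hx : x ∈ traceable η α) : oscA η * x ∈ traceable η α := by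
  intro d e
  have h := hx (d + 1) e
  convert (geomSeq η α).sub_mem h ((geomSeq η α).smul_mem (qpow η (2 * (d + 1 : ℕ)))
    (qpow_mul_mem_geomSeq 1 h)) using 1
  funext k
  simp only [Module.End.mul_apply, oscA_apply, Pi.sub_apply, Pi.smul_apply, smul_eq_mul,
    ← mul_assoc, ← qpow_add, ← add_assoc, sub_mul, one_mul]
  congr 3
  push_cast
  ring

theorem oscAstar_mul_mem_traceable (hx : x ∈ traceable η α) :
    oscAstar * x ∈ traceable η α := by
  intro d e
  cases d with
  | zero =>
    convert unshift_mem_geomSeq (hx 0 (e + 1)) using 1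
    funext k
    simp only [Module.End.mul_apply, oscAstar_apply, add_zero]
    cases k with
    | zero => simp
    | succ k => simp [add_right_comm, add_assoc]
  | succ d =>
    convert hx d e using 1
    funext k
    simp [Module.End.mul_apply, oscAstar_apply, ← add_assoc]

theorem mul_oscA_mem_traceable (hx : x ∈ traceable η α) : x * oscA η ∈ traceable η α := by
  intro d e
  have key : ∀ f : ℕ → ℂ, f ∈ geomSeq η α →
      (fun k : ℕ => (1 - qpow η (2 * (k + e : ℕ))) * f k) ∈ geomSeq η α := by
    intro f hf
    convert (geomSeq η α).sub_mem hf ((geomSeq η α).smul_mem (qpow η (2 * e))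
      (qpow_mul_mem_geomSeq 1 hf)) using 1
    funext k
    simp only [Pi.sub_apply, Pi.smul_apply, smul_eq_mul, ← mul_assoc, ← qpow_add, sub_mul, one_mul]
    congr 3
    push_cast
    ring
  cases e with
  | zero =>
    convert key _ (unshift_mem_geomSeq (hx (d + 1) 0)) using 1
    funext k
    simp only [Module.End.mul_apply, oscA_single, map_smul, Finsupp.smul_apply, smul_eq_mul,
      add_zero]
    cases k with
    | zero => simp [qpow_zero]
    | succ k => simp [add_right_comm, add_assoc]
  | succ e =>
    convert key _ (hx d e) using 1
    funext k
    simp [Module.End.mul_apply, oscA_single, ← add_assoc, -Finsupp.smul_single]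

theorem mul_oscAstar_mem_traceable (hx : x ∈ traceable η α) :
    x * oscAstar ∈ traceable η α := by
  intro d e
  convert hx d (e + 1) using 1
  funext k
  rw [Module.End.mul_apply, oscAstar_single, add_assoc]

theorem oscQ_mul_mul_oscQ_mem_traceable {b c : ℂ} {m : ℤ} (hm : b + c = 2 * m)
    (hx : x ∈ traceable η α) : oscQ η b * x * oscQ η c ∈ traceable η α := by
  intro d e
  convert (geomSeq η α).smul_mem (qpow η (b * d + c * e)) (qpow_mul_mem_geomSeq m (hx d e)) using 1
  funext k
  simp only [Module.End.mul_apply, oscQ_eq_fockDiag, fockDiag_single, map_smul, fockDiag_apply,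
    Finsupp.smul_apply, Pi.smul_apply, smul_eq_mul, ← mul_assoc, ← qpow_add, ← hm]
  congr 2
  push_cast
  ring

end Traceable

/-! ### Adding a site on the right -/

/-- The `S^z`-eigenvalue of one site. -/
def siteSpin (κ : Fin 2) : ℂ := if κ = 0 then 1 / 2 else -(1 / 2)

/-- The configuration `σ` of `n` sites followed by `κ` on site `n + 1`. -/
def snocCfg {n : ℕ} (σ : Cfg n) (κ : Fin 2) : Cfg (n + 1) := Fin.snoc (α := fun _ => Fin 2) σ κ

@[simp] theorem snocCfg_last {n : ℕ} (σ : Cfg n) (κ : Fin 2) : snocCfg σ κ (Fin.last n) = κ := by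
  simp [snocCfg]

@[simp] theorem snocCfg_castSucc {n : ℕ} (σ : Cfg n) (κ : Fin 2) (i : Fin n) :
    snocCfg σ κ i.castSucc = σ i := by
  simp [snocCfg]

@[simp] theorem init_snocCfg {n : ℕ} (σ : Cfg n) (κ : Fin 2) :
    (Fin.init (snocCfg σ κ) : Cfg n) = σ := by
  simp [snocCfg]

theorem exists_snocCfg {n : ℕ} (σ : Cfg (n + 1)) : ∃ σ' κ, σ = snocCfg σ' κ :=
  ⟨Fin.init σ, σ (Fin.last n), by simp [snocCfg]⟩

theorem spinZ_snocCfg {n : ℕ} (σ : Cfg n) (κ : Fin 2) :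
    spinZ (snocCfg σ κ) = spinZ σ + siteSpin κ := by
  simp [spinZ, Fin.sum_univ_castSucc, siteSpin]

/-- The block `⟨μ| X |ν⟩` with respect to the last site. -/
def lastBlock {n : ℕ} (μ ν : Fin 2) (X : SegOp (n + 1)) : SegOp n :=
  fun σ τ => X (snocCfg σ μ) (snocCfg τ ν)

theorem tensorId_one_snocCfg {n : ℕ} (X : SegOp n) (σ τ : Cfg n) (κ κ' : Fin 2) :
    tensorId 1 X (snocCfg σ κ) (snocCfg τ κ') = if κ = κ' then X σ τ else 0 := by
  have h (σ : Cfg n) (κ : Fin 2) : snocCfg σ κ (Fin.natAdd n 0) = κ := snocCfg_last σ κ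
  have h' (σ : Cfg n) (κ : Fin 2) : (fun i => snocCfg σ κ (Fin.castAdd 1 i)) = σ := by
    funext i
    exact snocCfg_castSucc σ κ i
  simp only [tensorId, h', Fin.forall_fin_one]
  rw [h, h]

/-! ### Linearity of the spin operations -/

section Spin

variable {n : ℕ} (f g : ℂ → ℂ) (X Y : SegOp n)

theorem spinFun_add : spinFun f (X + Y) = spinFun f X + spinFun f Y := by
  ext; simp [spinFun, mul_add]

theorem spinFun_smul (r : ℂ) : spinFun f (r • X) = r • spinFun f X := by
  ext; simp [spinFun, mul_left_comm]

theorem spinFun_spinFun : spinFun f (spinFun g X) = spinFun (fun s => f s * g s) X := by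
  ext; simp [spinFun, mul_assoc]

theorem spinFun_const (r : ℂ) : spinFun (fun _ => r) X = r • X := by
  ext; simp [spinFun]

theorem mulQSpin_add (η : ℂ) : mulQSpin η (X + Y) = mulQSpin η X + mulQSpin η Y := by
  ext; simp [mulQSpin, mul_add]

theorem mulQSpin_smul (η r : ℂ) : mulQSpin η (r • X) = r • mulQSpin η X := by
  ext; simp [mulQSpin, mul_left_comm]

theorem mulQSpin_spinFun (η : ℂ) : mulQSpin η (spinFun f X) = spinFun f (mulQSpin η X) := by
  ext; simp [mulQSpin, spinFun, mul_left_comm]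

theorem spinFun_tensorId_one : spinFun f (tensorId 1 X) = tensorId 1 (spinFun f X) := by
  ext σ τ
  obtain ⟨σ, κ, rfl⟩ := exists_snocCfg σ
  obtain ⟨τ, κ', rfl⟩ := exists_snocCfg τ
  simp only [spinFun, tensorId_one_snocCfg, spinZ_snocCfg]
  split_ifs with h
  · rw [h, add_sub_add_right_eq_sub]
  · rw [mul_zero]

theorem spinFlip_tensorId_one : spinFlip (tensorId 1 X) = tensorId 1 (spinFlip X) := by
  have h (σ : Cfg n) (κ : Fin 2) : (fun i => 1 - snocCfg σ κ i) =
      snocCfg (fun i => 1 - σ i) (1 - κ) := by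
    funext i
    refine Fin.lastCases ?_ (fun i => ?_) i <;> simp
  ext σ τ
  obtain ⟨σ, κ, rfl⟩ := exists_snocCfg σ
  obtain ⟨τ, κ', rfl⟩ := exists_snocCfg τ
  simp only [spinFlip, h, tensorId_one_snocCfg, sub_right_inj]

theorem spinFlip_add : spinFlip (X + Y) = spinFlip X + spinFlip Y := rfl

theorem spinFlip_smul (r : ℂ) : spinFlip (r • X) = r • spinFlip X := rfl

end Spin

theorem lastBlock_mulQSpin_tensorId {n : ℕ} (η : ℂ) (X : SegOp n) (μ ν : Fin 2) :
    lastBlock μ ν (mulQSpin η (tensorId 1 X)) =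
      if μ = ν then qpow η (-2 * siteSpin μ) • mulQSpin η X else 0 := by
  ext σ τ
  simp only [lastBlock, mulQSpin, tensorId_one_snocCfg, spinZ_snocCfg]
  split_ifs with h
  · rw [mul_add, qpow_add, Matrix.smul_apply, smul_eq_mul, mulQSpin]
    ring
  · simp

theorem tensorId_zero {n : ℕ} (X : SegOp n) : tensorId 0 X = X := by
  ext σ τ
  simp [tensorId]

theorem tensorId_succ {n : ℕ} (m : ℕ) (X : SegOp n) :
    tensorId (m + 1) X = tensorId 1 (tensorId m X) := by
  ext σ τ
  have key : (∀ i : Fin (m + 1), σ (Fin.natAdd n i) = τ (Fin.natAdd n i)) ↔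
      (∀ i : Fin 1, σ (Fin.natAdd (n + m) i) = τ (Fin.natAdd (n + m) i)) ∧
        ∀ i : Fin m, σ (Fin.castAdd 1 (Fin.natAdd n i)) = τ (Fin.castAdd 1 (Fin.natAdd n i)) := by
    rw [Fin.forall_fin_succ', Fin.forall_fin_one, and_comm]
    rfl
  exact (if_congr key rfl rfl).trans (ite_and _ _ _ _)

theorem tensorId_zero_right {n : ℕ} (m : ℕ) : tensorId m (0 : SegOp n) = 0 := by
  ext σ τ
  simp [tensorId]

theorem tensorId_add {n : ℕ} (m : ℕ) (X Y : SegOp n) :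
    tensorId m (X + Y) = tensorId m X + tensorId m Y := by
  ext σ τ
  simp only [tensorId, Matrix.add_apply]
  split_ifs <;> simp

theorem tensorId_smul {n : ℕ} (m : ℕ) (r : ℂ) (X : SegOp n) :
    tensorId m (r • X) = r • tensorId m X := by
  ext σ τ
  simp only [tensorId, Matrix.smul_apply]
  split_ifs <;> simp

/-! ### Transport of an operator along a chain -/

section Transport

variable {A : Type*} [Semiring A] [Algebra ℂ A]

/-- The matrix elements, in the configurations `σ`, `τ`, of `ℓ_n ⋯ ℓ_1 (t ⊗ X) ℓ'_1 ⋯ ℓ'_n`, where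
`ℓ_j`, `ℓ'_j` are copies of `2 × 2` matrices `ℓ`, `ℓ'` over an auxiliary algebra `A`, acting on
site `j`. For `ℓ' = ℓ⁻¹` this is the adjoint action of the monodromy of `ℓ`; `ℓ'` is kept
independent of `ℓ` because it is convenient to clear its denominators. -/
def transport (ℓ ℓ' : Fin 2 → Fin 2 → A) (t : A) : (n : ℕ) → SegOp n → Cfg n → Cfg n → A
  | 0, X, σ, τ => X σ τ • t
  | n + 1, X, σ, τ => ∑ μ, ∑ ν, ℓ (σ (Fin.last n)) μ *
      transport ℓ ℓ' t n (lastBlock μ ν X) (Fin.init σ) (Fin.init τ) * ℓ' ν (τ (Fin.last n))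

variable (ℓ ℓ' : Fin 2 → Fin 2 → A) (t : A)

theorem transport_snocCfg {n : ℕ} (X : SegOp (n + 1)) (σ τ : Cfg n) (κ κ' : Fin 2) :
    transport ℓ ℓ' t (n + 1) X (snocCfg σ κ) (snocCfg τ κ') =
      ∑ μ, ∑ ν, ℓ κ μ * transport ℓ ℓ' t n (lastBlock μ ν X) σ τ * ℓ' ν κ' := by
  simp [transport]

theorem transport_add {n : ℕ} (X Y : SegOp n) (σ τ : Cfg n) :
    transport ℓ ℓ' t n (X + Y) σ τ = transport ℓ ℓ' t n X σ τ + transport ℓ ℓ' t n Y σ τ := by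
  induction n with
  | zero => simp [transport, add_smul]
  | succ n ih =>
    have h (μ ν : Fin 2) : lastBlock μ ν (X + Y) = lastBlock μ ν X + lastBlock μ ν Y := rfl
    simp only [transport, h, ih, mul_add, add_mul, Finset.sum_add_distrib]

theorem transport_smul {n : ℕ} (r : ℂ) (X : SegOp n) (σ τ : Cfg n) :
    transport ℓ ℓ' t n (r • X) σ τ = r • transport ℓ ℓ' t n X σ τ := by
  induction n with
  | zero => simp [transport, mul_smul]
  | succ n ih =>
    have h (μ ν : Fin 2) : lastBlock μ ν (r • X) = r • lastBlock μ ν X := rfl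
    simp only [transport, h, ih, mul_smul_comm, smul_mul_assoc, Finset.smul_sum]

theorem transport_zero {n : ℕ} (σ τ : Cfg n) : transport ℓ ℓ' t n 0 σ τ = 0 := by
  have := transport_smul ℓ ℓ' t 0 (0 : SegOp n) σ τ
  simpa using this

/-- A conjugation in the auxiliary algebra that is common to all sites can be taken out. -/
theorem transport_conj {u v : A} (hvu : v * u = 1) {n : ℕ} (X : SegOp n) (σ τ : Cfg n) :
    transport (fun κ μ => u * ℓ κ μ * v) (fun ν κ => u * ℓ' ν κ * v) (u * t * v) n X σ τ =
      u * transport ℓ ℓ' t n X σ τ * v := by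
  induction n with
  | zero => simp [transport]
  | succ n ih =>
    have hv (x : A) : v * (u * x) = x := by rw [← mul_assoc, hvu, one_mul]
    simp only [transport, ih]
    simp only [Finset.mul_sum, Finset.sum_mul, mul_assoc, hv]

theorem transport_smul_smul (c c' d : ℂ) {n : ℕ} (X : SegOp n) (σ τ : Cfg n) :
    transport (fun κ μ => c • ℓ κ μ) (fun ν κ => c' • ℓ' ν κ) (d • t) n X σ τ =
      ((c * c') ^ n * d) • transport ℓ ℓ' t n X σ τ := by
  induction n with
  | zero => simp [transport, smul_comm d]
  | succ n ih =>
    simp only [transport, ih, Finset.smul_sum, smul_mul_assoc, mul_smul_comm, smul_smul]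
    refine Finset.sum_congr rfl fun μ _ => Finset.sum_congr rfl fun ν _ => ?_
    congr 1
    ring

/-- Diagonal factors `q^{e σ^z / 2}` of the site matrices can be moved to the operator, on which
they act by `q^{e 𝕊}`. -/
theorem transport_qpow_siteSpin (η e : ℂ) {n : ℕ} (X : SegOp n) (σ τ : Cfg n) :
    transport (fun κ μ => qpow η (e * siteSpin μ) • ℓ κ μ)
        (fun ν κ => qpow η (-(e * siteSpin ν)) • ℓ' ν κ) t n X σ τ =
      transport ℓ ℓ' t n (spinFun (fun s => qpow η (e * s)) X) σ τ := by
  induction n with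
  | zero => simp [transport, spinFun, spinZ, qpow_zero]
  | succ n ih =>
    have h (μ ν : Fin 2) : lastBlock μ ν (spinFun (fun s => qpow η (e * s)) X) =
        (qpow η (e * siteSpin μ) * qpow η (-(e * siteSpin ν))) •
          spinFun (fun s => qpow η (e * s)) (lastBlock μ ν X) := by
      ext σ τ
      simp only [lastBlock, spinFun, spinZ_snocCfg, Matrix.smul_apply, smul_eq_mul, ← mul_assoc,
        ← qpow_add]
      congr 2
      ring
    simp only [transport, h, ih, transport_smul, smul_mul_assoc, mul_smul_comm, smul_smul,
      mul_comm]

/-- On `q^{-2 S^z} (X ⊗ id)` the last step of the transport is a single sum over the states of the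
new site, with weights `q^{-σ^z}`. -/
theorem transport_mulQSpin_tensorId (η : ℂ) {n : ℕ} (X : SegOp n) (σ τ : Cfg n) (κ κ' : Fin 2) :
    transport ℓ ℓ' t (n + 1) (mulQSpin η (tensorId 1 X)) (snocCfg σ κ) (snocCfg τ κ') =
      ∑ μ, qpow η (-2 * siteSpin μ) •
        (ℓ κ μ * transport ℓ ℓ' t n (mulQSpin η X) σ τ * ℓ' μ κ') := by
  rw [transport_snocCfg]
  refine Finset.sum_congr rfl fun μ _ => ?_
  rw [Finset.sum_eq_single μ]
  · rw [lastBlock_mulQSpin_tensorId, if_pos rfl, transport_smul, mul_smul_comm, smul_mul_assoc]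
  · intro ν _ h
    rw [lastBlock_mulQSpin_tensorId, if_neg h.symm, transport_zero, mul_zero, zero_mul]
  · simp

/-- Transport by lower triangular site matrices is lower triangular, and its diagonal entries are
the transports by the diagonal entries. -/
theorem transport_lowerTriangular {O : Type*} [Semiring O] [Algebra ℂ O]
    (ℓ ℓ' : Fin 2 → Fin 2 → Matrix (Fin 2) (Fin 2) O) (t : Matrix (Fin 2) (Fin 2) O)
    (hℓ : ∀ κ μ, ℓ κ μ 0 1 = 0) (hℓ' : ∀ κ μ, ℓ' κ μ 0 1 = 0) (ht : t 0 1 = 0) {n : ℕ}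
    (X : SegOp n) (σ τ : Cfg n) :
    transport ℓ ℓ' t n X σ τ 0 1 = 0 ∧ ∀ a, transport ℓ ℓ' t n X σ τ a a =
      transport (fun κ μ => ℓ κ μ a a) (fun κ μ => ℓ' κ μ a a) (t a a) n X σ τ := by
  induction n with
  | zero => simp [transport, ht]
  | succ n ih =>
    constructor
    · simp [transport, Matrix.sum_apply, Matrix.mul_apply, hℓ, hℓ', ih]
    · intro a
      fin_cases a <;>
        simp [transport, Matrix.sum_apply, Matrix.mul_apply, Fin.sum_univ_two, hℓ, hℓ', ih]

/-- If a space of `z`-dependent elements is stable under multiplication by `z` and under the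
one-site operations, then it contains the transports of operators with polynomial entries. -/
theorem transport_mem (P : Submodule ℂ (ℂ → A)) (ℓ ℓ' : ℂ → Fin 2 → Fin 2 → A) (t : A)
    (hz : ∀ F ∈ P, (fun z => z • F z) ∈ P) (ht : (fun _ => t) ∈ P)
    (hℓ : ∀ F ∈ P, ∀ κ μ ν κ', (fun z => ℓ z κ μ * F z * ℓ' z ν κ') ∈ P) {n : ℕ}
    (X : ℂ → SegOp n) (hX : ∀ σ τ, ∃ p : Polynomial ℂ, ∀ z, X z σ τ = p.eval z) (σ τ : Cfg n) :
    (fun z => transport (ℓ z) (ℓ' z) t n (X z) σ τ) ∈ P := by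
  induction n with
  | zero =>
    obtain ⟨p, hp⟩ := hX σ τ
    simp only [transport, hp]
    clear hp
    induction p using Polynomial.induction_on' with
    | add p q hp hq =>
      simp only [Polynomial.eval_add, add_smul]
      exact P.add_mem hp hq
    | monomial k c =>
      have hk : (fun z : ℂ => z ^ k • t) ∈ P := by
        induction k with
        | zero => simpa using ht
        | succ k ih => simpa [pow_succ', mul_smul] using hz _ ih
      simp only [Polynomial.eval_monomial, mul_smul]
      exact P.smul_mem c hk
  | succ n ih =>
    have : (fun z => transport (ℓ z) (ℓ' z) t (n + 1) (X z) σ τ) =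
        ∑ μ, ∑ ν, fun z => ℓ z (σ (Fin.last n)) μ *
          transport (ℓ z) (ℓ' z) t n (lastBlock μ ν (X z)) (Fin.init σ) (Fin.init τ) *
            ℓ' z ν (τ (Fin.last n)) := by
      funext z
      simp [transport, Finset.sum_apply]
    rw [this]
    exact P.sum_mem fun μ _ => P.sum_mem fun ν _ =>
      hℓ _ (ih (fun z => lastBlock μ ν (X z)) (fun σ τ => hX _ _) _ _) _ _ _ _

end Transport

/-! ### Polynomial families of oscillator operators -/

/-- Polynomials in `z` with coefficients in `traceable`. -/
def polyFamily (η α : ℂ) : Submodule ℂ (ℂ → FockOp) :=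
  Submodule.span ℂ {F | ∃ i : ℕ, ∃ x ∈ traceable η α, F = fun z => z ^ i • x}

section PolyFamily

variable {η α : ℂ} {F : ℂ → FockOp}

theorem const_mem_polyFamily {x : FockOp} (hx : x ∈ traceable η α) :
    (fun _ => x) ∈ polyFamily η α :=
  Submodule.subset_span ⟨0, x, hx, by simp⟩

theorem map_mem_polyFamily (T : FockOp →ₗ[ℂ] FockOp)
    (hT : ∀ x ∈ traceable η α, T x ∈ traceable η α) (hF : F ∈ polyFamily η α) :
    (fun z => T (F z)) ∈ polyFamily η α := by
  induction hF using Submodule.span_induction with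
  | mem F hF =>
    obtain ⟨i, x, hx, rfl⟩ := hF
    exact Submodule.subset_span ⟨i, T x, hT x hx, by simp⟩
  | zero =>
    simp only [Pi.zero_apply, map_zero]
    exact (polyFamily η α).zero_mem
  | add F G _ _ hF hG =>
    simp only [Pi.add_apply, map_add]
    exact (polyFamily η α).add_mem hF hG
  | smul r F _ hF =>
    simp only [Pi.smul_apply, map_smul]
    exact (polyFamily η α).smul_mem r hF

theorem self_smul_mem_polyFamily (hF : F ∈ polyFamily η α) :
    (fun z => z • F z) ∈ polyFamily η α := by
  induction hF using Submodule.span_induction with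
  | mem F hF =>
    obtain ⟨i, x, hx, rfl⟩ := hF
    exact Submodule.subset_span ⟨i + 1, x, hx, by simp [pow_succ', mul_smul]⟩
  | zero =>
    simp only [Pi.zero_apply, smul_zero]
    exact (polyFamily η α).zero_mem
  | add F G _ _ hF hG =>
    simp only [Pi.add_apply, smul_add]
    exact (polyFamily η α).add_mem hF hG
  | smul r F _ hF =>
    have h : (fun z => z • (r • F) z) = r • fun z => z • F z :=
      funext fun z => smul_comm z r (F z)
    rw [h]
    exact (polyFamily η α).smul_mem r hF

theorem apply_mem_traceable (hF : F ∈ polyFamily η α) (z : ℂ) : F z ∈ traceable η α := by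
  induction hF using Submodule.span_induction with
  | mem F hF =>
    obtain ⟨i, x, hx, rfl⟩ := hF
    exact (traceable η α).smul_mem _ hx
  | zero => exact (traceable η α).zero_mem
  | add F G _ _ hF hG => exact (traceable η α).add_mem hF hG
  | smul r F _ hF => exact (traceable η α).smul_mem r hF

theorem exists_oscTrace_eq_eval (hα : ∀ m : ℤ, qpow η (2 * (α + m)) ≠ 1)
    (hF : F ∈ polyFamily η α) : ∃ p : Polynomial ℂ, ∀ z, oscTrace (F z) = p.eval z := by
  induction hF using Submodule.span_induction with
  | mem F hF =>
    obtain ⟨i, x, hx, rfl⟩ := hF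
    exact ⟨Polynomial.C (oscTrace x) * Polynomial.X ^ i, fun z => by
      rw [oscTrace_smul hα _ hx]; simp [mul_comm (z ^ i)]⟩
  | zero => exact ⟨0, fun z => by simpa using oscTrace_zero⟩
  | add F G hF hG ihF ihG =>
    obtain ⟨p, hp⟩ := ihF
    obtain ⟨p', hp'⟩ := ihG
    refine ⟨p + p', fun z => ?_⟩
    rw [Pi.add_apply, oscTrace_add hα (apply_mem_traceable hF z) (apply_mem_traceable hG z), hp,
      hp', Polynomial.eval_add]
  | smul r F hF ih =>
    obtain ⟨p, hp⟩ := ih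
    refine ⟨Polynomial.C r * p, fun z => ?_⟩
    rw [Pi.smul_apply, oscTrace_smul hα r (apply_mem_traceable hF z), hp]
    simp

end PolyFamily

/-! ### Relations of the oscillator algebra -/

theorem oscQ_mul_oscQ (η b c : ℂ) : oscQ η b * oscQ η c = oscQ η (b + c) := by
  refine fockOp_ext fun k => ?_
  simp only [oscQ_eq_fockDiag, Module.End.mul_apply, fockDiag_single, map_smul, smul_smul,
    ← qpow_add]
  ring_nf

theorem oscQ_zero (η : ℂ) : oscQ η 0 = 1 := by
  refine fockOp_ext fun k => ?_
  simp [oscQ_eq_fockDiag, fockDiag_single, qpow_zero]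

theorem oscA_mul_oscQ (η c : ℂ) : oscA η * oscQ η c = qpow η c • (oscQ η c * oscA η) := by
  refine fockOp_ext fun k => ?_
  simp only [oscQ_eq_fockDiag, Module.End.mul_apply, fockDiag_single, oscA_single, map_smul,
    smul_smul, LinearMap.smul_apply]
  cases k with
  | zero => simp [qpow_zero]
  | succ k =>
    congr 1
    simp only [Nat.add_sub_cancel, qpow_natCast_mul, pow_succ]
    ring

theorem oscAstar_mul_oscQ (η c : ℂ) :
    oscAstar * oscQ η c = (qpow η c)⁻¹ • (oscQ η c * oscAstar) := by
  refine fockOp_ext fun k => ?_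
  simp only [oscQ_eq_fockDiag, Module.End.mul_apply, fockDiag_single, oscAstar_single, map_smul,
    smul_smul, LinearMap.smul_apply]
  congr 1
  simp only [qpow_natCast_mul, pow_succ]
  field_simp [qpow_ne_zero]

theorem oscA_mul_oscAstar (η : ℂ) : oscA η * oscAstar = 1 + (-qpow η 2) • oscQ η 2 := by
  refine fockOp_ext fun k => ?_
  simp only [oscQ_eq_fockDiag, Module.End.mul_apply, fockDiag_single, oscAstar_single,
    oscA_single, smul_smul, LinearMap.smul_apply, LinearMap.add_apply, Module.End.one_apply,
    Nat.add_sub_cancel, qpow_natCast_mul, pow_succ']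
  module

theorem oscAstar_mul_oscA (η : ℂ) : oscAstar * oscA η = 1 + (-1 : ℂ) • oscQ η 2 := by
  refine fockOp_ext fun k => ?_
  simp only [oscQ_eq_fockDiag, Module.End.mul_apply, fockDiag_single, oscAstar_single,
    oscA_single, map_smul, LinearMap.add_apply, LinearMap.smul_apply, Module.End.one_apply]
  cases k with
  | zero => simp [qpow_zero]
  | succ k =>
    rw [Nat.add_sub_cancel]
    module

section Assoc

variable (η c : ℂ) (x : FockOp)

theorem oscQ_mul_oscQ_assoc (b : ℂ) : oscQ η b * (oscQ η c * x) = oscQ η (b + c) * x := by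
  rw [← mul_assoc, oscQ_mul_oscQ]

theorem oscA_mul_oscQ_assoc :
    oscA η * (oscQ η c * x) = qpow η c • (oscQ η c * (oscA η * x)) := by
  rw [← mul_assoc, oscA_mul_oscQ, smul_mul_assoc, mul_assoc]

theorem oscAstar_mul_oscQ_assoc :
    oscAstar * (oscQ η c * x) = (qpow η c)⁻¹ • (oscQ η c * (oscAstar * x)) := by
  rw [← mul_assoc, oscAstar_mul_oscQ, smul_mul_assoc, mul_assoc]

end Assoc

theorem qpow_two (η : ℂ) : qpow η 2 = qpow η 1 ^ 2 := by
  rw [← qpow_natCast_mul]; norm_num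

/-! ### The one-site matrices -/

/-- The matrix `L_{A,j}` of the oscillator, up to its diagonal factor, after conjugation by
`ζ^{-D}`. It is a polynomial in `z = ζ²`. -/
def mHat (η z : ℂ) : Matrix (Fin 2) (Fin 2) FockOp :=
  !![1 + (-(z * qpow η 2)) • oscQ η 2, (-z) • oscA η; (-1 : ℂ) • oscAstar, 1]

/-- `(1 - z)` times the inverse of `mHat`. -/
def nHat (η z : ℂ) : Matrix (Fin 2) (Fin 2) FockOp :=
  !![1, z • oscA η; oscAstar, 1 + (-z) • oscQ η 2]

/-- The exponents of the diagonal factor `diag(q^{-D}, q^{D})` of `L_{A,j}`. -/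
def diagExp (μ : Fin 2) : ℂ := if μ = 0 then -1 else 1

/-- `L_{A,j}(ζ)`, conjugated by `ζ^{-D}`, as a function of `z = ζ²`. -/
def lHat (η z : ℂ) (κ μ : Fin 2) : FockOp := mHat η z κ μ * oscQ η (diagExp μ)

/-- `(1 - z)` times the inverse of `lHat`. -/
def lHat' (η z : ℂ) (ν κ : Fin 2) : FockOp := oscQ η (-diagExp ν) * nHat η z ν κ

/-- The six-vertex matrix on `ℂ² ⊗ ℂ²` with weights `a`, `b` on the diagonal (for equal and for
different spins) and exchange amplitudes `c`, `d`. -/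
def sixVertex (a b c d : ℂ) : Matrix (Fin 2 × Fin 2) (Fin 2 × Fin 2) ℂ := fun x y =>
  if x.1 = x.2 then (if y = x then a else 0)
  else if y = x then b
  else if y = (x.2, x.1) then (if x.1 = 0 then c else d)
  else 0

/-- `(1 - q² z) R(ζ)`, conjugated by `diag(1, ζ)` in the auxiliary space. -/
def rHat (η z : ℂ) : Matrix (Fin 2 × Fin 2) (Fin 2 × Fin 2) ℂ :=
  sixVertex (1 - qpow η 2 * z) ((1 - z) * qpow η 1) (1 - qpow η 2) ((1 - qpow η 2) * z)

/-- `(q² - z) R(ζ)⁻¹`, conjugated by `diag(1, ζ)` in the auxiliary space. -/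
def rHat' (η z : ℂ) : Matrix (Fin 2 × Fin 2) (Fin 2 × Fin 2) ℂ :=
  sixVertex (qpow η 2 - z) ((1 - z) * qpow η 1) (-(1 - qpow η 2)) (-((1 - qpow η 2) * z))

/-- The algebra `End V_a ⊗ End W⁺`. -/
abbrev AuxOp : Type := Matrix (Fin 2) (Fin 2) FockOp

/-- The product `L_{a,j} L_{A,j}`, as a matrix in `V_j` over `End V_a ⊗ End W⁺`. -/
def combine (r : Matrix (Fin 2 × Fin 2) (Fin 2 × Fin 2) ℂ) (l : Fin 2 → Fin 2 → FockOp)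
    (κ μ : Fin 2) : AuxOp :=
  Matrix.of fun a c => ∑ ρ, r (a, κ) (c, ρ) • l ρ μ

/-- The product `L_{A,j}⁻¹ L_{a,j}⁻¹`, as a matrix in `V_j` over `End V_a ⊗ End W⁺`. -/
def combine' (r : Matrix (Fin 2 × Fin 2) (Fin 2 × Fin 2) ℂ) (l : Fin 2 → Fin 2 → FockOp)
    (ν κ : Fin 2) : AuxOp :=
  Matrix.of fun d b => ∑ ρ, r (d, ρ) (b, κ) • l ν ρ

/-! ### Polynomiality of the one-site operations -/

section Stability

variable {η α : ℂ} {F : ℂ → FockOp}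

theorem mHat_mul_mem (hF : F ∈ polyFamily η α) (κ μ : Fin 2) :
    (fun z => mHat η z κ μ * F z) ∈ polyFamily η α := by
  have hQ : (fun z => oscQ η 2 * F z) ∈ polyFamily η α :=
    map_mem_polyFamily (LinearMap.mulLeft ℂ (oscQ η 2)) (fun x hx => by
      have := oscQ_mul_mul_oscQ_mem_traceable (b := 2) (c := 0) (m := 1) (by norm_num) hx
      simpa [oscQ_zero] using this) hF
  have hA : (fun z => oscA η * F z) ∈ polyFamily η α :=
    map_mem_polyFamily (LinearMap.mulLeft ℂ (oscA η)) (fun x => oscA_mul_mem_traceable) hF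
  have hA' : (fun z => oscAstar * F z) ∈ polyFamily η α :=
    map_mem_polyFamily (LinearMap.mulLeft ℂ oscAstar) (fun x => oscAstar_mul_mem_traceable) hF
  fin_cases κ <;> fin_cases μ
  · convert Submodule.add_mem _ hF
      (Submodule.smul_mem _ (-qpow η 2) (self_smul_mem_polyFamily hQ)) using 1
    funext z
    simp [mHat, add_mul, smul_smul, mul_comm]
  · convert Submodule.smul_mem _ (-1 : ℂ) (self_smul_mem_polyFamily hA) using 1
    funext z
    simp [mHat, smul_smul]
  · convert Submodule.smul_mem _ (-1 : ℂ) hA' using 1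
    funext z
    simp [mHat]
  · simpa [mHat] using hF

theorem mul_nHat_mem (hF : F ∈ polyFamily η α) (κ μ : Fin 2) :
    (fun z => F z * nHat η z κ μ) ∈ polyFamily η α := by
  have hQ : (fun z => F z * oscQ η 2) ∈ polyFamily η α :=
    map_mem_polyFamily (LinearMap.mulRight ℂ (oscQ η 2)) (fun x hx => by
      have := oscQ_mul_mul_oscQ_mem_traceable (b := 0) (c := 2) (m := 1) (by norm_num) hx
      simpa [oscQ_zero] using this) hF
  have hA : (fun z => F z * oscA η) ∈ polyFamily η α :=
    map_mem_polyFamily (LinearMap.mulRight ℂ (oscA η)) (fun x => mul_oscA_mem_traceable) hF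
  have hA' : (fun z => F z * oscAstar) ∈ polyFamily η α :=
    map_mem_polyFamily (LinearMap.mulRight ℂ oscAstar) (fun x => mul_oscAstar_mem_traceable) hF
  fin_cases κ <;> fin_cases μ
  · simpa [nHat] using hF
  · convert self_smul_mem_polyFamily hA using 1
    funext z
    simp [nHat]
  · simpa [nHat] using hA'
  · convert Submodule.add_mem _ hF
      (Submodule.smul_mem _ (-1 : ℂ) (self_smul_mem_polyFamily hQ)) using 1
    funext z
    simp [nHat, mul_add, smul_smul]

/-- The factors `q^{± D}` to the left and to the right combine to an even power of `q^D`, which is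
what `traceable` is stable under. -/
theorem lHat_mul_mul_lHat'_mem (hF : F ∈ polyFamily η α) (κ μ ν κ' : Fin 2) :
    (fun z => lHat η z κ μ * F z * lHat' η z ν κ') ∈ polyFamily η α := by
  obtain ⟨m, hm⟩ : ∃ m : ℤ, diagExp μ + -diagExp ν = 2 * m := by
    fin_cases μ <;> fin_cases ν
    · exact ⟨0, by simp [diagExp]⟩
    · exact ⟨-1, by norm_num [diagExp]⟩
    · exact ⟨1, by norm_num [diagExp]⟩
    · exact ⟨0, by simp [diagExp]⟩
  have h := map_mem_polyFamily
    ((LinearMap.mulRight ℂ (oscQ η (-diagExp ν))).comp (LinearMap.mulLeft ℂ (oscQ η (diagExp μ))))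
    (fun x hx => oscQ_mul_mul_oscQ_mem_traceable hm hx) hF
  convert mul_nHat_mem (mHat_mul_mem h κ μ) ν κ' using 1
  funext z
  simp [lHat, lHat', mul_assoc]

theorem combine_mul_mul_combine'_mem {F : ℂ → AuxOp}
    (hF : ∀ a b, (fun z => F z a b) ∈ polyFamily η α) (κ μ ν κ' a b : Fin 2) :
    (fun z => (combine (rHat η z) (lHat η z) κ μ * F z *
      combine' (rHat' η z) (lHat' η z) ν κ') a b) ∈ polyFamily η α := by
  have hz {G : ℂ → FockOp} (hG : G ∈ polyFamily η α) (c d : ℂ) :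
      (fun z => (c + d * z) • G z) ∈ polyFamily η α := by
    convert (polyFamily η α).add_mem ((polyFamily η α).smul_mem c hG)
      ((polyFamily η α).smul_mem d (self_smul_mem_polyFamily hG)) using 1
    funext z
    simp [add_smul, smul_smul]
  have hr {G : ℂ → FockOp} (hG : G ∈ polyFamily η α) (x y : Fin 2 × Fin 2) :
      (fun z => rHat η z x y • G z) ∈ polyFamily η α := by
    obtain ⟨c, d, h⟩ : ∃ c d : ℂ, ∀ z, rHat η z x y = c + d * z := by
      simp only [rHat, sixVertex]
      split_ifs
      · exact ⟨1, -qpow η 2, fun z => by ring⟩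
      · exact ⟨0, 0, fun z => by ring⟩
      · exact ⟨qpow η 1, -qpow η 1, fun z => by ring⟩
      · exact ⟨1 - qpow η 2, 0, fun z => by ring⟩
      · exact ⟨0, 1 - qpow η 2, fun z => by ring⟩
      · exact ⟨0, 0, fun z => by ring⟩
    simp only [h]
    exact hz hG c d
  have hr' {G : ℂ → FockOp} (hG : G ∈ polyFamily η α) (x y : Fin 2 × Fin 2) :
      (fun z => rHat' η z x y • G z) ∈ polyFamily η α := by
    obtain ⟨c, d, h⟩ : ∃ c d : ℂ, ∀ z, rHat' η z x y = c + d * z := by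
      simp only [rHat', sixVertex]
      split_ifs
      · exact ⟨qpow η 2, -1, fun z => by ring⟩
      · exact ⟨0, 0, fun z => by ring⟩
      · exact ⟨qpow η 1, -qpow η 1, fun z => by ring⟩
      · exact ⟨-(1 - qpow η 2), 0, fun z => by ring⟩
      · exact ⟨0, -(1 - qpow η 2), fun z => by ring⟩
      · exact ⟨0, 0, fun z => by ring⟩
    simp only [h]
    exact hz hG c d
  have : (fun z => (combine (rHat η z) (lHat η z) κ μ * F z *
      combine' (rHat' η z) (lHat' η z) ν κ') a b) =
      ∑ d, ∑ ρ', ∑ c, ∑ ρ, fun z => rHat' η z (d, ρ') (b, κ') • (rHat η z (a, κ) (c, ρ) •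
        (lHat η z ρ μ * F z c d * lHat' η z ν ρ')) := by
    funext z
    simp only [Matrix.mul_apply, combine, combine', Matrix.of_apply, Finset.sum_apply,
      Finset.sum_mul, Finset.mul_sum, smul_mul_assoc, mul_smul_comm]
    simp only [Finset.smul_sum]
  rw [this]
  exact Submodule.sum_mem _ fun d _ => Submodule.sum_mem _ fun ρ' _ =>
    Submodule.sum_mem _ fun c _ => Submodule.sum_mem _ fun ρ _ =>
      hr' (hr (lHat_mul_mul_lHat'_mem (hF c d) _ _ _ _) _ _) _ _

end Stability

/-! ### Triangularity -/

/-- The unipotent matrix that makes `L_{a,j} L_{A,j}` lower triangular. -/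
def uMat (η : ℂ) : AuxOp := !![1, oscA η; 0, 1]

/-- The inverse of `uMat`. -/
def uMat' (η : ℂ) : AuxOp := !![1, (-1 : ℂ) • oscA η; 0, 1]

theorem uMat'_mul_uMat (η : ℂ) : uMat' η * uMat η = 1 := by
  have h : oscA η + (-1 : ℂ) • oscA η = 0 := by module
  ext a b : 2
  fin_cases a <;> fin_cases b <;> simp [uMat, uMat', Matrix.mul_apply, h]

/-- The entries of `U x U⁻¹`, apart from the lower left one. -/
theorem uMat_conj_apply (η : ℂ) (x : AuxOp) :
    (uMat η * x * uMat' η) 0 0 = x 0 0 + oscA η * x 1 0 ∧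
    (uMat η * x * uMat' η) 0 1 =
      x 0 1 + oscA η * x 1 1 + (-1 : ℂ) • ((x 0 0 + oscA η * x 1 0) * oscA η) ∧
    (uMat η * x * uMat' η) 1 1 = x 1 1 + (-1 : ℂ) • (x 1 0 * oscA η) := by
  simp only [uMat, uMat', Matrix.mul_apply, Fin.sum_univ_two]
  simp [add_comm]

section Triangular

variable (η z : ℂ) (κ μ : Fin 2)

set_option maxHeartbeats 2000000 in
/-- The diagonal blocks are `lHat` at `q² z` and `q⁻² z`, up to scalars, diagonal factors in the
quantum space and a conjugation by `q^{± D}`. -/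
theorem uMat_conj_combine :
    (uMat η * combine (rHat η z) (lHat η z) κ μ * uMat' η) 0 1 = 0 ∧
    (uMat η * combine (rHat η z) (lHat η z) κ μ * uMat' η) 0 0 =
      ((1 - z) * if μ = 0 then 1 else qpow η 1) •
        (oscQ η 1 * lHat η (qpow η 2 * z) κ μ * oscQ η (-1)) ∧
    (uMat η * combine (rHat η z) (lHat η z) κ μ * uMat' η) 1 1 =
      ((1 - qpow η 2 * z) * if μ = 0 then qpow η 1 else 1) •
        (oscQ η (-1) * lHat η (qpow η (-2) * z) κ μ * oscQ η 1) := by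
  have hq := qpow_ne_zero η 1
  rw [(uMat_conj_apply η _).1, (uMat_conj_apply η _).2.1, (uMat_conj_apply η _).2.2]
  refine ⟨?_, ?_, ?_⟩ <;> fin_cases κ <;> fin_cases μ <;>
  · simp [combine, rHat, sixVertex, lHat, mHat, diagExp, Fin.sum_univ_two]
    simp only [add_mul, mul_add, one_mul, mul_one, smul_mul_assoc,
      mul_smul_comm, mul_assoc, oscQ_mul_oscQ_assoc, oscA_mul_oscQ_assoc,
      oscQ_mul_oscQ, oscA_mul_oscQ, oscAstar_mul_oscQ, oscA_mul_oscAstar, oscAstar_mul_oscA,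
      smul_add]
    norm_num [qpow_two, qpow_neg, oscQ_zero]
    try match_scalars <;> field_simp <;> ring

set_option maxHeartbeats 2000000 in
/-- The counterpart of `uMat_conj_combine` for the inverse `L`-operators. -/
theorem uMat_conj_combine' :
    (uMat η * combine' (rHat' η z) (lHat' η z) κ μ * uMat' η) 0 1 = 0 ∧
    (uMat η * combine' (rHat' η z) (lHat' η z) κ μ * uMat' η) 0 0 =
      ((qpow η 2 - z) * if κ = 0 then 1 else qpow η (-1)) •
        (oscQ η 1 * lHat' η (qpow η 2 * z) κ μ * oscQ η (-1)) ∧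
    (uMat η * combine' (rHat' η z) (lHat' η z) κ μ * uMat' η) 1 1 =
      ((1 - z) * qpow η 2 * if κ = 0 then qpow η (-1) else 1) •
        (oscQ η (-1) * lHat' η (qpow η (-2) * z) κ μ * oscQ η 1) := by
  have hq := qpow_ne_zero η 1
  rw [(uMat_conj_apply η _).1, (uMat_conj_apply η _).2.1, (uMat_conj_apply η _).2.2]
  refine ⟨?_, ?_, ?_⟩ <;> fin_cases κ <;> fin_cases μ <;>
  · simp [combine', rHat', sixVertex, lHat', nHat, diagExp, Fin.sum_univ_two]
    simp only [add_mul, mul_add, mul_one, smul_mul_assoc,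
      mul_smul_comm, mul_assoc, oscQ_mul_oscQ_assoc, oscA_mul_oscQ_assoc,
      oscQ_mul_oscQ, oscA_mul_oscQ, oscAstar_mul_oscQ, oscA_mul_oscAstar, oscAstar_mul_oscA,
      smul_add]
    norm_num [qpow_two, qpow_neg, oscQ_zero]
    try match_scalars <;> field_simp <;> ring

end Triangular

/-! ### Cyclicity of the site matrices -/

theorem isCyclic_lHat' (η z : ℂ) (ν κ : Fin 2) : IsCyclic (lHat' η z ν κ) := by
  have hQ (c : ℂ) : IsCyclic (oscQ η c) := isCyclic_fockDiag _
  have hD : (1 + (-z) • oscQ η 2 : FockOp) = fockDiag fun k => 1 - z * qpow η (2 * k) := by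
    refine fockOp_ext fun k => ?_
    simp only [oscQ_eq_fockDiag, LinearMap.add_apply, LinearMap.smul_apply, Module.End.one_apply,
      fockDiag_single]
    module
  refine (hQ _).mul ?_
  fin_cases ν <;> fin_cases κ
  · simpa [nHat, oscQ_zero] using hQ 0
  · simpa [nHat] using (isCyclic_oscA η).smul z
  · simpa [nHat] using isCyclic_oscAstar
  · have := isCyclic_fockDiag fun k : ℕ => 1 - z * qpow η (2 * k)
    rw [← hD] at this
    simpa [nHat] using this

/-- In the trace over `W⁺` the factors of `lHat η z κ μ * x * lHat' η z μ κ'` can be permuted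
cyclically; this is the product that results when `x` comes from an operator `q^{-2 S^z} (X ⊗ id)`.
It is upper triangular. -/
theorem sum_qpow_smul_lHat'_mul_lHat (η z : ℂ) (κ κ' : Fin 2) :
    ∑ μ, qpow η (-2 * siteSpin μ) • (lHat' η z μ κ' * lHat η z κ μ) =
      (!![(qpow η (-1) - qpow η 1 * z) • (1 : FockOp), (z * (qpow η (-2) - qpow η 2)) • oscA η;
        0, (qpow η 1 - qpow η (-1) * z) • 1] : Matrix (Fin 2) (Fin 2) FockOp) κ κ' := by
  have hq := qpow_ne_zero η 1
  fin_cases κ <;> fin_cases κ' <;>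
  · simp [lHat, lHat', mHat, nHat, diagExp, siteSpin, Fin.sum_univ_two]
    simp only [add_mul, mul_add, one_mul, mul_one, smul_mul_assoc,
      mul_smul_comm, mul_assoc, oscQ_mul_oscQ_assoc, oscA_mul_oscQ_assoc,
      oscAstar_mul_oscQ_assoc, oscQ_mul_oscQ, oscA_mul_oscQ, oscAstar_mul_oscQ,
      oscA_mul_oscAstar, oscAstar_mul_oscA,
      smul_add]
    norm_num [qpow_two, qpow_neg, oscQ_zero]
    try match_scalars <;> field_simp <;> ring

/-! ### Operators on `V_a ⊗ W⁺ ⊗ H` -/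

/-- The block `⟨κ| Y |κ'⟩` with respect to the last site. -/
def blk {n : ℕ} (κ κ' : Fin 2) (Y : FullOp (n + 1)) : FullOp n :=
  fun x y => Y (x.1, snocCfg x.2 κ) (y.1, snocCfg y.2 κ')

/-- `x ⊗ id_H` for `x ∈ End V_a ⊗ End W⁺`. -/
def auxOp {n : ℕ} (x : AuxOp) : FullOp n := fun u v => if u.2 = v.2 then x u.1 v.1 else 0

/-- The matrix elements in `H` of an operator. -/
def entry {n : ℕ} (Y : FullOp n) (σ τ : Cfg n) : AuxOp := Matrix.of fun a b => Y (a, σ) (b, τ)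

/-- The matrix `ℓ` on `V_a ⊗ V_j`, with coefficients in `End W⁺`, acting on site `j`. -/
def siteOp {n : ℕ} (ℓ : Matrix (Fin 2 × Fin 2) (Fin 2 × Fin 2) FockOp) (j : Fin n) : FullOp n :=
  fun x y => if ∀ i, i ≠ j → x.2 i = y.2 i then ℓ (x.1, x.2 j) (y.1, y.2 j) else 0

/-- The block `⟨κ| ℓ |κ'⟩` with respect to `V_j`. -/
def siteBlock (ℓ : Matrix (Fin 2 × Fin 2) (Fin 2 × Fin 2) FockOp) (κ κ' : Fin 2) : AuxOp :=
  Matrix.of fun a b => ℓ (a, κ) (b, κ')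

section Blocks

variable {n : ℕ}

theorem blk_ext {Y W : FullOp (n + 1)} (h : ∀ κ κ', blk κ κ' Y = blk κ κ' W) : Y = W := by
  ext ⟨a, σ⟩ ⟨b, τ⟩ : 1
  obtain ⟨σ, κ, rfl⟩ := exists_snocCfg σ
  obtain ⟨τ, κ', rfl⟩ := exists_snocCfg τ
  exact congrFun (congrFun (h κ κ') (a, σ)) (b, τ)

theorem sum_snocCfg {M : Type*} [AddCommMonoid M] (f : Cfg (n + 1) → M) :
    ∑ σ, f σ = ∑ μ, ∑ σ, f (snocCfg σ μ) := by
  rw [← (Fin.snocEquiv fun _ : Fin (n + 1) => Fin 2).sum_comp, Fintype.sum_prod_type]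
  rfl

theorem blk_mul (Y W : FullOp (n + 1)) (κ κ' : Fin 2) :
    blk κ κ' (Y * W) = ∑ μ, blk κ μ Y * blk μ κ' W := by
  ext x y : 1
  simp only [blk, Matrix.mul_apply, Matrix.sum_apply, Fintype.sum_prod_type, sum_snocCfg]
  rw [Finset.sum_comm]

theorem auxOp_mul_apply (x : AuxOp) (Y : FullOp n) (u v : Fin 2 × Cfg n) :
    (auxOp x * Y : FullOp n) u v = ∑ c, x u.1 c * Y (c, u.2) v := by
  simp [Matrix.mul_apply, auxOp, Fintype.sum_prod_type]

theorem mul_auxOp_apply (x : AuxOp) (Y : FullOp n) (u v : Fin 2 × Cfg n) :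
    (Y * auxOp x : FullOp n) u v = ∑ c, Y u (c, v.2) * x c v.1 := by
  simp [Matrix.mul_apply, auxOp, Fintype.sum_prod_type]

theorem auxOp_mul_auxOp (x y : AuxOp) : (auxOp x * auxOp y : FullOp n) = auxOp (x * y) := by
  ext u v : 1
  rw [auxOp_mul_apply]
  simp only [auxOp, Matrix.mul_apply]
  split_ifs <;> simp

theorem auxOp_sum {ι : Type*} (s : Finset ι) (x : ι → AuxOp) :
    (auxOp (∑ i ∈ s, x i) : FullOp n) = ∑ i ∈ s, auxOp (x i) := by
  ext u v : 1
  simp only [auxOp, Matrix.sum_apply]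
  split_ifs <;> simp

theorem auxOp_diagonal (f : Fin 2 → FockOp) :
    (auxOp (Matrix.diagonal f) : FullOp n) = Matrix.diagonal fun u => f u.1 := by
  ext ⟨a, σ⟩ ⟨b, τ⟩ : 1
  simp only [auxOp, Matrix.diagonal_apply, Prod.mk.injEq]
  by_cases h : σ = τ <;> simp [h]

theorem blk_auxOp (x : AuxOp) (κ κ' : Fin 2) :
    blk κ κ' (auxOp x : FullOp (n + 1)) = if κ = κ' then auxOp x else 0 := by
  ext u v : 1
  have h : snocCfg u.2 κ = snocCfg v.2 κ' ↔ κ = κ' ∧ u.2 = v.2 := by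
    simp [snocCfg, Fin.snoc_inj, and_comm]
  by_cases hκ : κ = κ'
  · rw [if_pos hκ]
    exact if_congr (h.trans (and_iff_right hκ)) rfl rfl
  · rw [if_neg hκ]
    exact if_neg fun h' => hκ (h.1 h').1

theorem blk_auxOp_mul (x : AuxOp) (Y : FullOp (n + 1)) (κ κ' : Fin 2) :
    blk κ κ' (auxOp x * Y) = auxOp x * blk κ κ' Y := by
  rw [blk_mul, Finset.sum_eq_single κ]
  · rw [blk_auxOp, if_pos rfl]
  · intro μ _ h
    rw [blk_auxOp, if_neg h.symm, zero_mul]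
  · simp

theorem entry_auxOp_mul (x : AuxOp) (Y : FullOp n) (σ τ : Cfg n) :
    entry (auxOp x * Y) σ τ = x * entry Y σ τ := by
  ext a b : 1
  exact (auxOp_mul_apply x Y (a, σ) (b, τ)).trans (by
    simp only [entry, Matrix.of_apply, Matrix.mul_apply])

theorem entry_mul_auxOp (x : AuxOp) (Y : FullOp n) (σ τ : Cfg n) :
    entry (Y * auxOp x) σ τ = entry Y σ τ * x := by
  ext a b : 1
  exact (mul_auxOp_apply x Y (a, σ) (b, τ)).trans (by
    simp only [entry, Matrix.of_apply, Matrix.mul_apply])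

theorem entry_sum {ι : Type*} (s : Finset ι) (Y : ι → FullOp n) (σ τ : Cfg n) :
    entry (∑ i ∈ s, Y i) σ τ = ∑ i ∈ s, entry (Y i) σ τ := by
  ext a b : 1
  simp [entry, Matrix.sum_apply]

variable (ℓ ℓ' : Matrix (Fin 2 × Fin 2) (Fin 2 × Fin 2) FockOp)

theorem blk_siteOp_castSucc (j : Fin n) (κ κ' : Fin 2) :
    blk κ κ' (siteOp ℓ j.castSucc) = if κ = κ' then siteOp ℓ j else 0 := by
  ext u v : 1
  have h : (∀ i, i ≠ j.castSucc → snocCfg u.2 κ i = snocCfg v.2 κ' i) ↔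
      κ = κ' ∧ ∀ i, i ≠ j → u.2 i = v.2 i := by
    simp [Fin.forall_fin_succ', and_comm, Fin.ext_iff, (j.isLt.ne')]
  by_cases hκ : κ = κ'
  · rw [if_pos hκ]
    refine if_congr (h.trans (and_iff_right hκ)) ?_ rfl
    simp only [snocCfg_castSucc]
  · rw [if_neg hκ]
    exact if_neg fun h' => hκ (h.1 h').1

theorem blk_siteOp_last (κ κ' : Fin 2) :
    blk κ κ' (siteOp ℓ (Fin.last n)) = auxOp (siteBlock ℓ κ κ') := by
  ext u v : 1
  have h : (∀ i, i ≠ Fin.last n → snocCfg u.2 κ i = snocCfg v.2 κ' i) ↔ u.2 = v.2 := by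
    simp [Fin.forall_fin_succ', funext_iff, Fin.castSucc_ne_last]
  simp only [blk, siteOp, h, snocCfg_last, auxOp, siteBlock, Matrix.of_apply]

theorem blk_siteOp_castSucc_mul_mul (j : Fin n) (Y : FullOp (n + 1)) (κ κ' : Fin 2) :
    blk κ κ' (siteOp ℓ j.castSucc * Y * siteOp ℓ' j.castSucc) =
      siteOp ℓ j * blk κ κ' Y * siteOp ℓ' j := by
  simp [blk_mul, blk_siteOp_castSucc, ite_mul]

theorem siteBlock_mul (κ κ' : Fin 2) :
    siteBlock (ℓ * ℓ') κ κ' = ∑ μ, siteBlock ℓ κ μ * siteBlock ℓ' μ κ' := by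
  ext a b : 1
  simp only [siteBlock, Matrix.of_apply, Matrix.mul_apply, Matrix.sum_apply,
    Fintype.sum_prod_type_right]

theorem siteOp_mul_siteOp (j : Fin n) : siteOp ℓ j * siteOp ℓ' j = siteOp (ℓ * ℓ') j := by
  induction n with
  | zero => exact j.elim0
  | succ n ih =>
    refine blk_ext fun κ κ' => ?_
    refine Fin.lastCases ?_ (fun j => ?_) j
    · simp only [blk_mul, blk_siteOp_last, auxOp_mul_auxOp, siteBlock_mul, auxOp_sum]
    · simp only [blk_mul, blk_siteOp_castSucc, ite_mul, zero_mul, mul_ite, mul_zero,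
        Finset.sum_ite_eq', Finset.mem_univ, if_true, ih]

theorem siteOp_one (j : Fin n) : siteOp 1 j = 1 := by
  ext ⟨a, σ⟩ ⟨b, τ⟩ : 1
  have h : σ = τ ↔ (∀ i, i ≠ j → σ i = τ i) ∧ σ j = τ j := by
    refine ⟨fun h => by simp [h], fun h => funext fun i => ?_⟩
    by_cases hi : i = j
    · rw [hi, h.2]
    · exact h.1 i hi
  simp only [siteOp, Matrix.one_apply, Prod.mk.injEq, h]
  by_cases h1 : ∀ i, i ≠ j → σ i = τ i
  · simp only [eq_true h1, true_and, if_true]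
  · simp [h1]

theorem inverse_siteOp {ℓ ℓ' : Matrix (Fin 2 × Fin 2) (Fin 2 × Fin 2) FockOp} (h : ℓ * ℓ' = 1)
    (h' : ℓ' * ℓ = 1) (j : Fin n) : Ring.inverse (siteOp ℓ j) = siteOp ℓ' j :=
  Ring.inverse_unit (⟨siteOp ℓ j, siteOp ℓ' j, by rw [siteOp_mul_siteOp, h, siteOp_one],
    by rw [siteOp_mul_siteOp, h', siteOp_one]⟩ : (FullOp n)ˣ)

/-- The product `ℓ_n ⋯ ℓ_1 Y ℓ'_1 ⋯ ℓ'_n`. -/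
def conjSites (n : ℕ) (Y : FullOp n) : FullOp n :=
  (List.finRange n).foldl (fun Z j => siteOp ℓ j * Z * siteOp ℓ' j) Y

theorem adjointMonodromy_siteOp {ℓ ℓ' : Matrix (Fin 2 × Fin 2) (Fin 2 × Fin 2) FockOp}
    (h : ℓ * ℓ' = 1) (h' : ℓ' * ℓ = 1) (Y : FullOp n) :
    adjointMonodromy (siteOp ℓ) Y = conjSites ℓ ℓ' n Y := by
  simp only [adjointMonodromy, conjSites, List.ofFn_eq_map, List.foldl_map, inverse_siteOp h h']

/-- In blocks with respect to the last site, the factors of the last site act as matrices over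
`End V_a ⊗ End W⁺`, and the other ones act within each block. -/
theorem blk_conjSites (Y : FullOp (n + 1)) (κ κ' : Fin 2) :
    blk κ κ' (conjSites ℓ ℓ' (n + 1) Y) = ∑ μ, ∑ ν, auxOp (siteBlock ℓ κ μ) *
      conjSites ℓ ℓ' n (blk μ ν Y) * auxOp (siteBlock ℓ' ν κ') := by
  have h (l : List (Fin n)) (Y : FullOp (n + 1)) (μ ν : Fin 2) :
      blk μ ν (l.foldl (fun Z j => siteOp ℓ j.castSucc * Z * siteOp ℓ' j.castSucc) Y) =
        l.foldl (fun Z j => siteOp ℓ j * Z * siteOp ℓ' j) (blk μ ν Y) := by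
    induction l generalizing Y with
    | nil => rfl
    | cons j l ih => rw [List.foldl_cons, ih, blk_siteOp_castSucc_mul_mul, List.foldl_cons]
  simp only [conjSites, List.finRange_succ_last, List.foldl_append, List.foldl_map,
    List.foldl_cons, List.foldl_nil, blk_mul, blk_siteOp_last, h, Finset.sum_mul]
  rw [Finset.sum_comm]

theorem conjSites_sum {ι : Type*} (s : Finset ι) (Y : ι → FullOp n) :
    conjSites ℓ ℓ' n (∑ i ∈ s, Y i) = ∑ i ∈ s, conjSites ℓ ℓ' n (Y i) := by
  simp only [conjSites]
  generalize List.finRange n = l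
  induction l generalizing Y with
  | nil => rfl
  | cons j l ih => simp only [List.foldl_cons, Finset.mul_sum, Finset.sum_mul, ih]

theorem conjSites_mul_mul {u v : FullOp n} (hu : ∀ j, Commute u (siteOp ℓ j))
    (hv : ∀ j, Commute v (siteOp ℓ' j)) (Y : FullOp n) :
    conjSites ℓ ℓ' n (u * Y * v) = u * conjSites ℓ ℓ' n Y * v := by
  simp only [conjSites]
  generalize List.finRange n = l
  induction l generalizing Y with
  | nil => rfl
  | cons j l ih =>
    have : siteOp ℓ j * (u * Y * v) * siteOp ℓ' j = u * (siteOp ℓ j * Y * siteOp ℓ' j) * v := by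
      rw [mul_assoc u, ← mul_assoc (siteOp ℓ j), ← (hu j).eq, mul_assoc, mul_assoc, mul_assoc,
        (hv j).eq]
      simp only [mul_assoc]
    simp only [List.foldl_cons, this, ih]

end Blocks

/-! ### The adjoint action of the monodromies -/

/-- A matrix on `V_a ⊗ V_j` acting trivially on `W⁺`. -/
def ofAux (r : Matrix (Fin 2 × Fin 2) (Fin 2 × Fin 2) ℂ) :
    Matrix (Fin 2 × Fin 2) (Fin 2 × Fin 2) FockOp :=
  fun x y => algebraMap ℂ FockOp (r x y)

/-- A matrix on `W⁺ ⊗ V_j` acting trivially on `V_a`. -/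
def ofOsc (l : Matrix (Fin 2) (Fin 2) FockOp) :
    Matrix (Fin 2 × Fin 2) (Fin 2 × Fin 2) FockOp :=
  fun x y => if x.1 = y.1 then l x.2 y.2 else 0

theorem Laux_eq (η ζ : ℂ) {n : ℕ} : (Laux η ζ : Fin n → FullOp n) = siteOp (ofAux (Rmat η ζ)) :=
  rfl

theorem Losc_eq (η ζ : ℂ) {n : ℕ} :
    (Losc η ζ : Fin n → FullOp n) = siteOp (ofOsc (oscMat η ζ)) := by
  funext j
  ext x y : 1
  simp only [Losc, siteOp, ofOsc, and_comm (a := x.1 = y.1), ite_and]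

/-- The twist `q^{α σ_a^z} q^{2α D_A}`. -/
def twist (η α : ℂ) : AuxOp :=
  Matrix.diagonal fun a => (if a = 0 then qpow η α else qpow η (-α)) • oscQ η (2 * α)

theorem commute_auxOp_siteOp {n : ℕ} (o : FockOp) (r : Matrix (Fin 2 × Fin 2) (Fin 2 × Fin 2) ℂ)
    (j : Fin n) : Commute (auxOp (Matrix.diagonal fun _ => o) : FullOp n) (siteOp (ofAux r) j) := by
  rw [auxOp_diagonal]
  ext u v : 1
  rw [Matrix.diagonal_mul, Matrix.mul_diagonal, siteOp, ofAux]
  split_ifs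
  · exact (Algebra.commutes _ _).symm
  · simp

theorem siteBlock_ofOsc (l : Matrix (Fin 2) (Fin 2) FockOp) (κ κ' : Fin 2) :
    siteBlock (ofOsc l) κ κ' = Matrix.diagonal fun _ => l κ κ' := by
  ext a b : 1
  simp [siteBlock, ofOsc, Matrix.diagonal_apply]

theorem combine_eq (r : Matrix (Fin 2 × Fin 2) (Fin 2 × Fin 2) ℂ)
    (l : Matrix (Fin 2) (Fin 2) FockOp)
    (κ μ : Fin 2) :
    combine r l κ μ = ∑ ρ, siteBlock (ofAux r) κ ρ * siteBlock (ofOsc l) ρ μ := by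
  ext a b : 1
  simp only [siteBlock_ofOsc, Matrix.sum_apply, Matrix.mul_diagonal]
  simp only [combine, siteBlock, ofAux, Matrix.of_apply, Algebra.smul_def]

theorem combine'_eq (r : Matrix (Fin 2 × Fin 2) (Fin 2 × Fin 2) ℂ)
    (l : Matrix (Fin 2) (Fin 2) FockOp) (κ μ : Fin 2) :
    combine' r l κ μ = ∑ ρ, siteBlock (ofOsc l) κ ρ * siteBlock (ofAux r) ρ μ := by
  ext a b : 1
  simp only [siteBlock_ofOsc, Matrix.sum_apply, Matrix.diagonal_mul]
  simp only [combine', siteBlock, ofAux, Matrix.of_apply, Algebra.smul_def, Algebra.commutes]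

theorem blk_embedSeg {n : ℕ} (X : SegOp (n + 1)) (κ κ' : Fin 2) :
    blk κ κ' (embedSeg X) = embedSeg (lastBlock κ κ' X) := rfl

theorem sum_sum_sum_sum_comm {ι M : Type*} [Fintype ι] [AddCommMonoid M]
    (f : ι → ι → ι → ι → M) :
    ∑ a, ∑ b, ∑ c, ∑ d, f a b c d = ∑ c, ∑ d, ∑ b, ∑ a, f a b c d := by
  calc ∑ a, ∑ b, ∑ c, ∑ d, f a b c d = ∑ a, ∑ c, ∑ b, ∑ d, f a b c d :=
        Finset.sum_congr rfl fun a _ => Finset.sum_comm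
    _ = ∑ c, ∑ a, ∑ b, ∑ d, f a b c d := Finset.sum_comm
    _ = ∑ c, ∑ a, ∑ d, ∑ b, f a b c d :=
        Finset.sum_congr rfl fun c _ => Finset.sum_congr rfl fun a _ => Finset.sum_comm
    _ = ∑ c, ∑ d, ∑ a, ∑ b, f a b c d := Finset.sum_congr rfl fun c _ => Finset.sum_comm
    _ = ∑ c, ∑ d, ∑ b, ∑ a, f a b c d :=
        Finset.sum_congr rfl fun c _ => Finset.sum_congr rfl fun d _ => Finset.sum_comm

/-- The two successive adjoint actions amount to a single transport, by the products
`L_{a,j} L_{A,j}`, because `L_{a,j}` commutes with `L_{A,i}` for `i ≠ j`. -/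
theorem entry_conjSites_conjSites (η α : ℂ) (r r' : Matrix (Fin 2 × Fin 2) (Fin 2 × Fin 2) ℂ)
    (l l' : Matrix (Fin 2) (Fin 2) FockOp) {n : ℕ} (X : SegOp n) (σ τ : Cfg n) :
    entry (conjSites (ofAux r) (ofAux r') n (twistAux η α n *
      conjSites (ofOsc l) (ofOsc l') n (twistOsc η α n * embedSeg X))) σ τ =
      transport (combine r l) (combine' r' l') (twist η α) n X σ τ := by
  have hA (n : ℕ) : twistAux η α n = auxOp (Matrix.diagonal fun a =>
      algebraMap ℂ FockOp (if a = 0 then qpow η α else qpow η (-α))) := by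
    rw [auxOp_diagonal]; rfl
  have hO (n : ℕ) : twistOsc η α n = auxOp (Matrix.diagonal fun _ => oscQ η (2 * α)) := by
    rw [auxOp_diagonal]; rfl
  have htw : twist η α = (Matrix.diagonal fun a =>
      algebraMap ℂ FockOp (if a = 0 then qpow η α else qpow η (-α))) *
        Matrix.diagonal fun _ => oscQ η (2 * α) := by
    rw [twist, Matrix.diagonal_mul_diagonal]
    simp only [Algebra.smul_def]
  induction n with
  | zero =>
    have hX : entry (embedSeg X) σ τ = X σ τ • (1 : AuxOp) := by
      ext a b : 1
      by_cases h : a = b <;> simp [entry, embedSeg, h, Algebra.algebraMap_eq_smul_one]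
    simp only [conjSites, List.finRange_zero, List.foldl_nil, hA, hO, entry_auxOp_mul, hX,
      transport, htw, mul_smul_comm, mul_one]
  | succ n ih =>
    obtain ⟨σ, κ, rfl⟩ := exists_snocCfg σ
    obtain ⟨τ, κ', rfl⟩ := exists_snocCfg τ
    -- The oscillator part of the new site commutes with the matrices `L_{a,j}` of the other sites.
    have hcomm (x y : FockOp) (Y : FullOp n) :
        conjSites (ofAux r) (ofAux r') n (twistAux η α n *
          (auxOp (Matrix.diagonal fun _ => x) * Y * auxOp (Matrix.diagonal fun _ => y))) =
        auxOp (Matrix.diagonal fun _ => x) * conjSites (ofAux r) (ofAux r') n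
          (twistAux η α n * Y) * auxOp (Matrix.diagonal fun _ => y) := by
      rw [← conjSites_mul_mul _ _ (commute_auxOp_siteOp x r) (commute_auxOp_siteOp y r'),
        ← mul_assoc, ← mul_assoc, ← mul_assoc]
      congr 3
      rw [hA, auxOp_diagonal, auxOp_diagonal, Matrix.diagonal_mul_diagonal,
        Matrix.diagonal_mul_diagonal]
      simp only [Algebra.commutes]
    have hblk := blk_conjSites (ofAux r) (ofAux r') (twistAux η α (n + 1) *
      conjSites (ofOsc l) (ofOsc l') (n + 1) (twistOsc η α (n + 1) * embedSeg X)) κ κ'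
    rw [hA (n + 1), hO (n + 1)] at hblk
    simp only [blk_auxOp_mul, blk_conjSites (ofOsc l), blk_embedSeg, siteBlock_ofOsc] at hblk
    simp only [Finset.mul_sum, ← hA, ← hO, conjSites_sum, hcomm] at hblk
    have hent := congrArg (fun Y => entry Y σ τ) hblk
    simp only [entry_sum, entry_auxOp_mul, entry_mul_auxOp, ih, Finset.sum_mul] at hent
    rw [transport_snocCfg]
    refine Eq.trans ?_ (hent.trans ?_)
    · rfl
    · simp only [combine_eq, combine'_eq, siteBlock_ofOsc, Finset.sum_mul, Finset.mul_sum,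
        mul_assoc]
      exact sum_sum_sum_sum_comm _

/-! ### Inverses of the `L`-operators and the gauge transformation -/

theorem fockOp_sub_eq (x y : FockOp) : x - y = x + (-1 : ℂ) • y := by
  refine fockOp_ext fun k => ?_
  simp [sub_eq_add_neg]

theorem fockOp_neg_eq (x : FockOp) : -x = (-1 : ℂ) • x := by
  refine fockOp_ext fun k => ?_
  simp

/-- The operator `ζ^D` on `W⁺`. -/
def fockPow (ζ : ℂ) : FockOp := fockDiag fun k => ζ ^ k

theorem fockDiag_mul_fockDiag (f g : ℕ → ℂ) : fockDiag f * fockDiag g = fockDiag (f * g) := by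
  refine fockOp_ext fun k => ?_
  simp only [Module.End.mul_apply, fockDiag_single, map_smul, smul_smul, Pi.mul_apply]
  rw [mul_comm]

theorem fockDiag_one : fockDiag 1 = 1 := by
  refine fockOp_ext fun k => ?_
  simp [fockDiag_single]

theorem fockPow_inv_mul {ζ : ℂ} (hζ : ζ ≠ 0) : fockPow ζ⁻¹ * fockPow ζ = 1 := by
  rw [fockPow, fockPow, fockDiag_mul_fockDiag, ← fockDiag_one]
  congr 1
  funext k
  simp [hζ]

theorem fockPow_mul_inv {ζ : ℂ} (hζ : ζ ≠ 0) : fockPow ζ * fockPow ζ⁻¹ = 1 := by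
  have := fockPow_inv_mul (inv_ne_zero hζ)
  rwa [inv_inv] at this

theorem oscQ_mul_fockPow (η c ζ : ℂ) : oscQ η c * fockPow ζ = fockPow ζ * oscQ η c := by
  rw [fockPow, oscQ_eq_fockDiag, fockDiag_mul_fockDiag, fockDiag_mul_fockDiag, mul_comm]

theorem fockPow_mul_oscA {ζ : ℂ} (hζ : ζ ≠ 0) (η : ℂ) :
    fockPow ζ * oscA η = ζ⁻¹ • (oscA η * fockPow ζ) := by
  refine fockOp_ext fun k => ?_
  simp only [fockPow, Module.End.mul_apply, fockDiag_single, oscA_single, map_smul, smul_smul,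
    LinearMap.smul_apply]
  cases k with
  | zero => simp [qpow_zero]
  | succ k =>
    rw [Nat.add_sub_cancel, pow_succ]
    congr 1
    field_simp

theorem fockPow_mul_oscAstar (ζ : ℂ) :
    fockPow ζ * oscAstar = ζ • (oscAstar * fockPow ζ) := by
  refine fockOp_ext fun k => ?_
  simp only [fockPow, Module.End.mul_apply, fockDiag_single, oscAstar_single, map_smul, smul_smul,
    LinearMap.smul_apply, pow_succ']

/-- `L_{A,j}(ζ)` depends on the sign of `ζ` only through a conjugation by `ζ^D`. -/
theorem oscMat_eq {ζ : ℂ} (hζ : ζ ≠ 0) (η : ℂ) (κ μ : Fin 2) :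
    oscMat η ζ κ μ = fockPow ζ * lHat η (ζ ^ 2) κ μ * fockPow ζ⁻¹ := by
  have h1 := fockPow_mul_inv hζ
  have h2 (c : ℂ) (x : FockOp) : oscQ η c * (fockPow ζ⁻¹ * x) = fockPow ζ⁻¹ * (oscQ η c * x) := by
    rw [← mul_assoc, oscQ_mul_fockPow, mul_assoc]
  have h3 (x : FockOp) : fockPow ζ * (fockPow ζ⁻¹ * x) = x := by rw [← mul_assoc, h1, one_mul]
  have h4 (x : FockOp) : fockPow ζ * (oscA η * x) = ζ⁻¹ • (oscA η * (fockPow ζ * x)) := by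
    rw [← mul_assoc, fockPow_mul_oscA hζ, smul_mul_assoc, mul_assoc]
  have h5 (x : FockOp) : fockPow ζ * (oscAstar * x) = ζ • (oscAstar * (fockPow ζ * x)) := by
    rw [← mul_assoc, fockPow_mul_oscAstar, smul_mul_assoc, mul_assoc]
  fin_cases κ <;> fin_cases μ <;>
  · simp only [oscMat, Matrix.mul_apply, Fin.sum_univ_two]
    simp only [Fin.zero_eta, Fin.mk_one, lHat, mHat, diagExp, Matrix.of_apply, Matrix.cons_val',
      Matrix.cons_val_zero, Matrix.cons_val_one, Matrix.cons_val_fin_one, mul_zero, add_zero,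
      zero_add, fockOp_sub_eq, fockOp_neg_eq, if_true,
      one_ne_zero, if_false, oscQ_mul_fockPow, mul_assoc, add_mul, mul_add, one_mul, smul_mul_assoc,
      mul_smul_comm, h2, h3, h4, h5, smul_smul]
    try match_scalars <;> field_simp

theorem sum_lHat_mul_lHat' (η z : ℂ) (κ κ' : Fin 2) :
    ∑ μ, lHat η z κ μ * lHat' η z μ κ' = if κ = κ' then (1 - z) • 1 else 0 := by
  have hq := qpow_ne_zero η 1
  fin_cases κ <;> fin_cases κ' <;>
  · simp [lHat, lHat', mHat, nHat, diagExp, Fin.sum_univ_two]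
    simp only [add_mul, mul_add, one_mul, mul_one, smul_mul_assoc,
      mul_smul_comm, mul_assoc, oscQ_mul_oscQ_assoc, oscA_mul_oscQ_assoc,
      oscAstar_mul_oscQ_assoc, oscQ_mul_oscQ, oscA_mul_oscQ, oscAstar_mul_oscQ,
      oscA_mul_oscAstar, oscAstar_mul_oscA,
      smul_add]
    norm_num [qpow_two, qpow_neg, oscQ_zero]
    try match_scalars <;> field_simp <;> ring

theorem sum_lHat'_mul_lHat (η z : ℂ) (κ κ' : Fin 2) :
    ∑ μ, lHat' η z κ μ * lHat η z μ κ' = if κ = κ' then (1 - z) • 1 else 0 := by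
  have hq := qpow_ne_zero η 1
  fin_cases κ <;> fin_cases κ' <;>
  · simp [lHat, lHat', mHat, nHat, diagExp, Fin.sum_univ_two]
    simp only [add_mul, mul_add, one_mul, mul_one, smul_mul_assoc,
      mul_smul_comm, mul_assoc, oscQ_mul_oscQ_assoc, oscA_mul_oscQ_assoc,
      oscAstar_mul_oscQ_assoc, oscQ_mul_oscQ, oscA_mul_oscQ, oscAstar_mul_oscQ,
      oscA_mul_oscAstar, oscAstar_mul_oscA,
      smul_add]
    norm_num [qpow_two, qpow_neg, oscQ_zero]
    try match_scalars <;> field_simp <;> ring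

/-- The inverse of `oscMat`. -/
def oscMatInv (η ζ : ℂ) : Matrix (Fin 2) (Fin 2) FockOp :=
  Matrix.of fun κ μ => (1 - ζ ^ 2)⁻¹ • (fockPow ζ * lHat' η (ζ ^ 2) κ μ * fockPow ζ⁻¹)

theorem ofOsc_mul (l l' : Matrix (Fin 2) (Fin 2) FockOp) : ofOsc l * ofOsc l' = ofOsc (l * l') := by
  ext x y : 1
  simp only [ofOsc, Matrix.mul_apply, Fintype.sum_prod_type, ite_mul, zero_mul, mul_ite, mul_zero]
  by_cases h : x.1 = y.1 <;> simp [h]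

theorem ofOsc_one : ofOsc 1 = 1 := by
  ext x y : 1
  by_cases h : x.1 = y.1 <;> simp [ofOsc, Matrix.one_apply, Prod.ext_iff, h]

theorem ofAux_mul (r r' : Matrix (Fin 2 × Fin 2) (Fin 2 × Fin 2) ℂ) :
    ofAux r * ofAux r' = ofAux (r * r') := by
  ext x y : 1
  simp only [ofAux, Matrix.mul_apply, map_sum, map_mul]

theorem ofAux_one : ofAux 1 = 1 := by
  ext x y : 1
  by_cases h : x = y <;> simp [ofAux, Matrix.one_apply, h]

section OscInverse

variable {η ζ : ℂ}

theorem oscMat_mul_inv (hζ : ζ ≠ 0) (hz : ζ ^ 2 ≠ 1) : oscMat η ζ * oscMatInv η ζ = 1 := by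
  have h3 (x : FockOp) : fockPow ζ⁻¹ * (fockPow ζ * x) = x := by
    rw [← mul_assoc, fockPow_inv_mul hζ, one_mul]
  have hz' : 1 - ζ ^ 2 ≠ 0 := sub_ne_zero.2 hz.symm
  ext κ κ' : 1
  simp only [Matrix.mul_apply, oscMat_eq hζ, oscMatInv, Matrix.of_apply, mul_smul_comm, mul_assoc,
    h3]
  rw [← Finset.smul_sum, ← Finset.mul_sum]
  simp only [← mul_assoc (lHat _ _ _ _)]
  rw [← Finset.sum_mul, sum_lHat_mul_lHat', Matrix.one_apply]
  split_ifs
  · rw [smul_mul_assoc, one_mul, mul_smul_comm, fockPow_mul_inv hζ, smul_smul,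
      inv_mul_cancel₀ hz', one_smul]
  · rw [zero_mul, mul_zero, smul_zero]

theorem oscMat_inv_mul (hζ : ζ ≠ 0) (hz : ζ ^ 2 ≠ 1) : oscMatInv η ζ * oscMat η ζ = 1 := by
  have h3 (x : FockOp) : fockPow ζ⁻¹ * (fockPow ζ * x) = x := by
    rw [← mul_assoc, fockPow_inv_mul hζ, one_mul]
  have hz' : 1 - ζ ^ 2 ≠ 0 := sub_ne_zero.2 hz.symm
  ext κ κ' : 1
  simp only [Matrix.mul_apply, oscMat_eq hζ, oscMatInv, Matrix.of_apply, smul_mul_assoc, mul_assoc,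
    h3]
  rw [← Finset.smul_sum, ← Finset.mul_sum]
  simp only [← mul_assoc (lHat' _ _ _ _)]
  rw [← Finset.sum_mul, sum_lHat'_mul_lHat, Matrix.one_apply]
  split_ifs
  · rw [smul_mul_assoc, one_mul, mul_smul_comm, fockPow_mul_inv hζ, smul_smul,
      inv_mul_cancel₀ hz', one_smul]
  · rw [zero_mul, mul_zero, smul_zero]

end OscInverse

theorem sixVertex_mul_eq_one {a b c d a' b' c' d' : ℂ} (h0 : a * a' = 1) (h1 : b * b' + c * d' = 1)
    (h2 : b * c' + c * b' = 0) (h3 : d * b' + b * d' = 0) (h4 : d * c' + b * b' = 1) :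
    sixVertex a b c d * sixVertex a' b' c' d' = 1 := by
  ext ⟨x1, x2⟩ ⟨y1, y2⟩
  fin_cases x1 <;> fin_cases x2 <;> fin_cases y1 <;> fin_cases y2 <;>
    simp [Matrix.mul_apply, Fintype.sum_prod_type, sixVertex, h0, h1, h2, h3, h4]

/-- The inverse of `Rmat`. -/
def RmatInv (η ζ : ℂ) : Matrix (Fin 2 × Fin 2) (Fin 2 × Fin 2) ℂ :=
  sixVertex 1 ((1 - ζ ^ 2) * qpow η 1 / (qpow η 2 - ζ ^ 2))
    (-((1 - qpow η 2) * ζ / (qpow η 2 - ζ ^ 2))) (-((1 - qpow η 2) * ζ / (qpow η 2 - ζ ^ 2)))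

theorem Rmat_eq (η ζ : ℂ) : Rmat η ζ = sixVertex 1 (beta η ζ) (gamma η ζ) (gamma η ζ) := by
  funext x y
  simp only [Rmat, sixVertex, ite_self]

section RInverse

variable {η ζ : ℂ}

theorem Rmat_mul_inv (h : 1 - qpow η 2 * ζ ^ 2 ≠ 0) (h' : qpow η 2 - ζ ^ 2 ≠ 0) :
    Rmat η ζ * RmatInv η ζ = 1 := by
  have hc : 1 - ζ ^ 2 * qpow η 2 ≠ 0 := by rwa [mul_comm]
  rw [Rmat_eq, RmatInv]
  simp only [beta, gamma]
  rw [qpow_two] at *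
  apply sixVertex_mul_eq_one <;> field_simp <;> ring

theorem Rmat_inv_mul (h : 1 - qpow η 2 * ζ ^ 2 ≠ 0) (h' : qpow η 2 - ζ ^ 2 ≠ 0) :
    RmatInv η ζ * Rmat η ζ = 1 := by
  have hc : 1 - ζ ^ 2 * qpow η 2 ≠ 0 := by rwa [mul_comm]
  rw [Rmat_eq, RmatInv]
  simp only [beta, gamma]
  rw [qpow_two] at *
  apply sixVertex_mul_eq_one <;> field_simp <;> ring

end RInverse

/-- The operator `diag(1, ζ⁻¹) ζ^D` on `V_a ⊗ W⁺`. -/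
def gauge (ζ : ℂ) : AuxOp := Matrix.diagonal fun a => (if a = 0 then 1 else ζ⁻¹) • fockPow ζ

theorem gauge_inv_mul {ζ : ℂ} (hζ : ζ ≠ 0) : gauge ζ⁻¹ * gauge ζ = 1 := by
  rw [gauge, gauge, Matrix.diagonal_mul_diagonal, ← Matrix.diagonal_one]
  congr 1
  funext a
  rw [smul_mul_smul_comm, fockPow_inv_mul hζ]
  split_ifs <;> simp [hζ]

theorem gauge_conj_apply (ζ : ℂ) (x : AuxOp) (a b : Fin 2) :
    (gauge ζ * x * gauge ζ⁻¹) a b = ((if a = 0 then 1 else ζ⁻¹) * (if b = 0 then 1 else ζ)) •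
      (fockPow ζ * x a b * fockPow ζ⁻¹) := by
  rw [gauge, gauge, Matrix.mul_diagonal, Matrix.diagonal_mul, smul_mul_assoc, mul_smul_comm,
    smul_mul_assoc, smul_smul, mul_comm, inv_inv]

section Gauge

variable {η ζ : ℂ}

theorem combine_eq_gauge (hζ : ζ ≠ 0) (h : 1 - qpow η 2 * ζ ^ 2 ≠ 0) (κ μ : Fin 2) :
    combine (Rmat η ζ) (oscMat η ζ) κ μ = (1 - qpow η 2 * ζ ^ 2)⁻¹ •
      (gauge ζ * combine (rHat η (ζ ^ 2)) (lHat η (ζ ^ 2)) κ μ * gauge ζ⁻¹) := by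
  have hr (x y : Fin 2 × Fin 2) : Rmat η ζ x y = (1 - qpow η 2 * ζ ^ 2)⁻¹ *
      ((if x.1 = 0 then 1 else ζ⁻¹) * (if y.1 = 0 then 1 else ζ) * rHat η (ζ ^ 2) x y) := by
    obtain ⟨x1, x2⟩ := x
    obtain ⟨y1, y2⟩ := y
    rw [Rmat_eq, rHat]
    fin_cases x1 <;> fin_cases x2 <;> fin_cases y1 <;> fin_cases y2 <;>
      simp [sixVertex, beta, gamma] <;> field_simp
  ext a c : 1
  rw [Matrix.smul_apply, gauge_conj_apply]
  simp only [combine, Matrix.of_apply, oscMat_eq hζ, hr, Finset.mul_sum, Finset.sum_mul,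
    Finset.smul_sum, mul_smul_comm, smul_mul_assoc, smul_smul]

theorem combine'_eq_gauge (hζ : ζ ≠ 0) (h' : qpow η 2 - ζ ^ 2 ≠ 0) (κ μ : Fin 2) :
    combine' (RmatInv η ζ) (oscMatInv η ζ) κ μ = ((qpow η 2 - ζ ^ 2)⁻¹ * (1 - ζ ^ 2)⁻¹) •
      (gauge ζ * combine' (rHat' η (ζ ^ 2)) (lHat' η (ζ ^ 2)) κ μ * gauge ζ⁻¹) := by
  have hr (x y : Fin 2 × Fin 2) : RmatInv η ζ x y = (qpow η 2 - ζ ^ 2)⁻¹ *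
      ((if x.1 = 0 then 1 else ζ⁻¹) * (if y.1 = 0 then 1 else ζ) * rHat' η (ζ ^ 2) x y) := by
    obtain ⟨x1, x2⟩ := x
    obtain ⟨y1, y2⟩ := y
    rw [RmatInv, rHat']
    fin_cases x1 <;> fin_cases x2 <;> fin_cases y1 <;> fin_cases y2 <;>
      simp [sixVertex] <;> field_simp <;> ring
  ext a c : 1
  rw [Matrix.smul_apply, gauge_conj_apply]
  simp only [combine', Matrix.of_apply, oscMatInv, hr, Finset.mul_sum, Finset.sum_mul,
    Finset.smul_sum, mul_smul_comm, smul_mul_assoc, smul_smul]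
  refine Finset.sum_congr rfl fun ρ _ => ?_
  congr 1
  ring

theorem twist_eq_gauge (hζ : ζ ≠ 0) (α : ℂ) : twist η α = gauge ζ * twist η α * gauge ζ⁻¹ := by
  ext a b : 1
  rw [gauge_conj_apply, twist, Matrix.diagonal_apply]
  by_cases hab : a = b
  · subst hab
    by_cases h : a = 0 <;>
      simp [h, mul_assoc, oscQ_mul_fockPow, hζ, ← mul_assoc (fockPow ζ), fockPow_mul_inv hζ]
  · simp [hab]

end Gauge

/-! ### The trace over one more site -/

section OneSite

variable {η α z : ℂ} {x : FockOp}

theorem oscQ_two_mul_mem_traceable (hx : x ∈ traceable η α) : oscQ η 2 * x ∈ traceable η α := by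
  have := oscQ_mul_mul_oscQ_mem_traceable (b := 2) (c := 0) (m := 1) (by norm_num) hx
  simpa [oscQ_zero] using this

theorem conj_mHat_mul_mem_traceable (c : ℂ) (κ μ : Fin 2) (hx : x ∈ traceable η α) :
    oscQ η (-c) * (mHat η z κ μ * (oscQ η c * x)) ∈ traceable η α := by
  fin_cases κ <;> fin_cases μ <;>
    simp only [mHat, Fin.zero_eta, Fin.mk_one, Matrix.of_apply, Matrix.cons_val',
      Matrix.cons_val_zero,
      Matrix.cons_val_one, Matrix.cons_val_fin_one, add_mul, one_mul, mul_add, smul_mul_assoc,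
      mul_smul_comm, oscA_mul_oscQ_assoc, oscAstar_mul_oscQ_assoc, oscQ_mul_oscQ_assoc,
      neg_add_cancel, oscQ_zero]
  · refine Submodule.add_mem _ hx (Submodule.smul_mem _ _ ?_)
    convert oscQ_two_mul_mem_traceable hx using 3
    ring
  · exact Submodule.smul_mem _ _ (Submodule.smul_mem _ _ (oscA_mul_mem_traceable hx))
  · exact Submodule.smul_mem _ _ (Submodule.smul_mem _ _ (oscAstar_mul_mem_traceable hx))
  · exact hx

theorem conj_nHat_mul_mem_traceable (c : ℂ) (κ μ : Fin 2) (hx : x ∈ traceable η α) :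
    oscQ η (-c) * (nHat η z κ μ * (oscQ η c * x)) ∈ traceable η α := by
  fin_cases κ <;> fin_cases μ <;>
    simp only [nHat, Fin.zero_eta, Fin.mk_one, Matrix.of_apply, Matrix.cons_val',
      Matrix.cons_val_zero,
      Matrix.cons_val_one, Matrix.cons_val_fin_one, add_mul, one_mul, mul_add, smul_mul_assoc,
      mul_smul_comm, oscA_mul_oscQ_assoc, oscAstar_mul_oscQ_assoc, oscQ_mul_oscQ_assoc,
      neg_add_cancel, oscQ_zero]
  · exact hx
  · exact Submodule.smul_mem _ _ (Submodule.smul_mem _ _ (oscA_mul_mem_traceable hx))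
  · exact Submodule.smul_mem _ _ (oscAstar_mul_mem_traceable hx)
  · refine Submodule.add_mem _ hx (Submodule.smul_mem _ _ ?_)
    convert oscQ_two_mul_mem_traceable hx using 3
    ring

theorem lHat'_mul_lHat_mul_mem_traceable (κ μ κ' : Fin 2) (hx : x ∈ traceable η α) :
    lHat' η z μ κ' * lHat η z κ μ * x ∈ traceable η α := by
  have := conj_nHat_mul_mem_traceable (z := z) (diagExp μ) μ κ'
    (conj_mHat_mul_mem_traceable (z := z) (diagExp μ) κ μ hx)
  rw [oscQ_mul_oscQ_assoc, add_neg_cancel, oscQ_zero, one_mul] at this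
  simpa only [lHat, lHat', mul_assoc] using this

theorem lHat_mul_mul_lHat'_mem_traceable (κ μ ν κ' : Fin 2) (hx : x ∈ traceable η α) :
    lHat η z κ μ * x * lHat' η z ν κ' ∈ traceable η α :=
  apply_mem_traceable (lHat_mul_mul_lHat'_mem (const_mem_polyFamily hx) κ μ ν κ') z

theorem oscTrace_sum (hα : ∀ m : ℤ, qpow η (2 * (α + m)) ≠ 1) {ι : Type*} (s : Finset ι)
    {f : ι → FockOp} (hf : ∀ i ∈ s, f i ∈ traceable η α) :
    oscTrace (∑ i ∈ s, f i) = ∑ i ∈ s, oscTrace (f i) := by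
  classical
  induction s using Finset.induction_on with
  | empty => simpa using oscTrace_zero
  | insert i s hi ih =>
    rw [Finset.sum_insert hi, Finset.sum_insert hi, oscTrace_add hα (hf i (by simp))
      (Submodule.sum_mem _ fun j hj => hf j (by simp [hj])), ih fun j hj => hf j (by simp [hj])]

/-- The one-site operation of the oscillator monodromy on an operator that is the identity on the
new site, before the trace. -/
def oscSite (η z : ℂ) (ρ ρ' : Fin 2) (x : FockOp) : FockOp :=
  ∑ μ, qpow η (-2 * siteSpin μ) • (lHat η z ρ μ * x * lHat' η z μ ρ')

theorem oscSite_mem_traceable (ρ ρ' : Fin 2) (hx : x ∈ traceable η α) :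
    oscSite η z ρ ρ' x ∈ traceable η α :=
  Submodule.sum_mem _ fun _ _ =>
    Submodule.smul_mem _ _ (lHat_mul_mul_lHat'_mem_traceable _ _ _ _ hx)

theorem oscTrace_oscSite (hα : ∀ m : ℤ, qpow η (2 * (α + m)) ≠ 1) (hx : x ∈ traceable η α)
    (ρ ρ' : Fin 2) : oscTrace (oscSite η z ρ ρ' x) =
      oscTrace ((!![(qpow η (-1) - qpow η 1 * z) • (1 : FockOp),
        (z * (qpow η (-2) - qpow η 2)) • oscA η;
        0, (qpow η 1 - qpow η (-1) * z) • 1] : Matrix (Fin 2) (Fin 2) FockOp) ρ ρ' * x) := by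
  rw [← sum_qpow_smul_lHat'_mul_lHat, Finset.sum_mul, oscSite, oscTrace_sum hα _ fun _ _ =>
    Submodule.smul_mem _ _ (lHat_mul_mul_lHat'_mem_traceable _ _ _ _ hx)]
  simp only [smul_mul_assoc]
  rw [oscTrace_sum hα _ fun _ _ =>
    Submodule.smul_mem _ _ (lHat'_mul_lHat_mul_mem_traceable _ _ _ hx)]
  refine Finset.sum_congr rfl fun μ _ => ?_
  rw [oscTrace_smul hα _ (lHat_mul_mul_lHat'_mem_traceable _ _ _ _ hx),
    oscTrace_smul hα _ (lHat'_mul_lHat_mul_mem_traceable _ _ _ hx),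
    ← isCyclic_lHat' η z μ ρ', mul_assoc]

variable {Z : AuxOp}

/-- The one-site operation of both monodromies, on an operator that is the identity on the new
site. -/
def auxSite (η z : ℂ) (κ κ' : Fin 2) (Z : AuxOp) : AuxOp :=
  ∑ μ, qpow η (-2 * siteSpin μ) • (combine (rHat η z) (lHat η z) κ μ * Z *
    combine' (rHat' η z) (lHat' η z) μ κ')

/-- The entries of `rHat` and `rHat'` are scalars, so they can be taken out of the trace. -/
theorem oscTrace_auxSite (hα : ∀ m : ℤ, qpow η (2 * (α + m)) ≠ 1)
    (hZ : ∀ a b, Z a b ∈ traceable η α) (κ κ' a b : Fin 2) :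
    oscTrace (auxSite η z κ κ' Z a b) = ∑ d, ∑ ρ', ∑ c, ∑ ρ, rHat' η z (d, ρ') (b, κ') *
      (rHat η z (a, κ) (c, ρ) * oscTrace (oscSite η z ρ ρ' (Z c d))) := by
  have h : auxSite η z κ κ' Z a b = ∑ d, ∑ ρ', ∑ c, ∑ ρ, rHat' η z (d, ρ') (b, κ') •
      (rHat η z (a, κ) (c, ρ) • oscSite η z ρ ρ' (Z c d)) := by
    simp only [auxSite, oscSite, Matrix.sum_apply, Matrix.smul_apply, Matrix.mul_apply, combine,
      combine', Matrix.of_apply, Finset.sum_mul, Finset.mul_sum, smul_mul_assoc, mul_smul_comm,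
      Finset.smul_sum]
    rw [Finset.sum_comm]
    refine Finset.sum_congr rfl fun d _ => ?_
    rw [Finset.sum_comm]
    refine Finset.sum_congr rfl fun ρ' _ => ?_
    rw [Finset.sum_comm]
    refine Finset.sum_congr rfl fun c _ => ?_
    rw [Finset.sum_comm]
    refine Finset.sum_congr rfl fun ρ _ => Finset.sum_congr rfl fun μ _ => ?_
    simp only [smul_smul]
    congr 1
    ring
  have hm (d ρ' c ρ) := oscSite_mem_traceable (z := z) ρ ρ' (hZ c d)
  have hm1 (d ρ' c ρ) : rHat' η z (d, ρ') (b, κ') • (rHat η z (a, κ) (c, ρ) •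
      oscSite η z ρ ρ' (Z c d)) ∈ traceable η α :=
    Submodule.smul_mem _ _ (Submodule.smul_mem _ _ (hm d ρ' c ρ))
  rw [h, oscTrace_sum hα _ fun d _ => Submodule.sum_mem _ fun ρ' _ => Submodule.sum_mem _ fun c _ =>
    Submodule.sum_mem _ fun ρ _ => hm1 d ρ' c ρ]
  refine Finset.sum_congr rfl fun d _ => ?_
  rw [oscTrace_sum hα _ fun ρ' _ => Submodule.sum_mem _ fun c _ =>
    Submodule.sum_mem _ fun ρ _ => hm1 d ρ' c ρ]
  refine Finset.sum_congr rfl fun ρ' _ => ?_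
  rw [oscTrace_sum hα _ fun c _ => Submodule.sum_mem _ fun ρ _ => hm1 d ρ' c ρ]
  refine Finset.sum_congr rfl fun c _ => ?_
  rw [oscTrace_sum hα _ fun ρ _ => hm1 d ρ' c ρ]
  refine Finset.sum_congr rfl fun ρ _ => ?_
  rw [oscTrace_smul hα _ (Submodule.smul_mem _ _ (hm d ρ' c ρ)), oscTrace_smul hα _ (hm d ρ' c ρ)]

/-- The product of the denominators of the one-site operation. -/
def siteDen (η z : ℂ) : ℂ := (1 - qpow η 2 * z) * (qpow η 2 - z) * (1 - z)

/-- The blocks, with respect to the new site, of the trace that defines `𝐤`: the diagonal blocks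
reproduce the trace without that site, and the block `⟨1| |0⟩` vanishes. -/
theorem oscTrace_auxSite_one_zero (hα : ∀ m : ℤ, qpow η (2 * (α + m)) ≠ 1)
    (hZ : ∀ a b, Z a b ∈ traceable η α) :
    oscTrace (auxSite η z 0 0 Z 1 0) = siteDen η z * oscTrace (Z 1 0) ∧
    oscTrace (auxSite η z 1 1 Z 1 0) = siteDen η z * oscTrace (Z 1 0) ∧
    oscTrace (auxSite η z 1 0 Z 1 0) = 0 ∧
    oscTrace (auxSite η z 0 1 Z 1 0) = (1 - qpow η 2) * z * (1 - z) *
      ((qpow η 2 - z) * oscTrace ((uMat η * Z * uMat' η) 0 0) -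
        (1 - qpow η 2 * z) * oscTrace ((uMat η * Z * uMat' η) 1 1)) := by
  have hq := qpow_ne_zero η 1
  have h0 (a b : Fin 2) : oscTrace (oscSite η z 0 0 (Z a b)) =
      (qpow η (-1) - qpow η 1 * z) * oscTrace (Z a b) := by
    rw [oscTrace_oscSite hα (hZ a b)]
    simp [oscTrace_smul hα _ (hZ a b)]
  have h1 (a b : Fin 2) : oscTrace (oscSite η z 0 1 (Z a b)) =
      z * (qpow η (-2) - qpow η 2) * oscTrace (oscA η * Z a b) := by
    rw [oscTrace_oscSite hα (hZ a b)]
    simp [oscTrace_smul hα _ (oscA_mul_mem_traceable (hZ a b))]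
  have h2 (a b : Fin 2) : oscTrace (oscSite η z 1 0 (Z a b)) = 0 := by
    rw [oscTrace_oscSite hα (hZ a b)]
    simp [oscTrace_zero]
  have h3 (a b : Fin 2) : oscTrace (oscSite η z 1 1 (Z a b)) =
      (qpow η 1 - qpow η (-1) * z) * oscTrace (Z a b) := by
    rw [oscTrace_oscSite hα (hZ a b)]
    simp [oscTrace_smul hα _ (hZ a b)]
  have h4 : oscTrace ((uMat η * Z * uMat' η) 0 0) =
      oscTrace (Z 0 0) + oscTrace (oscA η * Z 1 0) := by
    rw [(uMat_conj_apply η Z).1, oscTrace_add hα (hZ _ _) (oscA_mul_mem_traceable (hZ _ _))]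
  have h5 : oscTrace ((uMat η * Z * uMat' η) 1 1) =
      oscTrace (Z 1 1) - oscTrace (oscA η * Z 1 0) := by
    rw [(uMat_conj_apply η Z).2.2, oscTrace_add hα (hZ _ _)
      (Submodule.smul_mem _ _ (mul_oscA_mem_traceable (hZ _ _))),
      oscTrace_smul hα _ (mul_oscA_mem_traceable (hZ _ _)), oscTrace_oscA_mul_comm]
    ring
  rw [h4, h5]
  simp only [oscTrace_auxSite hα hZ, Fin.sum_univ_two, h0, h1, h2, h3, siteDen]
  have e1 : qpow η (-1) = (qpow η 1)⁻¹ := qpow_neg η 1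
  have e2 : qpow η (-2) = (qpow η 1 ^ 2)⁻¹ := by rw [qpow_neg, qpow_two]
  simp only [rHat, rHat', sixVertex, e1, e2, qpow_two]
  norm_num
  refine ⟨?_, ?_, ?_⟩ <;> field_simp <;> ring

end OneSite

/-! ### Principal parts -/

section PrincipalPart

open Filter Topology

/-- Near `w`, the function `f` is `c((z - w)⁻¹)` plus an analytic function. So `c` is the principal
part of `f` at `w`, up to the constant coefficient, which is left undetermined. -/
def HasPrincipalPart (f : ℂ → ℂ) (w : ℂ) (c : Polynomial ℂ) : Prop :=
  ∃ g : ℂ → ℂ, AnalyticAt ℂ g w ∧ f =ᶠ[𝓝[≠] w] fun z => c.eval (z - w)⁻¹ + g z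

namespace HasPrincipalPart

variable {f f' : ℂ → ℂ} {w : ℂ} {c c' : Polynomial ℂ}

theorem congr (h : HasPrincipalPart f w c) (hf : f' =ᶠ[𝓝[≠] w] f) : HasPrincipalPart f' w c := by
  obtain ⟨g, hg, h⟩ := h
  exact ⟨g, hg, hf.trans h⟩

theorem of_analyticAt (h : AnalyticAt ℂ f w) : HasPrincipalPart f w 0 :=
  ⟨f, h, by simp⟩

theorem add (h : HasPrincipalPart f w c) (h' : HasPrincipalPart f' w c') :
    HasPrincipalPart (fun z => f z + f' z) w (c + c') := by
  obtain ⟨g, hg, h⟩ := h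
  obtain ⟨g', hg', h'⟩ := h'
  refine ⟨fun z => g z + g' z, hg.add hg', ?_⟩
  filter_upwards [h, h'] with z hz hz'
  rw [hz, hz', Polynomial.eval_add]
  ring

theorem const_mul (r : ℂ) (h : HasPrincipalPart f w c) :
    HasPrincipalPart (fun z => r * f z) w (Polynomial.C r * c) := by
  obtain ⟨g, hg, h⟩ := h
  refine ⟨fun z => r * g z, analyticAt_const.mul hg, ?_⟩
  filter_upwards [h] with z hz
  rw [hz, Polynomial.eval_mul, Polynomial.eval_C]
  ring

/-- Rescaling the variable by `r` multiplies the coefficient of index `j` by `r⁻ʲ`. -/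
theorem comp_mul {r : ℂ} (hr : r ≠ 0) (h : HasPrincipalPart f (r * w) c) :
    HasPrincipalPart (fun z => f (r * z)) w (c.comp (Polynomial.C r⁻¹ * Polynomial.X)) := by
  obtain ⟨g, hg, h⟩ := h
  refine ⟨fun z => g (r * z), hg.comp_of_eq (by fun_prop) rfl, ?_⟩
  have ht : Tendsto (fun z => r * z) (𝓝[≠] w) (𝓝[≠] (r * w)) := by
    refine tendsto_nhdsWithin_of_tendsto_nhds_of_eventually_within _ ?_ ?_
    · exact ((continuous_const_mul r).tendsto w).mono_left nhdsWithin_le_nhds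
    · filter_upwards [self_mem_nhdsWithin] with z hz
      simpa [hr] using hz
  filter_upwards [ht.eventually h] with z hz
  rw [hz]
  rw [← mul_sub, mul_inv]
  simp

/-- A quotient of an analytic function by `(z - w) ^ n` has a principal part of degree at most
`n`. -/
theorem exists_of_pow_mul {n : ℕ} {h : ℂ → ℂ} (hh : AnalyticAt ℂ h w)
    (hf : ∀ᶠ z in 𝓝[≠] w, f z = ((z - w)⁻¹) ^ n * h z) :
    ∃ c : Polynomial ℂ, (∀ j, n < j → c.coeff j = 0) ∧ HasPrincipalPart f w c := by
  induction n generalizing f h with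
  | zero => exact ⟨0, by simp, h, hh, hf.mono fun z hz => by simpa using hz⟩
  | succ n ih =>
    -- Split off the leading term `h w / (z - w) ^ (n + 1)`.
    have hd : AnalyticAt ℂ (dslope h w) w := by
      obtain ⟨s, hs, hs'⟩ := hh.eventually_analyticAt.exists_mem
      have : DifferentiableOn ℂ h s := fun z hz =>
        (hs' z hz).differentiableAt.differentiableWithinAt
      exact ((Complex.differentiableOn_dslope hs).2 this).analyticAt hs
    obtain ⟨c, hc, hc'⟩ := ih (f := fun z => (z - w)⁻¹ ^ n * dslope h w z) hd (by simp)
    refine ⟨Polynomial.C (h w) * Polynomial.X ^ (n + 1) + c, ?_, ?_⟩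
    · intro j hj
      rw [Polynomial.coeff_add, Polynomial.coeff_C_mul, Polynomial.coeff_X_pow, if_neg hj.ne',
        hc j (by omega)]
      simp
    · have h1 : HasPrincipalPart (fun z => h w * (z - w)⁻¹ ^ (n + 1)) w
          (Polynomial.C (h w) * Polynomial.X ^ (n + 1)) :=
        ⟨0, analyticAt_const, by simp⟩
      refine (h1.add hc').congr ?_
      filter_upwards [hf, self_mem_nhdsWithin] with z hz hzw
      have hzw : z - w ≠ 0 := sub_ne_zero.2 hzw
      rw [hz, dslope_of_ne _ (sub_ne_zero.1 hzw), slope_def_field, pow_succ]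
      field_simp
      ring

/-- The Laurent coefficients of negative index are the coefficients of the principal part. -/
theorem laurentCoeff_eq (h : HasPrincipalPart f w c) {j : ℕ} (hj : 1 ≤ j) :
    laurentCoeff f w (-(j : ℤ)) = c.coeff j := by
  obtain ⟨g, hg, h⟩ := h
  refine Tendsto.limUnder_eq (tendsto_const_nhds.congr' ?_)
  obtain ⟨k, rfl⟩ : ∃ k, j = k + 1 := ⟨j - 1, by omega⟩
  obtain ⟨ε, hε, hball⟩ := Metric.eventually_nhds_iff_ball.1
    ((eventually_nhdsWithin_iff.1 h).and hg.eventually_analyticAt)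
  filter_upwards [Ioo_mem_nhdsGT hε] with r hr
  have hsub : Metric.closedBall w r ⊆ Metric.ball w ε := Metric.closedBall_subset_ball hr.2
  have hsph : ∀ z ∈ Metric.sphere w r, z - w ≠ 0 := by
    intro z hz h0
    have hz' : ‖z - w‖ = r := by simpa [dist_eq_norm] using hz
    rw [h0, norm_zero] at hz'
    exact hr.1.ne hz'
  have hcong : Set.EqOn (fun z => (z - w) ^ (-(-((k + 1 : ℕ) : ℤ)) - 1) * f z)
      (fun z => (∑ i ∈ c.support, c.coeff i * (z - w) ^ ((k : ℤ) - i)) + (z - w) ^ k * g z)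
      (Metric.sphere w r) := by
    intro z hz
    have h0 := hsph z hz
    have hfz := (hball z (hsub (Metric.sphere_subset_closedBall hz))).1 (sub_ne_zero.1 h0)
    have he : (-(-((k + 1 : ℕ) : ℤ)) - 1) = (k : ℤ) := by push_cast; ring
    simp only [he, hfz, zpow_natCast, mul_add, Polynomial.eval_eq_sum, Polynomial.sum_def,
      Finset.mul_sum]
    congr 1
    refine Finset.sum_congr rfl fun i _ => ?_
    rw [zpow_sub₀ h0, zpow_natCast, zpow_natCast, inv_pow]
    field_simp
  -- Only the power `(z - w)⁻¹` of the principal part contributes to the integral.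
  have hint : ∀ i ∈ c.support,
      CircleIntegrable (fun z => c.coeff i * (z - w) ^ ((k : ℤ) - i)) w r := by
    intro i _
    refine ContinuousOn.circleIntegrable hr.1.le fun z hz => ?_
    have hcont : ContinuousAt (fun z => z - w) z := by fun_prop
    exact ((hcont.zpow₀ _ (Or.inl (hsph z hz))).const_mul (c.coeff i)).continuousWithinAt
  have hga : ∀ z ∈ Metric.closedBall w r, DifferentiableAt ℂ (fun z => (z - w) ^ k * g z) z := by
    intro z hz
    exact ((differentiableAt_id.sub_const w).pow k).mul (hball z (hsub hz)).2.differentiableAt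
  have hgint : CircleIntegrable (fun z => (z - w) ^ k * g z) w r :=
    ContinuousOn.circleIntegrable hr.1.le fun z hz =>
      (hga z (Metric.sphere_subset_closedBall hz)).continuousAt.continuousWithinAt
  have hg0 : (∮ z in C(w, r), (z - w) ^ k * g z) = 0 :=
    Complex.circleIntegral_eq_zero_of_differentiable_on_off_countable hr.1.le
      Set.countable_empty (fun z hz => (hga z hz).continuousAt.continuousWithinAt)
      (fun z hz => hga z (Metric.ball_subset_closedBall hz.1))
  have hmono : ∀ i ∈ c.support, (∮ z in C(w, r), c.coeff i * (z - w) ^ ((k : ℤ) - i)) =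
      if i = k + 1 then c.coeff i * (2 * Real.pi * Complex.I) else 0 := by
    intro i _
    rw [circleIntegral.integral_const_mul]
    split_ifs with hi
    · have : ((k : ℤ) - i) = -1 := by subst hi; push_cast; ring
      simp only [this, zpow_neg_one]
      rw [circleIntegral.integral_sub_center_inv w hr.1.ne']
    · rw [circleIntegral.integral_sub_zpow_of_ne (by omega), mul_zero]
  rw [circleIntegral.integral_congr hr.1.le hcong,
    circleIntegral.integral_add (CircleIntegrable.fun_sum _ hint) hgint, hg0, add_zero,
    circleIntegral.integral_fun_sum hint, Finset.sum_congr rfl hmono, Finset.sum_ite_eq']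
  have hpi : (2 * Real.pi * Complex.I : ℂ) ≠ 0 := Complex.two_pi_I_ne_zero
  split_ifs with hc
  · rw [mul_comm (c.coeff _), inv_mul_cancel_left₀ hpi]
  · rw [Polynomial.notMem_support_iff.1 hc, mul_zero]

end HasPrincipalPart

end PrincipalPart

/-! ### Polynomial form of `𝐤` -/

/-- The exponent `n - s`, where `s` is the spin of the matrix unit `|σ⟩⟨τ|`. -/
def spinExp {n : ℕ} (σ τ : Cfg n) : ℕ :=
  ∑ i, ((if σ i = 0 then 0 else 1) + (if τ i = 0 then 1 else 0))

theorem spinExp_cast {n : ℕ} (σ τ : Cfg n) : (spinExp σ τ : ℂ) = n - (spinZ σ - spinZ τ) := by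
  have hn : (n : ℂ) = ∑ _i : Fin n, (1 : ℂ) := by simp
  rw [spinExp, spinZ, spinZ, hn, ← Finset.sum_sub_distrib, ← Finset.sum_sub_distrib, Nat.cast_sum]
  refine Finset.sum_congr rfl fun i _ => ?_
  split_ifs <;> norm_num

/-- The operator `z^{n - 𝕊}`, which depends polynomially on `z`. -/
def spinPow {n : ℕ} (z : ℂ) (X : SegOp n) : SegOp n := fun σ τ => z ^ spinExp σ τ * X σ τ

section SpinPow

variable {n : ℕ} (z : ℂ) (X Y : SegOp n)

theorem spinPow_add : spinPow z (X + Y) = spinPow z X + spinPow z Y := by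
  ext; simp [spinPow, mul_add]

theorem spinPow_smul (r : ℂ) : spinPow z (r • X) = r • spinPow z X := by
  ext; simp [spinPow, mul_left_comm]

theorem spinPow_mulQSpin (η : ℂ) : spinPow z (mulQSpin η X) = mulQSpin η (spinPow z X) := by
  ext; simp [mulQSpin, spinPow, mul_left_comm]

theorem spinPow_spinFun (f : ℂ → ℂ) : spinPow z (spinFun f X) = spinFun f (spinPow z X) := by
  ext; simp [spinFun, spinPow, mul_left_comm]

theorem spinPow_tensorId_one : spinPow z (tensorId 1 X) = z • tensorId 1 (spinPow z X) := by
  ext σ τ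
  obtain ⟨σ, κ, rfl⟩ := exists_snocCfg σ
  obtain ⟨τ, κ', rfl⟩ := exists_snocCfg τ
  simp only [spinPow, tensorId_one_snocCfg, Matrix.smul_apply, smul_eq_mul]
  split_ifs with h
  · have h1 : spinExp (snocCfg σ κ) (snocCfg τ κ') = spinExp σ τ + 1 := by
      subst h
      by_cases hκ : κ = 0 <;> simp [spinExp, Fin.sum_univ_castSucc, hκ]
    rw [h1, pow_succ]
    ring
  · simp

theorem spinPow_qpow_mul (η c : ℂ) :
    spinPow (qpow η c * z) X =
      qpow η (c * n) • spinFun (fun s => qpow η (-c * s)) (spinPow z X) := by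
  ext σ τ
  simp only [spinPow, spinFun, Matrix.smul_apply, smul_eq_mul, mul_pow, ← qpow_natCast_mul,
    spinExp_cast, ← mul_assoc, ← qpow_add]
  congr 3
  ring

end SpinPow

/-- The adjoint action of both monodromies on `X`, with denominators cleared, as a function of
`z = ζ²`. -/
def auxTransport (η α z : ℂ) (n : ℕ) (X : SegOp n) (σ τ : Cfg n) : AuxOp :=
  transport (combine (rHat η z) (lHat η z)) (combine' (rHat' η z) (lHat' η z)) (twist η α) n X σ τ

/-- The adjoint action of the oscillator monodromy on `X`, with denominators cleared, as a function
of `z = ζ²`. -/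
def oscTransport (η α z : ℂ) (n : ℕ) (X : SegOp n) (σ τ : Cfg n) : FockOp :=
  transport (lHat η z) (lHat' η z) (oscQ η (2 * α)) n X σ τ

section Families

variable {η α : ℂ} {n : ℕ}

theorem twist_mem_traceable (a b : Fin 2) : twist η α a b ∈ traceable η α := by
  rw [twist, Matrix.diagonal_apply]
  split_ifs
  · exact Submodule.smul_mem _ _ oscQ_mem_traceable
  · exact Submodule.smul_mem _ _ oscQ_mem_traceable
  · exact Submodule.zero_mem _

theorem auxTransport_mem_polyFamily (X : ℂ → SegOp n)
    (hX : ∀ σ τ, ∃ p : Polynomial ℂ, ∀ z, X z σ τ = p.eval z) (σ τ : Cfg n) (a b : Fin 2) :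
    (fun z => auxTransport η α z n (X z) σ τ a b) ∈ polyFamily η α := by
  let P : Submodule ℂ (ℂ → AuxOp) :=
    { carrier := {F | ∀ a b, (fun z => F z a b) ∈ polyFamily η α}
      add_mem' := fun hF hG a b => Submodule.add_mem _ (hF a b) (hG a b)
      zero_mem' := fun a b => Submodule.zero_mem _
      smul_mem' := fun r F hF a b => Submodule.smul_mem _ r (hF a b) }
  exact transport_mem P (fun z => combine (rHat η z) (lHat η z))
    (fun z => combine' (rHat' η z) (lHat' η z)) (twist η α)
    (fun _ hF a b => self_smul_mem_polyFamily (hF a b))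
    (fun a b => const_mem_polyFamily (twist_mem_traceable a b))
    (fun _ hF κ μ ν κ' a b => combine_mul_mul_combine'_mem hF κ μ ν κ' a b) X hX σ τ a b

theorem oscTransport_mem_polyFamily (X : ℂ → SegOp n)
    (hX : ∀ σ τ, ∃ p : Polynomial ℂ, ∀ z, X z σ τ = p.eval z) (σ τ : Cfg n) :
    (fun z => oscTransport η α z n (X z) σ τ) ∈ polyFamily η α :=
  transport_mem (polyFamily η α) (lHat η) (lHat' η) _ (fun _ hF => self_smul_mem_polyFamily hF)
    (const_mem_polyFamily oscQ_mem_traceable)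
    (fun _ hF κ μ ν κ' => lHat_mul_mul_lHat'_mem hF κ μ ν κ') X hX σ τ

theorem auxTransport_mem_traceable (z : ℂ) (X : SegOp n) (σ τ : Cfg n) (a b : Fin 2) :
    auxTransport η α z n X σ τ a b ∈ traceable η α :=
  apply_mem_traceable (auxTransport_mem_polyFamily (fun _ => X)
    (fun σ τ => ⟨Polynomial.C (X σ τ), by simp⟩) σ τ a b) z

theorem oscTransport_mem_traceable (z : ℂ) (X : SegOp n) (σ τ : Cfg n) :
    oscTransport η α z n X σ τ ∈ traceable η α :=
  apply_mem_traceable (oscTransport_mem_polyFamily (fun _ => X)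
    (fun σ τ => ⟨Polynomial.C (X σ τ), by simp⟩) σ τ) z

theorem exists_spinPow_eq_eval (X : SegOp n) (σ τ : Cfg n) :
    ∃ p : Polynomial ℂ, ∀ z, spinPow z X σ τ = p.eval z :=
  ⟨Polynomial.X ^ spinExp σ τ * Polynomial.C (X σ τ), fun z => by
    rw [Polynomial.eval_mul, Polynomial.eval_pow, Polynomial.eval_X, Polynomial.eval_C, spinPow]⟩

end Families

/-- The points `z = ζ²` at which all `L`-operators exist and are invertible. -/
def IsRegularPt (η z : ℂ) : Prop :=
  z ≠ 0 ∧ z ≠ 1 ∧ 1 - qpow η 2 * z ≠ 0 ∧ qpow η 2 - z ≠ 0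

/-- The trace `tr_A` of the entry `⟨1| |0⟩` of the adjoint action, with denominators cleared. -/
def kNum (η α z : ℂ) (n : ℕ) (X : SegOp n) : SegOp n :=
  fun σ τ => oscTrace (auxTransport η α z n X σ τ 1 0)

/-- The trace `tr_A` of the adjoint action of the oscillator monodromy, with denominators
cleared. -/
def oscNum (η α z : ℂ) (n : ℕ) (X : SegOp n) : SegOp n :=
  fun σ τ => oscTrace (oscTransport η α z n X σ τ)

section Num

variable {η α : ℂ} {n : ℕ} (z : ℂ) (X Y : SegOp n)

theorem kNum_add (hα : ∀ m : ℤ, qpow η (2 * (α + m)) ≠ 1) :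
    kNum η α z n (X + Y) = kNum η α z n X + kNum η α z n Y := by
  ext σ τ
  have h : auxTransport η α z n (X + Y) σ τ 1 0 =
      auxTransport η α z n X σ τ 1 0 + auxTransport η α z n Y σ τ 1 0 := by
    rw [auxTransport, transport_add]; rfl
  rw [kNum, h, oscTrace_add hα (auxTransport_mem_traceable _ _ _ _ _ _)
    (auxTransport_mem_traceable _ _ _ _ _ _)]
  rfl

theorem kNum_smul (hα : ∀ m : ℤ, qpow η (2 * (α + m)) ≠ 1) (r : ℂ) :
    kNum η α z n (r • X) = r • kNum η α z n X := by
  ext σ τ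
  have h : auxTransport η α z n (r • X) σ τ 1 0 = r • auxTransport η α z n X σ τ 1 0 := by
    rw [auxTransport, transport_smul]; rfl
  rw [kNum, h, oscTrace_smul hα _ (auxTransport_mem_traceable _ _ _ _ _ _)]
  rfl

theorem oscNum_smul (hα : ∀ m : ℤ, qpow η (2 * (α + m)) ≠ 1) (r : ℂ) :
    oscNum η α z n (r • X) = r • oscNum η α z n X := by
  ext σ τ
  have h : oscTransport η α z n (r • X) σ τ = r • oscTransport η α z n X σ τ :=
    transport_smul _ _ _ _ _ _ _
  rw [oscNum, h, oscTrace_smul hα _ (oscTransport_mem_traceable _ _ _ _)]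
  rfl

end Num

theorem sigmaPlus_mul_apply {n : ℕ} (Y : FullOp n) (a b : Fin 2) (σ τ : Cfg n) :
    (sigmaPlus n * Y) (a, σ) (b, τ) = if a = 0 then Y (1, σ) (b, τ) else 0 := by
  have h (x : Fin 2 × Cfg n) : sigmaPlus n (a, σ) x = if x = (1, σ) ∧ a = 0 then 1 else 0 := by
    simp only [sigmaPlus, Prod.ext_iff]
    congr 1
    simp only [eq_iff_iff]
    tauto
  simp only [Matrix.mul_apply, h]
  split_ifs with h0 <;> simp [h0]

theorem oscTrace_smul_conj {u v : FockOp} (hu : IsCyclic u) (hvu : v * u = 1) (r : ℂ)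
    (x : FockOp) : oscTrace (r • (u * x * v)) = oscTrace (r • x) := by
  have h : r • (u * x * v) = u * (r • x * v) := by
    rw [smul_mul_assoc, mul_smul_comm, mul_assoc]
  rw [h, hu, mul_assoc, hvu, mul_one]

/-- All that `𝐤` depends on besides `z = ζ²` is a scalar factor `ζ⁻¹`, which comes from the gauge
transformation, and the operator `ζ^{α - 𝕊}`. The conjugation by `ζ^D` drops out of the
trace. -/
theorem kOp_eq {η α ζ : ℂ} (hα : ∀ m : ℤ, qpow η (2 * (α + m)) ≠ 1) (hζ : ζ ≠ 0)
    (hz : IsRegularPt η (ζ ^ 2)) {n : ℕ} (X : SegOp n) :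
    kOp η α n ζ X = ((siteDen η (ζ ^ 2))⁻¹ ^ n * ζ⁻¹) •
      kNum η α (ζ ^ 2) n (mulQSpin η (spinFun (fun s => ζ ^ (α - s)) X)) := by
  obtain ⟨-, h1, h2, h3⟩ := hz
  ext σ τ
  rw [mulQSpin_spinFun]
  set Y := spinFun (fun s => ζ ^ (α - s)) (mulQSpin η X)
  have hR := Rmat_mul_inv h2 h3
  have hR' := Rmat_inv_mul h2 h3
  have hL := oscMat_mul_inv (η := η) hζ h1
  have hL' := oscMat_inv_mul (η := η) hζ h1
  have hent := congrFun (congrFun (entry_conjSites_conjSites η α (Rmat η ζ) (RmatInv η ζ)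
    (oscMat η ζ) (oscMatInv η ζ) Y σ τ) 1) 0
  have hk : kOp η α n ζ X σ τ = oscTrace (transport (combine (Rmat η ζ) (oscMat η ζ))
      (combine' (RmatInv η ζ) (oscMatInv η ζ)) (twist η α) n Y σ τ 1 0) := by
    rw [← hent, kOp, traceAux, Laux_eq, Losc_eq,
      adjointMonodromy_siteOp (ℓ' := ofAux (RmatInv η ζ)) (by rw [ofAux_mul, hR, ofAux_one])
        (by rw [ofAux_mul, hR', ofAux_one]),
      adjointMonodromy_siteOp (ℓ' := ofOsc (oscMatInv η ζ)) (by rw [ofOsc_mul, hL, ofOsc_one])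
        (by rw [ofOsc_mul, hL', ofOsc_one])]
    simp only [sigmaPlus_mul_apply, Fin.sum_univ_two, if_true, one_ne_zero, if_false, oscTrace_zero,
      add_zero]
    rfl
  have hc : combine (Rmat η ζ) (oscMat η ζ) = fun κ μ => (1 - qpow η 2 * ζ ^ 2)⁻¹ •
      (gauge ζ * combine (rHat η (ζ ^ 2)) (lHat η (ζ ^ 2)) κ μ * gauge ζ⁻¹) := by
    funext κ μ
    exact combine_eq_gauge hζ h2 κ μ
  have hc' : combine' (RmatInv η ζ) (oscMatInv η ζ) = fun κ μ =>
      ((qpow η 2 - ζ ^ 2)⁻¹ * (1 - ζ ^ 2)⁻¹) •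
      (gauge ζ * combine' (rHat' η (ζ ^ 2)) (lHat' η (ζ ^ 2)) κ μ * gauge ζ⁻¹) := by
    funext κ μ
    exact combine'_eq_gauge hζ h3 κ μ
  have ht : twist η α = (1 : ℂ) • (gauge ζ * twist η α * gauge ζ⁻¹) := by
    rw [one_smul, ← twist_eq_gauge hζ]
  have hm := auxTransport_mem_traceable (η := η) (α := α) (ζ ^ 2) Y σ τ 1 0
  rw [hk, hc, hc', ht, transport_smul_smul, transport_conj _ _ _ (gauge_inv_mul hζ),
    Matrix.smul_apply, gauge_conj_apply, smul_smul, Matrix.smul_apply, kNum, ← auxTransport,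
    oscTrace_smul_conj (u := fockPow ζ) (isCyclic_fockDiag _) (fockPow_inv_mul hζ),
    oscTrace_smul hα _ hm,
    smul_eq_mul, siteDen]
  simp only [one_ne_zero, if_false, if_true, mul_one, mul_inv]
  ring

/-- `𝐤_skal` is a rational function of `z`: the power `ζ^{α - s}` inside `𝐤`, the normalisation
`ζ^{-α - s - 1}` and the factor `ζ⁻¹` in `kOp_eq` combine to `z^{-s - 1}`, and `spinPow z` is
`z^{n - s}`. -/
theorem kSkal_eq {η α z : ℂ} (hα : ∀ m : ℤ, qpow η (2 * (α + m)) ≠ 1) (hz : IsRegularPt η z)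
    {n : ℕ} (X : SegOp n) :
    kSkal η α n z X = ((siteDen η z)⁻¹ ^ n * (z ^ (n + 1))⁻¹) •
      kNum η α z n (mulQSpin η (spinPow z X)) := by
  -- Only `ζ ^ 2 = z` matters about the chosen square root.
  obtain ⟨ζ, hζ⟩ : ∃ ζ, ζ = z ^ (1 / 2 : ℂ) := ⟨_, rfl⟩
  have hζz : ζ ^ 2 = z := by
    rw [hζ, ← Complex.cpow_nat_mul]
    norm_num
  have hζ0 : ζ ≠ 0 := by
    rintro rfl
    exact hz.1 (by rw [← hζz]; norm_num)
  have hX : spinFun (fun s => ζ ^ (α - s)) (spinFun (fun s => ζ ^ (-α - s - 1)) X) =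
      (ζ * (z ^ (n + 1))⁻¹) • spinPow z X := by
    ext σ τ
    have hs : spinZ σ - spinZ τ = n - spinExp σ τ := by
      rw [spinExp_cast]
      ring
    have he : α - (spinZ σ - spinZ τ) + (-α - (spinZ σ - spinZ τ) - 1) =
        ((2 * (spinExp σ τ : ℤ) - (2 * (n + 1 : ℕ) : ℤ) + 1 : ℤ) : ℂ) := by
      rw [hs]
      push_cast
      ring
    rw [spinFun_spinFun, spinFun, ← Complex.cpow_add _ _ hζ0, he, Complex.cpow_intCast,
      zpow_add₀ hζ0, zpow_sub₀ hζ0, zpow_mul, zpow_mul, Matrix.smul_apply, spinPow, smul_eq_mul,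
      zpow_ofNat, hζz, zpow_natCast, zpow_natCast, zpow_one]
    ring
  rw [kSkal, ← hζ, kOp_eq hα hζ0 (by rwa [hζz]), hX, mulQSpin_smul, kNum_smul _ _ hα, smul_smul,
    hζz]
  congr 1
  field_simp

/-! ### Reduction of the last site -/

theorem auxTransport_tensorId_one (η α z : ℂ) {n : ℕ} (X : SegOp n) (σ τ : Cfg n)
    (κ κ' : Fin 2) :
    auxTransport η α z (n + 1) (mulQSpin η (tensorId 1 X)) (snocCfg σ κ) (snocCfg τ κ') =
      auxSite η z κ κ' (auxTransport η α z n (mulQSpin η X) σ τ) :=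
  transport_mulQSpin_tensorId _ _ _ _ _ _ _ _ _

/-- The twist commutes with `U`, because `𝐚 q^{2αD} = q^{2α} q^{2αD} 𝐚`. -/
theorem uMat_conj_twist (η α : ℂ) :
    (uMat η * twist η α * uMat' η) 0 1 = 0 ∧
    (uMat η * twist η α * uMat' η) 0 0 = qpow η α • oscQ η (2 * α) ∧
    (uMat η * twist η α * uMat' η) 1 1 = qpow η (-α) • oscQ η (2 * α) := by
  have h00 : twist η α 0 0 = qpow η α • oscQ η (2 * α) := by simp [twist]
  have h11 : twist η α 1 1 = qpow η (-α) • oscQ η (2 * α) := by simp [twist]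
  have h01 : twist η α 0 1 = 0 := by simp [twist]
  have h10 : twist η α 1 0 = 0 := by simp [twist]
  rw [(uMat_conj_apply η _).1, (uMat_conj_apply η _).2.1, (uMat_conj_apply η _).2.2, h00, h01, h10,
    h11]
  refine ⟨?_, by simp, by simp⟩
  have hq := qpow_ne_zero η α
  have h2 : qpow η (2 * α) = qpow η α ^ 2 := by
    rw [← qpow_natCast_mul]; congr 1; push_cast; ring
  simp only [mul_zero, add_zero, zero_add, mul_smul_comm, smul_mul_assoc, oscA_mul_oscQ, h2,
    qpow_neg]
  match_scalars
  field_simp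
  ring

theorem qpow_ite_spin_neg (η : ℂ) (μ : Fin 2) :
    (if μ = 0 then 1 else qpow η 1) = qpow η (1 / 2) * qpow η (-1 * siteSpin μ) := by
  rw [← qpow_add, siteSpin]
  split_ifs
  · norm_num [qpow_zero]
  · norm_num

theorem qpow_ite_spin (η : ℂ) (μ : Fin 2) :
    (if μ = 0 then qpow η 1 else 1) = qpow η (1 / 2) * qpow η (1 * siteSpin μ) := by
  rw [← qpow_add, siteSpin]
  split_ifs
  · norm_num
  · norm_num [qpow_zero]

theorem qpow_ite_spin_neg' (η : ℂ) (μ : Fin 2) :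
    (if μ = 0 then 1 else qpow η (-1)) = qpow η (-(1 / 2)) * qpow η (-(-1 * siteSpin μ)) := by
  rw [← qpow_add, siteSpin]
  split_ifs
  · norm_num [qpow_zero]
  · norm_num

theorem qpow_ite_spin' (η : ℂ) (μ : Fin 2) :
    (if μ = 0 then qpow η (-1) else 1) = qpow η (-(1 / 2)) * qpow η (-(1 * siteSpin μ)) := by
  rw [← qpow_add, siteSpin]
  split_ifs
  · norm_num
  · norm_num [qpow_zero]

section Triangular

variable {η α z : ℂ} {n : ℕ} (X : SegOp n) (σ τ : Cfg n)

/-- Transport by site matrices that differ from `lHat`, `lHat'` by scalars, diagonal factors in the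
quantum space and a conjugation by `q^{cD}`. -/
theorem oscTrace_transport_conj (hα : ∀ m : ℤ, qpow η (2 * (α + m)) ≠ 1) (r r' t c e : ℂ) :
    oscTrace (transport
      (fun κ μ => (r * (qpow η (1 / 2) * qpow η (e * siteSpin μ))) •
        (oscQ η c * lHat η z κ μ * oscQ η (-c)))
      (fun ν κ => (r' * (qpow η (-(1 / 2)) * qpow η (-(e * siteSpin ν)))) •
        (oscQ η c * lHat' η z ν κ * oscQ η (-c))) (t • oscQ η (2 * α)) n X σ τ) =
      ((r * r') ^ n * t) * oscNum η α z n (spinFun (fun s => qpow η (e * s)) X) σ τ := by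
  have hc : oscQ η (-c) * oscQ η c = 1 := by rw [oscQ_mul_oscQ, neg_add_cancel, oscQ_zero]
  have hℓ : (fun κ μ => (r * (qpow η (1 / 2) * qpow η (e * siteSpin μ))) •
        (oscQ η c * lHat η z κ μ * oscQ η (-c))) = fun κ μ => (r * qpow η (1 / 2)) •
        (oscQ η c * (qpow η (e * siteSpin μ) • lHat η z κ μ) * oscQ η (-c)) := by
    funext κ μ
    rw [mul_smul_comm, smul_mul_assoc, smul_smul, mul_assoc r]
  have hℓ' : (fun ν κ => (r' * (qpow η (-(1 / 2)) * qpow η (-(e * siteSpin ν)))) •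
        (oscQ η c * lHat' η z ν κ * oscQ η (-c))) = fun ν κ => (r' * qpow η (-(1 / 2))) •
        (oscQ η c * (qpow η (-(e * siteSpin ν)) • lHat' η z ν κ) * oscQ η (-c)) := by
    funext ν κ
    rw [mul_smul_comm, smul_mul_assoc, smul_smul, mul_assoc r']
  have ht : oscQ η (2 * α) = oscQ η c * oscQ η (2 * α) * oscQ η (-c) := by
    rw [oscQ_mul_oscQ, oscQ_mul_oscQ]
    congr 1
    ring
  rw [hℓ, hℓ', transport_smul_smul]
  nth_rw 1 [ht]
  rw [transport_conj _ _ _ hc, transport_qpow_siteSpin, ← oscTransport,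
    oscTrace_smul_conj (u := oscQ η c) (isCyclic_fockDiag _) hc,
    oscTrace_smul hα _ (oscTransport_mem_traceable _ _ _ _), oscNum]
  congr 3
  rw [qpow_neg]
  have := qpow_ne_zero η (1 / 2)
  field_simp

/-- After conjugation by `U` both monodromies together become lower triangular, and the traces of
the diagonal entries are those of the oscillator monodromy alone, at `q² z` and at `q⁻² z`. -/
theorem oscTrace_uMat_conj (hα : ∀ m : ℤ, qpow η (2 * (α + m)) ≠ 1) :
    oscTrace ((uMat η * auxTransport η α z n X σ τ * uMat' η) 0 0) =
      (((1 - z) * (qpow η 2 - z)) ^ n * qpow η α) *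
        oscNum η α (qpow η 2 * z) n (spinFun (fun s => qpow η (-1 * s)) X) σ τ ∧
    oscTrace ((uMat η * auxTransport η α z n X σ τ * uMat' η) 1 1) =
      (((1 - qpow η 2 * z) * ((1 - z) * qpow η 2)) ^ n * qpow η (-α)) *
        oscNum η α (qpow η (-2) * z) n (spinFun (fun s => qpow η (1 * s)) X) σ τ := by
  have htri := (transport_lowerTriangular
    (fun κ μ => uMat η * combine (rHat η z) (lHat η z) κ μ * uMat' η)
    (fun ν κ => uMat η * combine' (rHat' η z) (lHat' η z) ν κ * uMat' η)
    (uMat η * twist η α * uMat' η) (fun κ μ => (uMat_conj_combine η z κ μ).1)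
    (fun κ μ => (uMat_conj_combine' η z κ μ).1) (uMat_conj_twist η α).1 X σ τ).2
  rw [transport_conj _ _ _ (uMat'_mul_uMat η)] at htri
  rw [auxTransport, htri, htri]
  constructor
  · rw [← oscTrace_transport_conj X σ τ hα _ _ _ 1, (uMat_conj_twist η α).2.1]
    simp only [(uMat_conj_combine η z _ _).2.1, (uMat_conj_combine' η z _ _).2.1,
      qpow_ite_spin_neg, qpow_ite_spin_neg']
  · rw [← oscTrace_transport_conj X σ τ hα _ _ _ (-1), (uMat_conj_twist η α).2.2, neg_neg]
    simp only [(uMat_conj_combine η z _ _).2.2, (uMat_conj_combine' η z _ _).2.2,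
      qpow_ite_spin, qpow_ite_spin']

end Triangular

/-- The function `H` such that the block `⟨0| |1⟩` of `𝐤_skal (X ⊗ id)` with respect to the new site
is the difference of a multiple of `H` at `q² z` and a multiple of `H` at `q⁻² z`. Its only
singularities are at `0` and `1`. -/
def oscH (η α : ℂ) (n : ℕ) (z : ℂ) (X : SegOp n) : SegOp n :=
  (((1 - z) ^ (n + 1))⁻¹ * (z ^ n)⁻¹) • oscNum η α z n (mulQSpin η (spinPow z X))

theorem oscH_smul {η α : ℂ} (hα : ∀ m : ℤ, qpow η (2 * (α + m)) ≠ 1) {n : ℕ} (z r : ℂ)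
    (X : SegOp n) : oscH η α n z (r • X) = r • oscH η α n z X := by
  rw [oscH, spinPow_smul, mulQSpin_smul, oscNum_smul _ _ hα, smul_comm, oscH]

theorem oscH_qpow_mul {η α : ℂ} (hα : ∀ m : ℤ, qpow η (2 * (α + m)) ≠ 1) {n : ℕ} (z c : ℂ)
    (X : SegOp n) : oscH η α n (qpow η c * z) X =
      (((1 - qpow η c * z) ^ (n + 1))⁻¹ * (z ^ n)⁻¹) • oscNum η α (qpow η c * z) n
        (spinFun (fun s => qpow η (-c * s)) (mulQSpin η (spinPow z X))) := by
  rw [oscH, spinPow_qpow_mul, mulQSpin_smul, oscNum_smul _ _ hα, smul_smul, mulQSpin_spinFun,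
    mul_pow, ← qpow_natCast_mul]
  congr 1
  have := qpow_ne_zero η (c * n)
  field_simp

/-- The blocks of `𝐤_skal (X ⊗ id)` with respect to the last site. -/
theorem kSkal_tensorId_one {η α z : ℂ} (hα : ∀ m : ℤ, qpow η (2 * (α + m)) ≠ 1)
    (hz : IsRegularPt η z) {n : ℕ} (X : SegOp n) (σ τ : Cfg n) :
    (∀ κ, kSkal η α (n + 1) z (tensorId 1 X) (snocCfg σ κ) (snocCfg τ κ) = kSkal η α n z X σ τ) ∧
    kSkal η α (n + 1) z (tensorId 1 X) (snocCfg σ 1) (snocCfg τ 0) = 0 ∧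
    kSkal η α (n + 1) z (tensorId 1 X) (snocCfg σ 0) (snocCfg τ 1) =
      (1 - qpow η 2) *
        (qpow η α * oscH η α n (qpow η 2 * z) (spinFun (fun s => qpow η s) X) σ τ -
        qpow η (-2 - α) * oscH η α n (qpow η (-2) * z) (spinFun (fun s => qpow η (-s)) X) σ τ) := by
  have hk (κ κ' : Fin 2) : kSkal η α (n + 1) z (tensorId 1 X) (snocCfg σ κ) (snocCfg τ κ') =
      ((siteDen η z)⁻¹ ^ (n + 1) * (z ^ (n + 1))⁻¹) *
        oscTrace (auxSite η z κ κ' (auxTransport η α z n (mulQSpin η (spinPow z X)) σ τ) 1 0) := by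
    rw [kSkal_eq hα hz, spinPow_tensorId_one, mulQSpin_smul, kNum_smul _ _ hα, smul_smul,
      Matrix.smul_apply, kNum, auxTransport_tensorId_one, smul_eq_mul, pow_succ z (n + 1)]
    have := hz.1
    congr 1
    field_simp
  have htr := oscTrace_auxSite_one_zero (z := z) hα fun a b =>
    auxTransport_mem_traceable z (mulQSpin η (spinPow z X)) σ τ a b
  obtain ⟨h0, h1, h2, h3⟩ := hz
  have h1 : 1 - z ≠ 0 := sub_ne_zero.2 h1.symm
  have hd : siteDen η z ≠ 0 := mul_ne_zero (mul_ne_zero h2 h3) h1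
  have hdiag : (siteDen η z)⁻¹ ^ (n + 1) * (z ^ (n + 1))⁻¹ * (siteDen η z *
      oscTrace (auxTransport η α z n (mulQSpin η (spinPow z X)) σ τ 1 0)) =
      kSkal η α n z X σ τ := by
    rw [kSkal_eq hα ⟨h0, (sub_ne_zero.1 h1).symm, h2, h3⟩, Matrix.smul_apply, smul_eq_mul, kNum,
      pow_succ]
    field_simp
  refine ⟨fun κ => ?_, ?_, ?_⟩
  · fin_cases κ
    · exact (hk 0 0).trans (by rw [htr.1, hdiag])
    · exact (hk 1 1).trans (by rw [htr.2.1, hdiag])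
  · rw [hk, htr.2.2.1, mul_zero]
  · rw [hk, htr.2.2.2, (oscTrace_uMat_conj _ σ τ hα).1, (oscTrace_uMat_conj _ σ τ hα).2,
      oscH_qpow_mul hα, oscH_qpow_mul hα]
    simp only [spinPow_spinFun, mulQSpin_spinFun, spinFun_spinFun, ← qpow_add, Matrix.smul_apply,
      smul_eq_mul]
    have e1 (s : ℂ) : -2 * s + s = -1 * s := by ring
    have e2 (s : ℂ) : - -2 * s + -s = 1 * s := by ring
    simp only [e1, e2]
    have hq := qpow_ne_zero η 2
    have e3 : 1 - qpow η (-2) * z = (qpow η 2 - z) * (qpow η 2)⁻¹ := by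
      rw [qpow_neg]
      field_simp
    have e4 : qpow η (-2 - α) = (qpow η 2)⁻¹ * qpow η (-α) := by
      rw [sub_eq_add_neg, qpow_add, qpow_neg]
    rw [e3, e4, siteDen]
    simp only [mul_pow, inv_pow, mul_inv, pow_succ]
    generalize oscNum _ _ (_ * z) n _ σ τ = A
    generalize oscNum _ _ (_ * z) n _ σ τ = B
    field_simp

/-! ### Principal parts of `𝐤_skal` -/

section Poles

open Filter Topology

theorem HasPrincipalPart.laurentCoeff_congr {f f' : ℂ → ℂ} {w : ℂ} {c : Polynomial ℂ}
    (h : HasPrincipalPart f w c) (hf : f' =ᶠ[𝓝[≠] w] f) {j : ℕ} (hj : 1 ≤ j) :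
    laurentCoeff f' w (-(j : ℤ)) = laurentCoeff f w (-(j : ℤ)) := by
  rw [(h.congr hf).laurentCoeff_eq hj, h.laurentCoeff_eq hj]

theorem isRegularPt_iff {η z : ℂ} : IsRegularPt η z ↔ z ≠ 0 ∧ siteDen η z ≠ 0 := by
  simp only [IsRegularPt, siteDen, mul_ne_zero_iff, sub_ne_zero, ne_comm (a := z) (b := 1)]
  tauto

theorem qpow_two_ne_one {η : ℂ} (hq : qpow η 4 ≠ 1) : qpow η 2 ≠ 1 := by
  intro h
  apply hq
  rw [show (4 : ℂ) = 2 + 2 by norm_num, qpow_add, h, one_mul]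

/-- At `z = q^{±2}` the denominator of one site has a simple zero. -/
theorem exists_siteDen_eq {η : ℂ} (hq : qpow η 4 ≠ 1) {ε : ℤ} (hε : ε = 1 ∨ ε = -1) :
    ∃ D : ℂ → ℂ, AnalyticAt ℂ D (qpow η (2 * ε)) ∧ D (qpow η (2 * ε)) ≠ 0 ∧
      ∀ z, siteDen η z = (z - qpow η (2 * ε)) * D z := by
  have h2 := qpow_two_ne_one hq
  have h0 := qpow_ne_zero η 2
  have h4 : qpow η 2 * qpow η 2 ≠ 1 := by
    rw [← qpow_add]
    norm_num
    exact hq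
  rcases hε with rfl | rfl
  · refine ⟨fun z => -((1 - qpow η 2 * z) * (1 - z)), by fun_prop, ?_, fun z => ?_⟩
    · norm_num [sub_eq_zero]
      exact ⟨h4.symm, h2.symm⟩
    · norm_num [siteDen]
      ring
  · have e : qpow η (2 * ((-1 : ℤ) : ℂ)) = (qpow η 2)⁻¹ := by
      rw [← qpow_neg]
      norm_num
    rw [e]
    refine ⟨fun z => -qpow η 2 * ((qpow η 2 - z) * (1 - z)), by fun_prop, ?_, fun z => ?_⟩
    · simp only [ne_eq, mul_eq_zero, neg_eq_zero, h0, false_or, sub_eq_zero, not_or]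
      exact ⟨fun h => h4 (by nth_rw 1 [h]; exact inv_mul_cancel₀ h0),
        fun h => h2 (by rw [← inv_inv (qpow η 2), ← h, inv_one])⟩
    · rw [siteDen]
      field_simp
      ring

theorem eventually_isRegularPt {η : ℂ} (hq : qpow η 4 ≠ 1) {ε : ℤ} (hε : ε = 1 ∨ ε = -1) :
    ∀ᶠ z in 𝓝[≠] qpow η (2 * ε), IsRegularPt η z := by
  obtain ⟨D, hD, hD0, hden⟩ := exists_siteDen_eq hq hε
  filter_upwards [self_mem_nhdsWithin,
    eventually_nhdsWithin_of_eventually_nhds (hD.continuousAt.eventually_ne hD0),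
    eventually_nhdsWithin_of_eventually_nhds
      (continuousAt_id.eventually_ne (qpow_ne_zero η (2 * ε)))] with z hz hz' hz0
  rw [isRegularPt_iff, hden]
  exact ⟨hz0, mul_ne_zero (sub_ne_zero.2 hz) hz'⟩

section PrincipalParts

variable {η α : ℂ} {n : ℕ}

theorem exists_kNum_eq_eval (hα : ∀ m : ℤ, qpow η (2 * (α + m)) ≠ 1) (X : SegOp n) (σ τ : Cfg n) :
    ∃ p : Polynomial ℂ, ∀ z, kNum η α z n (mulQSpin η (spinPow z X)) σ τ = p.eval z := by
  simp only [← spinPow_mulQSpin]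
  exact exists_oscTrace_eq_eval hα
    (auxTransport_mem_polyFamily _ (exists_spinPow_eq_eval (mulQSpin η X)) σ τ 1 0)

theorem exists_oscNum_eq_eval (hα : ∀ m : ℤ, qpow η (2 * (α + m)) ≠ 1) (X : SegOp n)
    (σ τ : Cfg n) :
    ∃ p : Polynomial ℂ, ∀ z, oscNum η α z n (mulQSpin η (spinPow z X)) σ τ = p.eval z := by
  simp only [← spinPow_mulQSpin]
  exact exists_oscTrace_eq_eval hα
    (oscTransport_mem_polyFamily _ (exists_spinPow_eq_eval (mulQSpin η X)) σ τ)

/-- The poles of `𝐤_skal` at `q^{±2}` have order at most the number of sites. -/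
theorem exists_hasPrincipalPart_kSkal (hq : qpow η 4 ≠ 1)
    (hα : ∀ m : ℤ, qpow η (2 * (α + m)) ≠ 1) {ε : ℤ} (hε : ε = 1 ∨ ε = -1) (X : SegOp n)
    (σ τ : Cfg n) : ∃ c : Polynomial ℂ, (∀ j, n < j → c.coeff j = 0) ∧
      HasPrincipalPart (fun z => kSkal η α n z X σ τ) (qpow η (2 * ε)) c := by
  obtain ⟨D, hD, hD0, hden⟩ := exists_siteDen_eq hq hε
  obtain ⟨p, hp⟩ := exists_kNum_eq_eval hα X σ τ
  have hw := qpow_ne_zero η (2 * ε)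
  have hpa : AnalyticAt ℂ (fun z => p.eval z) (qpow η (2 * ε)) :=
    (p.differentiable.analyticAt _)
  refine HasPrincipalPart.exists_of_pow_mul
    (h := fun z => (D z)⁻¹ ^ n * (z ^ (n + 1))⁻¹ * p.eval z) ?_ ?_
  · exact (((hD.inv hD0).pow n).mul ((analyticAt_id.pow (n + 1)).inv (pow_ne_zero _ hw))).mul hpa
  · filter_upwards [eventually_isRegularPt hq hε] with z hz
    rw [kSkal_eq hα hz, Matrix.smul_apply, hp, smul_eq_mul, hden, mul_inv, mul_pow]
    ring

theorem analyticAt_oscH (hα : ∀ m : ℤ, qpow η (2 * (α + m)) ≠ 1) (X : SegOp n) (σ τ : Cfg n)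
    {w : ℂ} (hw0 : w ≠ 0) (hw1 : w ≠ 1) : AnalyticAt ℂ (fun z => oscH η α n z X σ τ) w := by
  obtain ⟨p, hp⟩ := exists_oscNum_eq_eval hα X σ τ
  have hpa : AnalyticAt ℂ (fun z => p.eval z) w := p.differentiable.analyticAt _
  simp only [oscH, Matrix.smul_apply, hp, smul_eq_mul]
  exact ((((analyticAt_const.sub analyticAt_id).pow (n + 1)).inv
    (pow_ne_zero _ (sub_ne_zero.2 hw1.symm))).mul
      ((analyticAt_id.pow n).inv (pow_ne_zero _ hw0))).mul hpa

theorem exists_hasPrincipalPart_oscH (hα : ∀ m : ℤ, qpow η (2 * (α + m)) ≠ 1) (X : SegOp n)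
    (σ τ : Cfg n) : ∃ c, HasPrincipalPart (fun z => oscH η α n z X σ τ) 1 c := by
  obtain ⟨p, hp⟩ := exists_oscNum_eq_eval hα X σ τ
  have hpa : AnalyticAt ℂ (fun z => p.eval z) 1 := p.differentiable.analyticAt _
  have h := HasPrincipalPart.exists_of_pow_mul (n := n + 1) (w := 1)
    (f := fun z => oscH η α n z X σ τ) (h := fun z => (-1) ^ (n + 1) * (z ^ n)⁻¹ * p.eval z)
    ((analyticAt_const.mul ((analyticAt_id.pow n).inv (pow_ne_zero _ one_ne_zero))).mul hpa)
    (Eventually.of_forall fun z => by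
      rw [oscH, Matrix.smul_apply, hp, smul_eq_mul, ← neg_sub z 1, neg_pow, mul_inv, ← inv_pow,
        inv_neg_one, inv_pow]
      ring)
  exact h.imp fun c hc => hc.2

/-! ### The Laurent coefficients at `q^{±2}` -/

section Rho

variable {ε : ℤ} {j : ℕ}

theorem kSkal_add (hα : ∀ m : ℤ, qpow η (2 * (α + m)) ≠ 1) {z : ℂ} (hz : IsRegularPt η z)
    (X Y : SegOp n) : kSkal η α n z (X + Y) = kSkal η α n z X + kSkal η α n z Y := by
  rw [kSkal_eq hα hz, kSkal_eq hα hz, kSkal_eq hα hz, spinPow_add, mulQSpin_add, kNum_add _ _ _ hα,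
    smul_add]

theorem kSkal_smul (hα : ∀ m : ℤ, qpow η (2 * (α + m)) ≠ 1) {z : ℂ} (hz : IsRegularPt η z)
    (r : ℂ) (X : SegOp n) : kSkal η α n z (r • X) = r • kSkal η α n z X := by
  rw [kSkal_eq hα hz, kSkal_eq hα hz, spinPow_smul, mulQSpin_smul, kNum_smul _ _ hα, smul_comm]

theorem rho_eq_zero (hq : qpow η 4 ≠ 1) (hα : ∀ m : ℤ, qpow η (2 * (α + m)) ≠ 1)
    (hε : ε = 1 ∨ ε = -1) (hj : n < j) (X : SegOp n) : rho η α n ε j X = 0 := by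
  ext σ τ
  obtain ⟨c, hc, h⟩ := exists_hasPrincipalPart_kSkal hq hα hε X σ τ
  exact (h.laurentCoeff_eq (by omega)).trans (hc j hj)

theorem rho_add (hq : qpow η 4 ≠ 1) (hα : ∀ m : ℤ, qpow η (2 * (α + m)) ≠ 1)
    (hε : ε = 1 ∨ ε = -1) (hj : 1 ≤ j) (X Y : SegOp n) :
    rho η α n ε j (X + Y) = rho η α n ε j X + rho η α n ε j Y := by
  ext σ τ
  obtain ⟨c, -, h⟩ := exists_hasPrincipalPart_kSkal hq hα hε X σ τ
  obtain ⟨c', -, h'⟩ := exists_hasPrincipalPart_kSkal hq hα hε Y σ τ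
  have hs : HasPrincipalPart (fun z => kSkal η α n z (X + Y) σ τ) (qpow η (2 * ε)) (c + c') := by
    refine (h.add h').congr ?_
    filter_upwards [eventually_isRegularPt hq hε] with z hz
    rw [kSkal_add hα hz, Matrix.add_apply]
  rw [Matrix.add_apply, rho, rho, rho, hs.laurentCoeff_eq hj, h.laurentCoeff_eq hj,
    h'.laurentCoeff_eq hj, Polynomial.coeff_add]

theorem rho_smul (hq : qpow η 4 ≠ 1) (hα : ∀ m : ℤ, qpow η (2 * (α + m)) ≠ 1)
    (hε : ε = 1 ∨ ε = -1) (hj : 1 ≤ j) (r : ℂ) (X : SegOp n) :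
    rho η α n ε j (r • X) = r • rho η α n ε j X := by
  ext σ τ
  obtain ⟨c, -, h⟩ := exists_hasPrincipalPart_kSkal hq hα hε X σ τ
  have hs : HasPrincipalPart (fun z => kSkal η α n z (r • X) σ τ) (qpow η (2 * ε))
      (Polynomial.C r * c) := by
    refine (h.const_mul r).congr ?_
    filter_upwards [eventually_isRegularPt hq hε] with z hz
    rw [kSkal_smul hα hz, Matrix.smul_apply, smul_eq_mul]
  rw [Matrix.smul_apply, rho, rho, hs.laurentCoeff_eq hj, h.laurentCoeff_eq hj,
    Polynomial.coeff_C_mul, smul_eq_mul]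

theorem rho_tensorId_one_self (hq : qpow η 4 ≠ 1) (hα : ∀ m : ℤ, qpow η (2 * (α + m)) ≠ 1)
    (hε : ε = 1 ∨ ε = -1) (hj : 1 ≤ j) (X : SegOp n) (σ τ : Cfg n) (κ : Fin 2) :
    rho η α (n + 1) ε j (tensorId 1 X) (snocCfg σ κ) (snocCfg τ κ) = rho η α n ε j X σ τ := by
  obtain ⟨c, -, h⟩ := exists_hasPrincipalPart_kSkal hq hα hε X σ τ
  refine h.laurentCoeff_congr ?_ hj
  filter_upwards [eventually_isRegularPt hq hε] with z hz
  exact (kSkal_tensorId_one hα hz X σ τ).1 κ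

theorem rho_tensorId_one_one_zero (hq : qpow η 4 ≠ 1) (hα : ∀ m : ℤ, qpow η (2 * (α + m)) ≠ 1)
    (hε : ε = 1 ∨ ε = -1) (hj : 1 ≤ j) (X : SegOp n) (σ τ : Cfg n) :
    rho η α (n + 1) ε j (tensorId 1 X) (snocCfg σ 1) (snocCfg τ 0) = 0 := by
  have h0 : HasPrincipalPart (fun z =>
      kSkal η α (n + 1) z (tensorId 1 X) (snocCfg σ 1) (snocCfg τ 0)) (qpow η (2 * ε)) 0 := by
    refine (HasPrincipalPart.of_analyticAt (f := 0) analyticAt_const).congr ?_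
    filter_upwards [eventually_isRegularPt hq hε] with z hz
    exact (kSkal_tensorId_one hα hz X σ τ).2.1
  exact h0.laurentCoeff_eq hj

/-- In the block `⟨0| |1⟩` the negative Laurent coefficients at `q⁻²` and at `q²` are, up to
factors, those of the same function `H` at `1`, since only one of the two terms is singular there. -/
theorem rho_tensorId_one_zero_one (hq : qpow η 4 ≠ 1) (hα : ∀ m : ℤ, qpow η (2 * (α + m)) ≠ 1)
    (hj : 1 ≤ j) (X : SegOp n) (σ τ : Cfg n) {c : Polynomial ℂ}
    (hc : HasPrincipalPart (fun z => oscH η α n z X σ τ) 1 c) (r : ℂ) :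
    rho η α (n + 1) (-1) j (tensorId 1 (spinFun (fun s => qpow η (r - s)) X))
      (snocCfg σ 0) (snocCfg τ 1) = (1 - qpow η 2) * qpow η (α + r - 2 * j) * c.coeff j ∧
    rho η α (n + 1) 1 j (tensorId 1 (spinFun (fun s => qpow η (r + s)) X))
      (snocCfg σ 0) (snocCfg τ 1) =
        -((1 - qpow η 2) * qpow η (-2 - α + r + 2 * j) * c.coeff j) := by
  have h2 := qpow_ne_zero η 2
  have hm2 := qpow_ne_zero η (-2)
  have hq2 : qpow η 2 * qpow η 2 ≠ 1 := by
    rw [← qpow_add]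
    norm_num
    exact hq
  have hqm2 : qpow η (-2) * qpow η (-2) ≠ 1 := by
    rw [qpow_neg, ← mul_inv]
    exact inv_ne_one.2 hq2
  have hana {a w : ℂ} (h0 : a * w ≠ 0) (h1 : a * w ≠ 1) (Y : SegOp n) :
      AnalyticAt ℂ (fun z => oscH η α n (a * z) Y σ τ) w :=
    (analyticAt_oscH hα Y σ τ h0 h1).comp_of_eq (f := fun z => a * z) (by fun_prop) rfl
  constructor
  · have hw : qpow η (2 * ((-1 : ℤ) : ℂ)) = qpow η (-2) := by norm_num
    have hp1 : HasPrincipalPart (fun z => oscH η α n (qpow η 2 * z) X σ τ)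
        (qpow η (2 * ((-1 : ℤ) : ℂ))) (c.comp (Polynomial.C (qpow η 2)⁻¹ * Polynomial.X)) := by
      refine HasPrincipalPart.comp_mul (f := fun z => oscH η α n z X σ τ) h2 ?_
      rwa [hw, qpow_neg, mul_inv_cancel₀ h2]
    -- `H (q⁻² z)` is regular at `q⁻²`, since `q⁻⁴ ≠ 1`.
    have hp2 := HasPrincipalPart.of_analyticAt (hana (a := qpow η (-2))
      (w := qpow η (2 * ((-1 : ℤ) : ℂ))) (by rw [hw]; exact mul_ne_zero hm2 hm2) (by rwa [hw])
      (spinFun (fun s => qpow η (r - 2 * s)) X))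
    have hp := (hp1.const_mul ((1 - qpow η 2) * qpow η (α + r))).add
      (hp2.const_mul (-((1 - qpow η 2) * qpow η (-2 - α))))
    rw [rho, (hp.congr _).laurentCoeff_eq hj]
    · have he : (qpow η 2)⁻¹ ^ j = qpow η (-(2 * j)) := by
        rw [qpow_neg, qpow_natCast_mul, inv_pow]
      simp only [mul_zero, add_zero, Polynomial.coeff_C_mul, Polynomial.comp_C_mul_X_coeff, he]
      rw [sub_eq_add_neg (α + r), qpow_add η (α + r)]
      ring
    · filter_upwards [eventually_isRegularPt (ε := -1) hq (Or.inr rfl)] with z hz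
      have e1 (s : ℂ) : qpow η s * qpow η (r - s) = qpow η r := by
        rw [← qpow_add]; congr 1; ring
      have e2 (s : ℂ) : qpow η (-s) * qpow η (r - s) = qpow η (r - 2 * s) := by
        rw [← qpow_add]; congr 1; ring
      rw [(kSkal_tensorId_one hα hz _ σ τ).2.2, spinFun_spinFun, spinFun_spinFun]
      simp only [e1, e2, spinFun_const]
      rw [oscH_smul hα, Matrix.smul_apply, smul_eq_mul, qpow_add]
      ring
  · have hw : qpow η (2 * ((1 : ℤ) : ℂ)) = qpow η 2 := by norm_num
    have hp1 : HasPrincipalPart (fun z => oscH η α n (qpow η (-2) * z) X σ τ)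
        (qpow η (2 * ((1 : ℤ) : ℂ))) (c.comp (Polynomial.C (qpow η (-2))⁻¹ * Polynomial.X)) := by
      refine HasPrincipalPart.comp_mul (f := fun z => oscH η α n z X σ τ) hm2 ?_
      rwa [hw, qpow_neg, inv_mul_cancel₀ h2]
    -- `H (q² z)` is regular at `q²`, since `q⁴ ≠ 1`.
    have hp2 := HasPrincipalPart.of_analyticAt (hana (a := qpow η 2)
      (w := qpow η (2 * ((1 : ℤ) : ℂ))) (by rw [hw]; exact mul_ne_zero h2 h2) (by rwa [hw])
      (spinFun (fun s => qpow η (r + 2 * s)) X))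
    have hp := (hp1.const_mul (-((1 - qpow η 2) * qpow η (-2 - α + r)))).add
      (hp2.const_mul ((1 - qpow η 2) * qpow η α))
    rw [rho, (hp.congr _).laurentCoeff_eq hj]
    · simp only [mul_zero, add_zero, Polynomial.coeff_C_mul, Polynomial.comp_C_mul_X_coeff,
        qpow_neg, inv_inv]
      rw [qpow_add η (-2 - α + r), qpow_natCast_mul]
      ring
    · filter_upwards [eventually_isRegularPt (ε := 1) hq (Or.inl rfl)] with z hz
      have e1 (s : ℂ) : qpow η (-s) * qpow η (r + s) = qpow η r := by
        rw [← qpow_add]; congr 1; ring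
      have e2 (s : ℂ) : qpow η s * qpow η (r + s) = qpow η (r + 2 * s) := by
        rw [← qpow_add]; congr 1; ring
      rw [(kSkal_tensorId_one hα hz _ σ τ).2.2, spinFun_spinFun, spinFun_spinFun]
      simp only [e1, e2, spinFun_const]
      rw [oscH_smul hα, Matrix.smul_apply, smul_eq_mul, qpow_add η (-2 - α)]
      ring

end Rho

end PrincipalParts

end Poles

/-! ### The modes on a segment -/

section Modes

variable {η α : ℂ} {n : ℕ}

/-- The condition on `α` is symmetric under `α ↦ -α`; the modes `b_p(α)` are built from
`c_p(-α)`. -/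
theorem qpow_neg_shift_ne_one (hα : ∀ m : ℤ, qpow η (2 * (α + m)) ≠ 1) (m : ℤ) :
    qpow η (2 * (-α + m)) ≠ 1 := by
  have h : 2 * (-α + m) = -(2 * (α + (-m : ℤ))) := by
    push_cast
    ring
  rw [h, qpow_neg]
  exact inv_ne_one.2 (hα _)

section CCoeff

variable {j : ℕ}

theorem cCoeff_eq_zero (hq : qpow η 4 ≠ 1) (hα : ∀ m : ℤ, qpow η (2 * (α + m)) ≠ 1) (hj : n < j)
    (X : SegOp n) : cCoeff η α n j X = 0 := by
  rw [cCoeff, rho_eq_zero hq hα (Or.inr rfl) hj, rho_eq_zero hq hα (Or.inl rfl) hj, add_zero,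
    smul_zero]

theorem cCoeff_add (hq : qpow η 4 ≠ 1) (hα : ∀ m : ℤ, qpow η (2 * (α + m)) ≠ 1) (hj : 1 ≤ j)
    (X Y : SegOp n) : cCoeff η α n j (X + Y) = cCoeff η α n j X + cCoeff η α n j Y := by
  rw [cCoeff, spinFun_add, spinFun_add, rho_add hq hα (Or.inr rfl) hj,
    rho_add hq hα (Or.inl rfl) hj, cCoeff, cCoeff, ← smul_add, add_add_add_comm]

theorem cCoeff_smul (hq : qpow η 4 ≠ 1) (hα : ∀ m : ℤ, qpow η (2 * (α + m)) ≠ 1) (hj : 1 ≤ j)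
    (r : ℂ) (X : SegOp n) : cCoeff η α n j (r • X) = r • cCoeff η α n j X := by
  rw [cCoeff, spinFun_smul, spinFun_smul, rho_smul hq hα (Or.inr rfl) hj,
    rho_smul hq hα (Or.inl rfl) hj, ← smul_add, smul_comm, cCoeff]

/-- The two Laurent coefficients in `c_j` are weighted in such a way that the contributions of the
block `⟨0| |1⟩` of the new site cancel. -/
theorem cCoeff_tensorId_one (hq : qpow η 4 ≠ 1) (hα : ∀ m : ℤ, qpow η (2 * (α + m)) ≠ 1)
    (hj : 1 ≤ j) (X : SegOp n) :
    cCoeff η α (n + 1) j (tensorId 1 X) = tensorId 1 (cCoeff η α n j X) := by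
  have hdiag (σ τ : Cfg n) (κ : Fin 2) :
      cCoeff η α (n + 1) j (tensorId 1 X) (snocCfg σ κ) (snocCfg τ κ) =
        cCoeff η α n j X σ τ := by
    simp only [cCoeff, spinFun_tensorId_one, Matrix.smul_apply, Matrix.add_apply,
      rho_tensorId_one_self hq hα (Or.inr rfl) hj, rho_tensorId_one_self hq hα (Or.inl rfl) hj]
  have h10 (σ τ : Cfg n) :
      cCoeff η α (n + 1) j (tensorId 1 X) (snocCfg σ 1) (snocCfg τ 0) = 0 := by
    simp only [cCoeff, spinFun_tensorId_one, Matrix.smul_apply, Matrix.add_apply,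
      rho_tensorId_one_one_zero hq hα (Or.inr rfl) hj,
      rho_tensorId_one_one_zero hq hα (Or.inl rfl) hj, add_zero, smul_zero]
  have h01 (σ τ : Cfg n) :
      cCoeff η α (n + 1) j (tensorId 1 X) (snocCfg σ 0) (snocCfg τ 1) = 0 := by
    obtain ⟨c, hc⟩ := exists_hasPrincipalPart_oscH hα X σ τ
    have e1 : (fun s => qpow η (2 * j - α - s - 1)) = fun s => qpow η ((2 * j - α - 1) - s) := by
      funext s
      congr 1
      ring
    have e2 : (fun s => qpow η (α + s + 1 - 2 * j)) = fun s => qpow η ((α + 1 - 2 * j) + s) := by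
      funext s
      congr 1
      ring
    rw [cCoeff, e1, e2, spinFun_tensorId_one, spinFun_tensorId_one, Matrix.smul_apply,
      Matrix.add_apply, (rho_tensorId_one_zero_one hq hα hj X σ τ hc _).1,
      (rho_tensorId_one_zero_one hq hα hj X σ τ hc _).2]
    -- Both contributions are `(1 - q²) q⁻¹` times the same coefficient, with opposite signs.
    have e3 : α + (2 * j - α - 1) - 2 * j = -1 := by ring
    have e4 : -2 - α + (α + 1 - 2 * j) + 2 * j = -1 := by ring
    rw [e3, e4, add_neg_cancel, smul_zero]
  ext σ τ
  obtain ⟨σ, κ, rfl⟩ := exists_snocCfg σ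
  obtain ⟨τ, κ', rfl⟩ := exists_snocCfg τ
  rw [tensorId_one_snocCfg]
  split_ifs with h
  · rw [h, hdiag]
  · rcases Fin.exists_fin_two.1 ⟨κ, rfl⟩ with h0 | h0 <;>
      rcases Fin.exists_fin_two.1 ⟨κ', rfl⟩ with h0' | h0' <;> subst h0 <;> subst h0'
    · exact absurd rfl h
    · exact h01 σ τ
    · exact h10 σ τ
    · exact absurd rfl h

end CCoeff

section CMode

variable {p : ℕ}

theorem cMode_eq_zero (hq : qpow η 4 ≠ 1) (hα : ∀ m : ℤ, qpow η (2 * (α + m)) ≠ 1) (hp : n < p)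
    (X : SegOp n) : cMode η α n p X = 0 := by
  rw [cMode, if_neg (by omega), cCoeff_eq_zero hq hα hp]

theorem cMode_add (hq : qpow η 4 ≠ 1) (hα : ∀ m : ℤ, qpow η (2 * (α + m)) ≠ 1)
    (X Y : SegOp n) : cMode η α n p (X + Y) = cMode η α n p X + cMode η α n p Y := by
  simp only [cMode]
  split_ifs with hp
  · rw [← smul_add, ← Finset.sum_add_distrib]
    congr 1
    refine Finset.sum_congr rfl fun j hj => ?_
    rw [cCoeff_add hq hα (Finset.mem_Icc.1 hj).1, smul_add]
  · exact cCoeff_add hq hα (by omega) X Y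

theorem cMode_smul (hq : qpow η 4 ≠ 1) (hα : ∀ m : ℤ, qpow η (2 * (α + m)) ≠ 1) (r : ℂ)
    (X : SegOp n) : cMode η α n p (r • X) = r • cMode η α n p X := by
  simp only [cMode]
  split_ifs with hp
  · rw [smul_comm r, Finset.smul_sum (r := r)]
    congr 1
    refine Finset.sum_congr rfl fun j hj => ?_
    rw [cCoeff_smul hq hα (Finset.mem_Icc.1 hj).1, smul_comm]
  · exact cCoeff_smul hq hα (by omega) r X

/-- For `p = 0` the sum on `n + 1` sites has one more term, which vanishes by `cCoeff_eq_zero`. -/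
theorem cMode_tensorId_one (hq : qpow η 4 ≠ 1) (hα : ∀ m : ℤ, qpow η (2 * (α + m)) ≠ 1)
    (X : SegOp n) : cMode η α (n + 1) p (tensorId 1 X) = tensorId 1 (cMode η α n p X) := by
  let T : SegOp n →ₗ[ℂ] SegOp (n + 1) :=
    { toFun := tensorId 1
      map_add' := tensorId_add 1
      map_smul' := tensorId_smul 1 }
  simp only [cMode]
  split_ifs with hp
  · change _ = T _
    rw [map_smul, map_sum, Finset.sum_Icc_succ_top (by omega)]
    rw [cCoeff_tensorId_one hq hα (by omega), cCoeff_eq_zero hq hα (Nat.lt_succ_self n),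
      tensorId_zero_right, smul_zero, add_zero]
    congr 1
    refine Finset.sum_congr rfl fun j hj => ?_
    rw [cCoeff_tensorId_one hq hα (Finset.mem_Icc.1 hj).1, map_smul]
    rfl
  · exact cCoeff_tensorId_one hq hα (by omega) X

variable (x : Annihilator)

theorem mode_eq_zero (hq : qpow η 4 ≠ 1) (hα : ∀ m : ℤ, qpow η (2 * (α + m)) ≠ 1) (hp : n < p)
    (X : SegOp n) : mode x η α n p X = 0 := by
  cases x with
  | b =>
    change bMode η α n p X = 0
    rw [bMode, cMode_eq_zero hq (qpow_neg_shift_ne_one hα) hp]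
    ext
    simp [spinFun, spinFlip]
  | c => exact cMode_eq_zero hq hα hp X

theorem mode_add (hq : qpow η 4 ≠ 1) (hα : ∀ m : ℤ, qpow η (2 * (α + m)) ≠ 1)
    (X Y : SegOp n) : mode x η α n p (X + Y) = mode x η α n p X + mode x η α n p Y := by
  cases x with
  | b =>
    change bMode η α n p (X + Y) = bMode η α n p X + bMode η α n p Y
    rw [bMode, spinFlip_add, cMode_add hq (qpow_neg_shift_ne_one hα), spinFlip_add, spinFun_add]
    rfl
  | c => exact cMode_add hq hα X Y

theorem mode_smul (hq : qpow η 4 ≠ 1) (hα : ∀ m : ℤ, qpow η (2 * (α + m)) ≠ 1) (r : ℂ)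
    (X : SegOp n) : mode x η α n p (r • X) = r • mode x η α n p X := by
  cases x with
  | b =>
    change bMode η α n p (r • X) = r • bMode η α n p X
    rw [bMode, spinFlip_smul, cMode_smul hq (qpow_neg_shift_ne_one hα), spinFlip_smul,
      spinFun_smul]
    rfl
  | c => exact cMode_smul hq hα r X

theorem mode_tensorId_one (hq : qpow η 4 ≠ 1) (hα : ∀ m : ℤ, qpow η (2 * (α + m)) ≠ 1)
    (X : SegOp n) : mode x η α (n + 1) p (tensorId 1 X) = tensorId 1 (mode x η α n p X) := by
  cases x with
  | b =>
    change bMode η α (n + 1) p (tensorId 1 X) = tensorId 1 (bMode η α n p X)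
    rw [bMode, spinFlip_tensorId_one, cMode_tensorId_one hq (qpow_neg_shift_ne_one hα),
      spinFlip_tensorId_one, spinFun_tensorId_one]
    rfl
  | c => exact cMode_tensorId_one hq hα X

theorem mode_tensorId (hq : qpow η 4 ≠ 1) (hα : ∀ m : ℤ, qpow η (2 * (α + m)) ≠ 1) (m : ℕ)
    (X : SegOp n) : mode x η α (n + m) p (tensorId m X) = tensorId m (mode x η α n p X) := by
  induction m with
  | zero =>
    simp only [tensorId_zero]
    rfl
  | succ m ih =>
    rw [tensorId_succ m, tensorId_succ m, ← ih]
    exact mode_tensorId_one x hq hα (tensorId m X)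

end CMode

end Modes

/-! ### Local operators -/

theorem tensorIdInf_tensorId {n : ℕ} (m : ℕ) (X : SegOp n) :
    tensorIdInf (n + m) (tensorId m X) = tensorIdInf n X := by
  classical
  ext σ τ
  refine (ite_and _ _ _ _).symm.trans (if_congr ⟨fun h i hi => ?_, fun h =>
    ⟨fun i hi => h i (by omega), fun i => ?_⟩⟩ rfl rfl)
  · by_cases him : n + m ≤ i
    · exact h.1 i him
    · have := h.2 ⟨i - n, by omega⟩
      simpa [Nat.add_sub_cancel' hi] using this
  · exact h _ (by simp)

theorem toLocal_tensorId {n : ℕ} (m : ℕ) (X : SegOp n) :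
    toLocal (n + m) (tensorId m X) = toLocal n X :=
  Subtype.ext (tensorIdInf_tensorId m X)

theorem toLocal_injective (n : ℕ) : Function.Injective (toLocal n) := by
  intro X Y h
  have h' : tensorIdInf n X = tensorIdInf n Y := congrArg Subtype.val h
  ext σ τ
  -- Extend configurations of the segment by a constant one.
  let E (σ : Cfg n) : ℕ → Fin 2 := fun i => if hi : i < n then σ ⟨i, hi⟩ else 0
  have hE (σ : Cfg n) : (fun i : Fin n => E σ i) = σ := by
    funext i
    simp [E]
  have hE' : ∀ i, n ≤ i → E σ i = E τ i := fun i hi => by simp [E, hi.not_gt]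
  have := congrFun (congrFun h' (E σ)) (E τ)
  simpa only [tensorIdInf, LinearMap.coe_mk, AddHom.coe_mk, Matrix.of_apply, if_pos hE', hE]
    using this

theorem exists_toLocal_eq (X : localOps) : ∃ (n : ℕ) (Y : SegOp n), toLocal n Y = X := by
  have hdir : Directed (· ≤ ·) fun n => LinearMap.range (tensorIdInf n) := by
    refine (monotone_nat_of_le_succ fun n => ?_).directed_le
    rintro _ ⟨Y, rfl⟩
    exact ⟨tensorId 1 Y, tensorIdInf_tensorId 1 Y⟩
  obtain ⟨n, Y, hY⟩ := (Submodule.mem_iSup_of_directed _ hdir).1 X.2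
  exact ⟨n, Y, Subtype.ext hY⟩

theorem exists_toLocal_eq_of_length (X : localOps) : ∃ Y : SegOp (length X),
    toLocal (length X) Y = X :=
  Nat.sInf_mem (s := {n | ∃ Y : SegOp n, toLocal n Y = X}) (exists_toLocal_eq X)

section Extension

/-- A family of linear maps on the segments that commutes with `X ↦ X ⊗ id` has exactly one linear
extension to the local operators. -/
theorem existsUnique_extension (F : (n : ℕ) → SegOp n → SegOp n)
    (hadd : ∀ n X Y, F n (X + Y) = F n X + F n Y) (hsmul : ∀ n (r : ℂ) X, F n (r • X) = r • F n X)
    (hF : ∀ n m X, F (n + m) (tensorId m X) = tensorId m (F n X)) :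
    ∃! T : Module.End ℂ localOps, ∀ n X, T (toLocal n X) = toLocal n (F n X) := by
  have hle {n n' : ℕ} (hn : n ≤ n') {Y : SegOp n} {Y' : SegOp n'}
      (h : toLocal n Y = toLocal n' Y') : toLocal n (F n Y) = toLocal n' (F n' Y') := by
    obtain ⟨m, rfl⟩ := Nat.exists_eq_add_of_le hn
    rw [← toLocal_tensorId m] at h
    rw [← toLocal_injective _ h, hF, toLocal_tensorId]
  have hwd {n n' : ℕ} {Y : SegOp n} {Y' : SegOp n'} (h : toLocal n Y = toLocal n' Y') :
      toLocal n (F n Y) = toLocal n' (F n' Y') := by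
    rcases le_total n n' with hn | hn
    · exact hle hn h
    · exact (hle hn h.symm).symm
  choose N R hR using exists_toLocal_eq
  have hT (n : ℕ) (Y : SegOp n) :
      toLocal (N (toLocal n Y)) (F _ (R (toLocal n Y))) = toLocal n (F n Y) := hwd (hR _)
  have hpair (X X' : localOps) :
      ∃ (n : ℕ) (Y Y' : SegOp n), toLocal n Y = X ∧ toLocal n Y' = X' := by
    obtain ⟨n, Y, rfl⟩ := exists_toLocal_eq X
    obtain ⟨n', Y', rfl⟩ := exists_toLocal_eq X'
    rcases le_total n n' with hn | hn
    · obtain ⟨m, rfl⟩ := Nat.exists_eq_add_of_le hn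
      exact ⟨_, tensorId m Y, Y', toLocal_tensorId m Y, rfl⟩
    · obtain ⟨m, rfl⟩ := Nat.exists_eq_add_of_le hn
      exact ⟨_, Y, tensorId m Y', rfl, toLocal_tensorId m Y'⟩
  refine ⟨{ toFun := fun X => toLocal (N X) (F _ (R X)), map_add' := ?_, map_smul' := ?_ },
    fun n X => hT n X, fun T' hT' => ?_⟩
  · intro X X'
    obtain ⟨n, Y, Y', rfl, rfl⟩ := hpair X X'
    rw [← map_add, hT, hT, hT, hadd, map_add]
  · intro r X
    obtain ⟨n, Y, rfl⟩ := exists_toLocal_eq X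
    rw [← map_smul, hT, hT, hsmul, map_smul, RingHom.id_apply]
  · refine LinearMap.ext fun X => ?_
    obtain ⟨n, Y, rfl⟩ := exists_toLocal_eq X
    rw [hT']
    exact (hT n Y).symm

end Extension

end XXZ

end

theorem mainTheorem7 (η α : ℂ) (hq : XXZ.qpow η 4 ≠ 1)
    (hα : ∀ m : ℤ, XXZ.qpow η (2 * (α + m)) ≠ 1) (x : XXZ.Annihilator) (p : ℕ) :
    (∀ (n m : ℕ) (X : XXZ.SegOp n),
      XXZ.mode x η α (n + m) p (XXZ.tensorId m X) =
        if p ≤ n then XXZ.tensorId m (XXZ.mode x η α n p X) else 0) ∧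
    (∃! T : Module.End ℂ XXZ.localOps, XXZ.ExtendsModes x η α p T) ∧
    (∀ T : Module.End ℂ XXZ.localOps, XXZ.ExtendsModes x η α p T →
      (∀ (n : ℕ) (X : XXZ.SegOp n),
        T (XXZ.toLocal n X) =
          if p ≤ n then XXZ.toLocal n (XXZ.mode x η α n p X) else 0) ∧
      ∀ X : XXZ.localOps, XXZ.length X < p → T X = 0) := by
  refine ⟨fun n m X => ?_, ?_, fun T hT => ?_⟩
  · rw [XXZ.mode_tensorId x hq hα]
    split_ifs with hp
    · rfl
    · rw [XXZ.mode_eq_zero x hq hα (not_le.1 hp), XXZ.tensorId_zero_right]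
  · exact XXZ.existsUnique_extension (fun n => XXZ.mode x η α n p)
      (fun n => XXZ.mode_add x hq hα) (fun n => XXZ.mode_smul x hq hα)
      fun n m => XXZ.mode_tensorId x hq hα m
  · have h0 {n : ℕ} (hp : n < p) (X : XXZ.SegOp n) : T (XXZ.toLocal n X) = 0 := by
      rw [hT, XXZ.mode_eq_zero x hq hα hp, map_zero]
    refine ⟨fun n X => ?_, fun X hX => ?_⟩
    · split_ifs with hp
      · exact hT n X
      · exact h0 (not_le.1 hp) X
    · obtain ⟨Y, hY⟩ := XXZ.exists_toLocal_eq_of_length X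
      rw [← hY]
      exact h0 hX Y
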